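/- **Conventions.** Manifolds are smooth, finite-dimensional, without boundary, Hausdorff and second countable. A $\mathbb Z$-graded vector bundle $V_\bullet\to M$ is a family $(V_i)_{i\in\mathbb Z}$ of smooth real vector bundles of finite rank over $M$; its dual is taken degreewise, linear functions on $V_i$ having degree $-i$, and $V[k]_i=V_{k+i}$. Let $\Gamma(S^{\ge 0}V_\bullet^*)$ be the $\mathbb Z$-graded algebra of finite sums of homogeneous smooth sections of the bundle of graded-symmetric algebras $S^{\ge0}V^*_\bullet$, where a section is smooth if near each point it is a polynomial in smooth functions and smooth sections of the $V_i^*$. A $\mathbb Z$-graded manifold $\mathcal M$ is a $\mathbb Z$-graded, graded-commutative real algebra $C(\mathcal M)$ that is isomorphic to $\Gamma(S^{\ge0}V_\bullet^*)$ for some $V_\bullet\to M$; a choice of such an isomorphism is a splitting of $\mathcal M$ by $V_\bullet$. A morphism $\mathcal M\to\mathcal N$ is a morphism of graded algebras $C(\mathcal N)\to C(\mathcal M)$. Let $D=\mathbb R[-1]$ be the graded manifold over a point with $C(D)=\mathbb R[\epsilon]$, $\deg\epsilon=-1$, $\epsilon^2=0$; put $C(D\times\mathcal T)=C(D)\otimes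 C(\mathcal T)$ (graded tensor product), and let $\mathrm{Hom}(D,\mathcal M)$ be the presheaf $\mathcal T\mapsto \hom(D\times\mathcal T,\mathcal M)$ on $\mathbb Z$-graded manifolds. Let $T[1]M$ be the graded vector bundle with $TM$ in degree $-1$ and zero in all other degrees. **Theorem.** Let $\mathcal M$ be a $\mathbb Z$-graded manifold with a splitting by $V_\bullet\to M$. Then the presheaf $\mathrm{Hom}(D,\mathcal M)$ is representable; a representing object is denoted $T[1]\mathcal M$. Moreover, a connection $\nabla$ on $V_\bullet^*$ (that is, a connection on each $V_i^*$) induces a splitting of $T[1]\mathcal M$ by $V_\bullet\oplus T[1]M\oplus V[1]_\bullet$: for every representing object $T[1]\mathcal M$ there is a unique isomorphism $C(T[1]\mathcal M)\cong\Gamma(S^{\ge0}(V_\bullet\oplus T[1]M\oplus V[1]_\bullet)^*)$ of graded algebras under which the universal morphism $C(\mathcal M)\to C(D)\otimes C(T[1]\mathcal M)$ takes the form $$f\mapsto f+\epsilon\, df\quad (f\in C^\infty(M)),\qquad \sigma\mapsto\sigma+\epsilon\,(\sigma[1]+\nabla\sigma)\quad(\sigma\in\Gamma(V_i^*),\ i\in\mathbb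 Z),$$ where $df\in\Gamma((T[1]M)^*)$, $\sigma[1]$ is $\sigma$ regarded as a section of $V[1]_\bullet^*$, and $\nabla\sigma\in\Gamma(T^*M\otimes V_i^*)$ is regarded as an element of arity $2$ through the product of $(T[1]M)^*$ and $V_\bullet^*$ in $S^{\ge0}$. -/

import Mathlib

open CategoryTheory Bundle
open scoped Manifold ContDiff TensorProduct DirectSum Topology

noncomputable section
namespace ZGraded

/-- A `ℤ`-graded (associative, unital) real algebra. -/
structure GrAlg where
  carrier : Type
  [ring : Ring carrier]
  [algebra : Algebra ℝ carrier]
  gr : ℤ → Submodule ℝ carrier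
  [graded : GradedAlgebra gr]

instance : CoeSort GrAlg Type := ⟨GrAlg.carrier⟩
attribute [instance] GrAlg.ring GrAlg.algebra GrAlg.graded

/-- Morphisms are the degree preserving algebra homomorphisms. -/
instance : Category GrAlg where
  Hom A B := A.gr →ₐᵍ[ℝ] B.gr
  id A := GradedAlgHom.id ℝ A.gr
  comp f g := GradedAlgHom.comp g f

instance : ConcreteCategory GrAlg (fun A B => A.gr →ₐᵍ[ℝ] B.gr) where
  hom f := f
  ofHom f := f

/-- A criterion for a spanning family of submodules to be a direct sum decomposition: there are
linear maps `δ d` injective on the `d`-th one and vanishing on the others. -/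
theorem isInternal_of_separated {A B : Type} [AddCommGroup A] [Module ℝ A] [AddCommMonoid B]
    [Module ℝ B] (𝒜 : ℤ → Submodule ℝ A) (htop : ⨆ d, 𝒜 d = ⊤) (δ : ℤ → A →ₗ[ℝ] B)
    (hδ : ∀ d, ∀ a ∈ 𝒜 d, δ d a = 0 → a = 0)
    (hδ' : ∀ d e, d ≠ e → ∀ a ∈ 𝒜 d, δ e a = 0) : DirectSum.IsInternal 𝒜 := by
  refine DirectSum.isInternal_submodule_of_iSupIndep_of_iSup_eq_top ?_ htop
  rw [iSupIndep_def]
  intro d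
  rw [Submodule.disjoint_def]
  intro a ha ha'
  refine hδ d a ha ?_
  have : (⨆ j, ⨆ (_ : j ≠ d), 𝒜 j) ≤ LinearMap.ker (δ d) := by
    refine iSup_le fun j => iSup_le fun hj => fun b hb => ?_
    exact hδ' j d hj b hb
  exact this ha'


/-! ### The algebra spanned by a graded family of submodules -/
section supAlg
variable {A : Type} [Ring A] [Algebra ℝ A] (𝒜 : ℤ → Submodule ℝ A) [SetLike.GradedMonoid 𝒜]

/-- The subalgebra of finite sums of homogeneous elements. -/
def supAlg : Subalgebra ℝ A :=
  (⨆ d, 𝒜 d).toSubalgebra (Submodule.mem_iSup_of_mem 0 SetLike.GradedOne.one_mem) (by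
    intro x y hx hy
    induction hx using Submodule.iSup_induction' with
    | zero => simp
    | add a b _ _ ha hb => rw [add_mul]; exact add_mem ha hb
    | mem i a ha =>
      induction hy using Submodule.iSup_induction' with
      | zero => simp
      | add a b _ _ ha hb => rw [mul_add]; exact add_mem ha hb
      | mem j b hb => exact Submodule.mem_iSup_of_mem (i + j) (SetLike.GradedMul.mul_mem ha hb))

theorem mem_supAlg {d : ℤ} {a : A} (ha : a ∈ 𝒜 d) : a ∈ supAlg 𝒜 :=
  (Submodule.mem_toSubalgebra).2 (Submodule.mem_iSup_of_mem d ha)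

/-- The grading of `supAlg`. -/
def supAlgGr (d : ℤ) : Submodule ℝ (supAlg 𝒜) := (𝒜 d).comap (supAlg 𝒜).val.toLinearMap

instance : SetLike.GradedMonoid (supAlgGr 𝒜) where
  one_mem := SetLike.GradedOne.one_mem (A := 𝒜)
  mul_mem := fun _ _ _ _ ha hb => SetLike.GradedMul.mul_mem (A := 𝒜) ha hb

theorem iSup_supAlgGr : ⨆ d, supAlgGr 𝒜 d = ⊤ := by
  rw [eq_top_iff]
  rintro ⟨x, hx⟩ -
  have hx' : x ∈ ⨆ d, 𝒜 d := hx
  induction hx' using Submodule.iSup_induction' with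
  | zero => exact zero_mem _
  | add a b ha hb iha ihb => exact add_mem (iha ha) (ihb hb)
  | mem i a ha => exact Submodule.mem_iSup_of_mem i ha

end supAlg

/-! ### Graded tensor products -/

namespace GrAlg
open TensorProduct

/-- The tensor product `A ⊗ B` of graded algebras, with the Koszul sign rule
`(a ⊗ b) (a' ⊗ b') = (-1) ^ (|b| |a'|) (a a') ⊗ (b b')`. -/
def Tensor (A B : GrAlg) : Type := A.gr ᵍ⊗[ℝ] B.gr

instance (A B : GrAlg) : Ring (Tensor A B) := inferInstanceAs (Ring (A.gr ᵍ⊗[ℝ] B.gr))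
instance (A B : GrAlg) : Algebra ℝ (Tensor A B) :=
  inferInstanceAs (Algebra ℝ (A.gr ᵍ⊗[ℝ] B.gr))

/-- The pure tensor `a ⊗ b`. -/
def tmul {A B : GrAlg} (a : A) (b : B) : Tensor A B := GradedTensorProduct.tmul ℝ a b

theorem tmul_mul_tmul {A B : GrAlg} (a a' : A) (b b' : B) (j i : ℤ) (hb : b ∈ B.gr j)
    (ha' : a' ∈ A.gr i) :
    tmul a b * tmul a' b' = (-1 : ℤˣ) ^ (j * i) • tmul (a * a') (b * b') :=
  GradedTensorProduct.tmul_coe_mul_coe_tmul (R := ℝ) A.gr B.gr a ⟨b, hb⟩ ⟨a', ha'⟩ b'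

theorem tmul_one_mul_one_tmul {A B : GrAlg} (a : A) (b : B) :
    tmul a 1 * tmul 1 b = tmul a b := by
  have h := tmul_mul_tmul a 1 1 b 0 0 (SetLike.GradedOne.one_mem (A := B.gr))
    (SetLike.GradedOne.one_mem (A := A.gr))
  rwa [mul_zero, uzpow_zero, one_smul, mul_one, one_mul] at h

theorem one_tmul_mul_tmul_one {A B : GrAlg} (a : A) (b : B) (j i : ℤ) (hb : b ∈ B.gr j)
    (ha : a ∈ A.gr i) : tmul 1 b * tmul a 1 = (-1 : ℤˣ) ^ (j * i) • tmul a b := by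
  have h := tmul_mul_tmul 1 a b 1 j i hb ha
  rwa [mul_one, one_mul] at h

/-- The underlying vector space is the usual tensor product. -/
def tensorEquiv (A B : GrAlg) : A ⊗[ℝ] B ≃ₗ[ℝ] Tensor A B where
  toFun z := GradedTensorProduct.of ℝ A.gr B.gr z
  invFun z := (GradedTensorProduct.of ℝ A.gr B.gr).symm z
  map_add' _ _ := rfl
  map_smul' _ _ := rfl
  left_inv _ := rfl
  right_inv _ := rfl

/-- The total degree: `|a ⊗ b| = |a| + |b|`. -/
def tensorGr (A B : GrAlg) (d : ℤ) : Submodule ℝ (Tensor A B) :=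
  Submodule.span ℝ {z | ∃ i j : ℤ, i + j = d ∧ ∃ a ∈ A.gr i, ∃ b ∈ B.gr j, tmul a b = z}

instance (A B : GrAlg) : SetLike.GradedMonoid (tensorGr A B) where
  one_mem := Submodule.subset_span
    ⟨0, 0, rfl, 1, SetLike.GradedOne.one_mem, 1, SetLike.GradedOne.one_mem, rfl⟩
  mul_mem := by
    intro d e x y hx hy
    have h := Submodule.mul_mem_mul hx hy
    rw [tensorGr, tensorGr, Submodule.span_mul_span] at h
    refine (Submodule.span_le (p := tensorGr A B (d + e))).2 ?_ h
    rintro _ ⟨_, ⟨i, j, rfl, a, ha, b, hb, rfl⟩, _, ⟨i', j', rfl, a', ha', b', hb', rfl⟩, rfl⟩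
    change tmul a b * tmul a' b' ∈ _
    rw [tmul_mul_tmul a a' b b' j i' hb ha']
    have hm : tmul (a * a') (b * b') ∈ tensorGr A B (i + j + (i' + j')) :=
      Submodule.subset_span ⟨i + i', j + j', by ring, _, SetLike.GradedMul.mul_mem ha ha', _,
        SetLike.GradedMul.mul_mem hb hb', rfl⟩
    rcases Int.units_eq_one_or ((-1 : ℤˣ) ^ (j * i')) with h1 | h1 <;> rw [h1]
    · rwa [one_smul]
    · rw [Units.neg_smul, one_smul]
      exact neg_mem hm

theorem tensor_induction {A B : GrAlg} {P : Tensor A B → Prop} (h0 : P 0)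
    (hadd : ∀ x y, P x → P y → P (x + y))
    (ht : ∀ i j, ∀ a ∈ A.gr i, ∀ b ∈ B.gr j, P (tmul a b)) (z : Tensor A B) : P z := by
  obtain ⟨z, rfl⟩ := (tensorEquiv A B).surjective z
  induction z with
  | zero => rwa [map_zero]
  | add x y hx hy => rw [map_add]; exact hadd _ _ hx hy
  | tmul a b =>
    induction a using DirectSum.Decomposition.inductionOn A.gr with
    | zero => rwa [TensorProduct.zero_tmul, map_zero]
    | add x y hx hy => rw [TensorProduct.add_tmul, map_add]; exact hadd _ _ hx hy
    | @homogeneous i a =>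
      induction b using DirectSum.Decomposition.inductionOn B.gr with
      | zero => rwa [TensorProduct.tmul_zero, map_zero]
      | add x y hx hy => rw [TensorProduct.tmul_add, map_add]; exact hadd _ _ hx hy
      | @homogeneous j b => exact ht i j a a.2 b b.2

theorem iSup_tensorGr (A B : GrAlg) : ⨆ d, tensorGr A B d = ⊤ := by
  rw [eq_top_iff]
  intro z _
  induction z using tensor_induction with
  | h0 => exact zero_mem _
  | hadd x y hx hy => exact add_mem (hx trivial) (hy trivial)
  | ht i j a ha b hb =>
    exact Submodule.mem_iSup_of_mem (i + j) (Submodule.subset_span ⟨i, j, rfl, a, ha, b, hb, rfl⟩)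

/-- The decomposition of the tensor product into bihomogeneous components. -/
def tensorComp (A B : GrAlg) : Tensor A B ≃ₗ[ℝ] ⨁ p : ℤ × ℤ, (A.gr p.1 ⊗[ℝ] B.gr p.2) :=
  (tensorEquiv A B).symm.trans
    ((TensorProduct.congr (DirectSum.decomposeLinearEquiv A.gr)
      (DirectSum.decomposeLinearEquiv B.gr)).trans
    (TensorProduct.directSum ℝ ℝ (fun i => A.gr i) (fun i => B.gr i)))

/-- The projection to the components of total degree `e`. -/
def tensorFilter (A B : GrAlg) (e : ℤ) :
    (⨁ p : ℤ × ℤ, (A.gr p.1 ⊗[ℝ] B.gr p.2)) →ₗ[ℝ] ⨁ p : ℤ × ℤ, (A.gr p.1 ⊗[ℝ] B.gr p.2) :=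
  DirectSum.toModule ℝ (ℤ × ℤ) _ fun p => if p.1 + p.2 = e then
    DirectSum.lof ℝ (ℤ × ℤ) (fun p : ℤ × ℤ => (A.gr p.1 ⊗[ℝ] B.gr p.2)) p else 0

theorem filter_tensorComp (A B : GrAlg) (d e : ℤ) (z : Tensor A B) (hz : z ∈ tensorGr A B d) :
    tensorFilter A B e (tensorComp A B z) = if d = e then tensorComp A B z else 0 := by
  induction hz using Submodule.span_induction with
  | zero => simp
  | add x y _ _ hx hy => rw [map_add, map_add, hx, hy]; split_ifs <;> simp
  | smul c x _ hx => rw [map_smul, map_smul, hx]; split_ifs <;> simp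
  | mem z hz =>
    obtain ⟨i, j, rfl, a, ha, b, hb, rfl⟩ := hz
    have : tensorComp A B (tmul a b) =
        DirectSum.lof ℝ (ℤ × ℤ) (fun p : ℤ × ℤ => (A.gr p.1 ⊗[ℝ] B.gr p.2)) (i, j)
          ((⟨a, ha⟩ : A.gr i) ⊗ₜ (⟨b, hb⟩ : B.gr j)) := by
      change TensorProduct.directSum ℝ ℝ (fun i => A.gr i) (fun i => B.gr i)
        ((DirectSum.decompose A.gr a) ⊗ₜ (DirectSum.decompose B.gr b)) = _
      rw [DirectSum.decompose_of_mem _ ha, DirectSum.decompose_of_mem _ hb]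
      exact TensorProduct.directSum_lof_tmul_lof ℝ ℝ i _ j _
    rw [this, tensorFilter, DirectSum.toModule_lof]
    split_ifs <;> rfl

instance (A B : GrAlg) : GradedAlgebra (tensorGr A B) where
  toDecomposition := (isInternal_of_separated _ (iSup_tensorGr A B)
    (fun d => tensorFilter A B d ∘ₗ (tensorComp A B).toLinearMap)
    (fun d a ha h => by
      have h2 := filter_tensorComp A B d d a ha
      rw [if_pos rfl] at h2
      exact (tensorComp A B).map_eq_zero_iff.1 (h2.symm.trans h))
    (fun d e hde a ha => by
      have h2 := filter_tensorComp A B d e a ha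
      rwa [if_neg hde] at h2)).chooseDecomposition

/-- The graded tensor product as a graded algebra. -/
def tensor (A B : GrAlg) : GrAlg where
  carrier := Tensor A B
  gr := tensorGr A B

/-- The linear map underlying `id ⊗ f`. -/
def tensorMapLin (A : GrAlg) {B C : GrAlg} (f : B ⟶ C) : Tensor A B →ₗ[ℝ] Tensor A C :=
  (tensorEquiv A C).toLinearMap ∘ₗ TensorProduct.map LinearMap.id
    (ConcreteCategory.hom f : B.gr →ₐᵍ[ℝ] C.gr).toAlgHom.toLinearMap ∘ₗ
      (tensorEquiv A B).symm.toLinearMap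

theorem tensorMapLin_tmul (A : GrAlg) {B C : GrAlg} (f : B ⟶ C) (a : A) (b : B) :
    tensorMapLin A f (tmul a b) = tmul a (f b) := rfl

/-- The algebra homomorphism underlying `id ⊗ f`. -/
def tensorMapAlg (A : GrAlg) {B C : GrAlg} (f : B ⟶ C) : Tensor A B →ₐ[ℝ] Tensor A C :=
  AlgHom.ofLinearMap (tensorMapLin A f)
    (by
      change tmul (1 : A) (f 1) = tmul 1 1
      rw [map_one])
    (by
      intro z w
      induction z using tensor_induction with
      | h0 => rw [zero_mul, map_zero, zero_mul]
      | hadd x y hx hy => rw [add_mul, map_add, hx, hy, map_add, add_mul]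
      | ht i j a ha b hb =>
        induction w using tensor_induction with
        | h0 => rw [mul_zero, map_zero, mul_zero]
        | hadd x y hx hy => rw [mul_add, map_add, hx, hy, map_add, mul_add]
        | ht i' j' a' ha' b' hb' =>
          have hb2 : f b ∈ C.gr j := (ConcreteCategory.hom f : B.gr →ₐᵍ[ℝ] C.gr).map_mem hb
          rw [tmul_mul_tmul _ _ _ _ j i' hb ha', tensorMapLin_tmul, tensorMapLin_tmul,
            tmul_mul_tmul _ _ _ _ j i' hb2 ha', LinearMap.map_smul_of_tower, tensorMapLin_tmul,
            map_mul])

theorem tensorMapAlg_tmul (A : GrAlg) {B C : GrAlg} (f : B ⟶ C) (a : A) (b : B) :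
    tensorMapAlg A f (tmul a b) = tmul a (f b) := rfl

theorem tensorMapAlg_mem (A : GrAlg) {B C : GrAlg} (f : B ⟶ C) (d : ℤ) (z : Tensor A B)
    (hz : z ∈ tensorGr A B d) : tensorMapAlg A f z ∈ tensorGr A C d := by
  induction hz using Submodule.span_induction with
  | zero => rw [map_zero]; exact zero_mem _
  | add x y _ _ hx hy => rw [map_add]; exact add_mem hx hy
  | smul c x _ hx => rw [map_smul]; exact Submodule.smul_mem _ _ hx
  | mem z hz =>
    obtain ⟨i, j, rfl, a, ha, b, hb, rfl⟩ := hz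
    rw [tensorMapAlg_tmul]
    exact Submodule.subset_span ⟨i, j, rfl, a, ha, f b,
      (ConcreteCategory.hom f : B.gr →ₐᵍ[ℝ] C.gr).map_mem hb, rfl⟩

/-- The morphism `id ⊗ f`. -/
def tensorMap (A : GrAlg) {B C : GrAlg} (f : B ⟶ C) : A.tensor B ⟶ A.tensor C :=
  ConcreteCategory.ofHom (C := GrAlg) (X := A.tensor B) (Y := A.tensor C)
  { tensorMapAlg A f with
    map_mem := fun {d} {z} hz => tensorMapAlg_mem A f d z hz }

theorem tensorMap_ext {A B C : GrAlg} {f g : A.tensor B ⟶ C}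
    (h : ∀ (a : A) (b : B), f (tmul a b : Tensor A B) = g (tmul a b : Tensor A B)) : f = g := by
  refine ConcreteCategory.hom_ext (C := GrAlg) f g fun z => ?_
  obtain ⟨z, rfl⟩ := (tensorEquiv A B).surjective z
  induction z with
  | zero => exact (map_zero (ConcreteCategory.hom f)).trans (map_zero (ConcreteCategory.hom g)).symm
  | add x y hx hy =>
    rw [map_add]
    refine (map_add (ConcreteCategory.hom f) _ _).trans
      (Eq.trans ?_ (map_add (ConcreteCategory.hom g) _ _).symm)
    exact congrArg₂ (· + ·) hx hy
  | tmul a b => exact h a b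

/-- The functor `B ↦ A ⊗ B`. -/
def tensorLeft (A : GrAlg) : GrAlg ⥤ GrAlg where
  obj B := A.tensor B
  map f := tensorMap A f
  map_id B := tensorMap_ext fun a b => tensorMapAlg_tmul A (𝟙 B) a b
  map_comp {B C E} f g := tensorMap_ext fun a b => by
    refine (tensorMapAlg_tmul A (f ≫ g) a b).trans ?_
    refine Eq.trans ?_ (congrArg (tensorMapAlg A g) (tensorMapAlg_tmul A f a b)).symm
    exact (tensorMapAlg_tmul A g a (f b)).symm

end GrAlg

/-! ### The graded symmetric algebra -/
section GSym
variable (N : ℤ → Type) [∀ i, AddCommGroup (N i)] [∀ i, Module ℝ (N i)]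

/-- The Koszul commutation rule. The elements of `N i` have degree `-i`, and
`(-1) ^ ((-i) * (-j)) = (-1) ^ (i * j)`. -/
inductive GSym.Rel : TensorAlgebra ℝ (⨁ i, N i) → TensorAlgebra ℝ (⨁ i, N i) → Prop
  | comm (i j : ℤ) (a : N i) (b : N j) :
    GSym.Rel
      (TensorAlgebra.ι ℝ (DirectSum.lof ℝ ℤ N i a) * TensorAlgebra.ι ℝ (DirectSum.lof ℝ ℤ N j b))
      ((-1 : ℤˣ) ^ (i * j) • (TensorAlgebra.ι ℝ (DirectSum.lof ℝ ℤ N j b) *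
        TensorAlgebra.ι ℝ (DirectSum.lof ℝ ℤ N i a)))

/-- The graded symmetric algebra over `ℝ` on the graded vector space that has `N i` in degree `-i`.
For `N i` the dual of `V i` this is the algebra `S^{≥ 0} (V^*)` of polynomial functions on the
graded vector space `V`: a linear function on `V i` has degree `-i`. -/
def GSym : Type := RingQuot (GSym.Rel N)

instance : Ring (GSym N) := inferInstanceAs (Ring (RingQuot (GSym.Rel N)))
instance : Algebra ℝ (GSym N) := inferInstanceAs (Algebra ℝ (RingQuot (GSym.Rel N)))

variable {N}

/-- The generators. -/
def GSym.ι (i : ℤ) : N i →ₗ[ℝ] GSym N :=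
  (RingQuot.mkAlgHom ℝ (GSym.Rel N)).toLinearMap ∘ₗ TensorAlgebra.ι ℝ ∘ₗ DirectSum.lof ℝ ℤ N i

variable (N) in
/-- The part of degree `d` (the degree of a product is the sum of the degrees of its factors). -/
def GSym.gr (d : ℤ) : Submodule ℝ (GSym N) :=
  Submodule.span ℝ {z | ∃ l : List (Σ i, N i),
    (l.map fun p => -p.1).sum = d ∧ (l.map fun p => GSym.ι p.1 p.2).prod = z}

theorem GSym.ι_mul_ι (i j : ℤ) (a : N i) (b : N j) :
    GSym.ι i a * GSym.ι j b = (-1 : ℤˣ) ^ (i * j) • (GSym.ι j b * GSym.ι i a) := by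
  have h := RingQuot.mkAlgHom_rel ℝ (GSym.Rel.comm (N := N) i j a b)
  rw [AlgHom.map_smul_of_tower, map_mul, map_mul] at h
  exact h

theorem GSym.ι_mem (i : ℤ) (a : N i) : GSym.ι i a ∈ GSym.gr N (-i) :=
  Submodule.subset_span ⟨[⟨i, a⟩], by simp, by simp⟩

instance : SetLike.GradedMonoid (GSym.gr N) where
  one_mem := Submodule.subset_span ⟨[], by simp, by simp⟩
  mul_mem := by
    intro i j a b ha hb
    have h := Submodule.mul_mem_mul ha hb
    rw [GSym.gr, GSym.gr, Submodule.span_mul_span] at h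
    refine Submodule.span_mono ?_ h
    rintro _ ⟨_, ⟨l, hl, rfl⟩, _, ⟨l', hl', rfl⟩, rfl⟩
    exact ⟨l ++ l', by simp [hl, hl'], by simp⟩

theorem GSym.hom_ext {B : Type} [Ring B] [Algebra ℝ B] {f g : GSym N →ₐ[ℝ] B}
    (h : ∀ i a, f (GSym.ι i a) = g (GSym.ι i a)) : f = g := by
  refine RingQuot.ringQuot_ext' ℝ f g ?_
  refine TensorAlgebra.hom_ext ?_
  refine DirectSum.linearMap_ext ℝ fun i => ?_
  ext a
  exact h i a

/-- The universal property. -/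
def GSym.lift {B : Type} [Ring B] [Algebra ℝ B] (φ : ∀ i, N i →ₗ[ℝ] B)
    (hφ : ∀ i j a b, φ i a * φ j b = (-1 : ℤˣ) ^ (i * j) • (φ j b * φ i a)) : GSym N →ₐ[ℝ] B :=
  RingQuot.liftAlgHom ℝ ⟨TensorAlgebra.lift ℝ (DirectSum.toModule ℝ ℤ B φ), by
    rintro _ _ ⟨i, j, a, b⟩
    rw [AlgHom.map_smul_of_tower]
    simp only [map_mul, TensorAlgebra.lift_ι_apply, DirectSum.toModule_lof]
    exact hφ i j a b⟩

@[simp] theorem GSym.lift_ι {B : Type} [Ring B] [Algebra ℝ B] (φ : ∀ i, N i →ₗ[ℝ] B)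
    (hφ : ∀ i j a b, φ i a * φ j b = (-1 : ℤˣ) ^ (i * j) • (φ j b * φ i a)) (i : ℤ) (a : N i) :
    GSym.lift φ hφ (GSym.ι i a) = φ i a := by
  simp only [GSym.lift, GSym.ι]
  erw [RingQuot.liftAlgHom_mkAlgHom_apply]
  simp

theorem GSym.iSup_gr : ⨆ d, GSym.gr N d = ⊤ := by
  let S : Subalgebra ℝ (GSym N) := (⨆ d, GSym.gr N d).toSubalgebra
    (Submodule.mem_iSup_of_mem 0 SetLike.GradedOne.one_mem) (by
      intro x y hx hy
      induction hx using Submodule.iSup_induction' with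
      | zero => simp
      | add a b _ _ ha hb => rw [add_mul]; exact add_mem ha hb
      | mem i a ha =>
        induction hy using Submodule.iSup_induction' with
        | zero => simp
        | add a b _ _ ha hb => rw [mul_add]; exact add_mem ha hb
        | mem j b hb => exact Submodule.mem_iSup_of_mem (i + j) (SetLike.GradedMul.mul_mem ha hb))
  have hS : ∀ i a, GSym.ι (N := N) i a ∈ S := fun i a =>
    (Submodule.mem_toSubalgebra).2 (Submodule.mem_iSup_of_mem (-i) (GSym.ι_mem i a))
  let F : GSym N →ₐ[ℝ] S := GSym.lift
    (fun i => (GSym.ι (N := N) i).codRestrict (Subalgebra.toSubmodule S) (hS i))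
    (fun i j a b => by
      apply Subtype.ext
      have h := GSym.ι_mul_ι i j a b
      rcases Int.units_eq_one_or ((-1 : ℤˣ) ^ (i * j)) with h1 | h1 <;> rw [h1] at h ⊢
      · rw [one_smul] at h ⊢
        exact h
      · rw [Units.neg_smul, one_smul] at h ⊢
        exact h)
  have hF : S.val.comp F = AlgHom.id ℝ _ := GSym.hom_ext fun i a => by
    rw [AlgHom.comp_apply, GSym.lift_ι]; rfl
  rw [eq_top_iff]
  intro x _
  have : (F x : GSym N) = x := congrArg (fun f : GSym N →ₐ[ℝ] GSym N => f x) hF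
  rw [← this]
  exact (F x).2

/-- The grading as a coaction, `z ↦ z T ^ d` for `z` of degree `d`. -/
def GSym.coact : GSym N →ₐ[ℝ] AddMonoidAlgebra (GSym N) ℤ :=
  GSym.lift (fun i => 
      { toFun := fun a => AddMonoidAlgebra.single (-i) (GSym.ι (N := N) i a)
        map_add' := by simp [-LaurentPolynomial.single_eq_C_mul_T]
        map_smul' := by simp [-LaurentPolynomial.single_eq_C_mul_T] }) (by
    intro i j a b
    simp only [LinearMap.coe_mk, AddHom.coe_mk, AddMonoidAlgebra.single_mul_single]
    rw [GSym.ι_mul_ι i j, add_comm (-i)]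
    rcases Int.units_eq_one_or ((-1 : ℤˣ) ^ (i * j)) with h | h <;> rw [h] <;> simp [-LaurentPolynomial.single_eq_C_mul_T, Units.smul_def])

theorem GSym.coact_of_mem (d : ℤ) (z : GSym N) (hz : z ∈ GSym.gr N d) :
    GSym.coact z = AddMonoidAlgebra.single d z := by
  induction hz using Submodule.span_induction with
  | zero => simp
  | add x y _ _ hx hy => simp [-LaurentPolynomial.single_eq_C_mul_T, hx, hy]
  | smul c x _ hx => simp [-LaurentPolynomial.single_eq_C_mul_T, hx]
  | mem z hz =>
    obtain ⟨l, rfl, rfl⟩ := hz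
    induction l with
    | nil => simp [-LaurentPolynomial.single_eq_C_mul_T, AddMonoidAlgebra.one_def]
    | cons p l ih =>
      simp only [List.map_cons, List.prod_cons, List.sum_cons, map_mul, ih]
      rw [GSym.coact, GSym.lift_ι]
      simp [-LaurentPolynomial.single_eq_C_mul_T, AddMonoidAlgebra.single_mul_single]

theorem GSym.isInternal : DirectSum.IsInternal (GSym.gr N) :=
  isInternal_of_separated _ GSym.iSup_gr
    (fun d => { toFun := fun z => (GSym.coact z).coeff d
                map_add' := by simp [-LaurentPolynomial.single_eq_C_mul_T]
                map_smul' := by simp [-LaurentPolynomial.single_eq_C_mul_T] })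
    (fun d a ha h => by simpa [-LaurentPolynomial.single_eq_C_mul_T, GSym.coact_of_mem d a ha] using h)
    (fun d e hde a ha => by simp [-LaurentPolynomial.single_eq_C_mul_T, GSym.coact_of_mem d a ha, hde])

instance : GradedAlgebra (GSym.gr N) where
  toDecomposition := GSym.isInternal.chooseDecomposition

theorem GSym.graded_comm (d e : ℤ) (a b : GSym N) (ha : a ∈ GSym.gr N d) (hb : b ∈ GSym.gr N e) :
    a * b = (-1 : ℤˣ) ^ (d * e) • (b * a) := by
  have key : ∀ (l : List (Σ i, N i)) (i : ℤ) (a : N i),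
      GSym.ι i a * (l.map fun p => GSym.ι p.1 p.2).prod =
        (-1 : ℤˣ) ^ (-i * (l.map fun p => -p.1).sum) •
          ((l.map fun p => GSym.ι p.1 p.2).prod * GSym.ι i a) := by
    intro l i a
    induction l with
    | nil => simp
    | cons p l ih =>
      simp only [List.map_cons, List.prod_cons, List.sum_cons]
      rw [← mul_assoc, GSym.ι_mul_ι i p.1, smul_mul_assoc, mul_assoc, ih, mul_smul_comm, smul_smul,
        mul_add, uzpow_add, neg_mul_neg, mul_assoc]
  have key2 : ∀ l l' : List (Σ i, N i),
      (l.map fun p => GSym.ι p.1 p.2).prod * (l'.map fun p => GSym.ι p.1 p.2).prod =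
        (-1 : ℤˣ) ^ ((l.map fun p => -p.1).sum * (l'.map fun p => -p.1).sum) •
          ((l'.map fun p => GSym.ι p.1 p.2).prod * (l.map fun p => GSym.ι p.1 p.2).prod) := by
    intro l l'
    induction l with
    | nil => simp
    | cons p l ih =>
      simp only [List.map_cons, List.prod_cons, List.sum_cons]
      rw [mul_assoc, ih, mul_smul_comm, ← mul_assoc, key, smul_mul_assoc, smul_smul, add_mul,
        uzpow_add, mul_assoc, mul_comm]
  induction ha, hb using Submodule.span_induction₂ with
  | mem_mem x y hx hy =>
    obtain ⟨l, rfl, rfl⟩ := hx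
    obtain ⟨l', rfl, rfl⟩ := hy
    exact key2 l l'
  | zero_left => simp
  | zero_right => simp
  | add_left x y z _ _ _ h1 h2 => rw [add_mul, mul_add, h1, h2, smul_add]
  | add_right x y z _ _ _ h1 h2 => rw [add_mul, mul_add, h1, h2, smul_add]
  | smul_left r x y _ _ h => rw [smul_mul_assoc, mul_smul_comm, h, smul_comm]
  | smul_right r x y _ _ h => rw [smul_mul_assoc, mul_smul_comm, h, smul_comm]
end GSym

/-! ### Manifolds, vector bundles and graded vector bundles -/

/-- A smooth manifold: finite dimensional, without boundary, Hausdorff and second countable. -/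
structure Mfd where
  carrier : Type
  dim : ℕ
  [top : TopologicalSpace carrier]
  [charted : ChartedSpace (EuclideanSpace ℝ (Fin dim)) carrier]
  [smooth : IsManifold (𝓡 dim) ∞ carrier]
  [t2 : T2Space carrier]
  [secondCountable : SecondCountableTopology carrier]

instance : CoeSort Mfd Type := ⟨Mfd.carrier⟩
attribute [instance] Mfd.top Mfd.charted Mfd.smooth Mfd.t2 Mfd.secondCountable

/-- A smooth real vector bundle of finite rank over `M`. -/
structure VB (M : Mfd) where
  Model : Type
  Fiber : M → Type
  [modelNormed : NormedAddCommGroup Model]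
  [modelSpace : NormedSpace ℝ Model]
  [modelFinite : FiniteDimensional ℝ Model]
  [addCommGroup : ∀ x, AddCommGroup (Fiber x)]
  [module : ∀ x, Module ℝ (Fiber x)]
  [fiberTop : ∀ x, TopologicalSpace (Fiber x)]
  [totalTop : TopologicalSpace (TotalSpace Model Fiber)]
  [fiberBundle : FiberBundle Model Fiber]
  [vectorBundle : VectorBundle ℝ Model Fiber]
  [smooth : ContMDiffVectorBundle ∞ Model Fiber (𝓡 M.dim)]

attribute [instance] VB.modelNormed VB.modelSpace VB.modelFinite VB.addCommGroup VB.module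
  VB.fiberTop VB.totalTop VB.fiberBundle VB.vectorBundle VB.smooth

namespace VB
variable {M : Mfd}

instance (E : VB M) (x : M) : IsTopologicalAddGroup (E.Fiber x) :=
  (VectorBundle.continuousLinearEquivAt ℝ E.Model
    E.Fiber x).toContinuousAddEquiv.isTopologicalAddGroup

instance (E : VB M) (x : M) : ContinuousSMul ℝ (E.Fiber x) :=
  (VectorBundle.continuousLinearEquivAt ℝ E.Model E.Fiber x).continuousSMul

/-- The tangent bundle. -/
@[reducible] def tangent (M : Mfd) : VB M where
  Model := EuclideanSpace ℝ (Fin M.dim)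
  Fiber := fun x : M => TangentSpace (𝓡 M.dim) x

/-- The trivial bundle with fiber `F`. -/
@[reducible] def trivial (M : Mfd) (F : Type) [NormedAddCommGroup F] [NormedSpace ℝ F]
    [FiniteDimensional ℝ F] : VB M where
  Model := F
  Fiber := Bundle.Trivial M F

/-- The direct (Whitney) sum. -/
@[reducible] def prod (E F : VB M) : VB M where
  Model := E.Model × F.Model
  Fiber := E.Fiber ×ᵇ F.Fiber

/-- The dual bundle. -/
@[reducible] def dual (E : VB M) : VB M where
  Model := E.Model →L[ℝ] ℝ
  Fiber := fun x => E.Fiber x →L[ℝ] Bundle.Trivial M ℝ x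

/-- Smooth sections. -/
abbrev Sec (E : VB M) : Type := Cₛ^∞⟮𝓡 M.dim; E.Model, E.Fiber⟯

/-- The projection to the first summand, on a fiber. -/
def fstL (E F : VB M) (x : M) : (E.prod F).Fiber x →L[ℝ] E.Fiber x :=
  ContinuousLinearMap.fst ℝ (E.Fiber x) (F.Fiber x)

/-- The projection to the second summand, on a fiber. -/
def sndL (E F : VB M) (x : M) : (E.prod F).Fiber x →L[ℝ] F.Fiber x :=
  ContinuousLinearMap.snd ℝ (E.Fiber x) (F.Fiber x)

/-- The identification of the fibers of equal bundles. -/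
def castL {E F : VB M} (h : E = F) (x : M) : E.Fiber x →L[ℝ] F.Fiber x :=
  h ▸ ContinuousLinearMap.id ℝ (E.Fiber x)

/-- A smooth connection (covariant derivative) on `E`. -/
structure Conn (E : VB M) where
  cov : CovariantDerivative (𝓡 M.dim) E.Model E.Fiber
  smooth : CovariantDerivative.ContMDiffCovariantDerivative cov ∞

end VB

/-- A `ℤ`-graded vector bundle over `M`: a vector bundle `V i` of finite rank for every degree `i`. -/
abbrev GVB (M : Mfd) := ℤ → VB M

namespace GVB
variable {M : Mfd}

/-- Degreewise direct sum. -/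
def sum (V W : GVB M) : GVB M := fun i => (V i).prod (W i)

/-- The shift `V[k]`, with `V[k]_i = V_{k + i}`. -/
def shift (V : GVB M) (k : ℤ) : GVB M := fun i => V (k + i)

/-- The graded vector bundle that is `E` in degree `j` and zero in the other degrees. -/
def inDegree (j : ℤ) (E : VB M) : GVB M := fun i => if i = j then E else VB.trivial M PUnit

theorem inDegree_self (j : ℤ) (E : VB M) : inDegree j E j = E := if_pos rfl

/-- The fiber at `x` of the bundle of algebras `S^{≥ 0} V^*`. -/
abbrev SymFiber (V : GVB M) (x : M) : Type := GSym fun i => (V i).dual.Fiber x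

/-- The sections of `S^{≥ 0} V^*` that are (global) polynomial expressions in smooth functions and in
smooth sections of the bundles `(V i)^*`. -/
def polySec (V : GVB M) : Subalgebra ℝ (∀ x, V.SymFiber x) :=
  Algebra.adjoin ℝ
    ({s | ∃ f : C^∞⟮𝓡 M.dim, M; ℝ⟯, ∀ x, s x = algebraMap ℝ (V.SymFiber x) (f x)} ∪
     {s | ∃ (i : ℤ) (σ : (V i).dual.Sec), ∀ x, s x = GSym.ι i (σ x)})

/-- The smooth sections of `S^{≥ 0} V^*` that are homogeneous of degree `d`. A section of `S^{≥ 0} V^*`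
is smooth if near every point it is a polynomial in smooth functions and smooth sections of the
`(V i)^*` (by bump functions it makes no difference whether these are defined locally or globally). -/
def homSec (V : GVB M) (d : ℤ) : Submodule ℝ (∀ x, V.SymFiber x) where
  carrier := {s | (∀ x, s x ∈ GSym.gr (fun i => (V i).dual.Fiber x) d) ∧
    ∀ x, ∃ p ∈ V.polySec, ∀ᶠ y in 𝓝 x, s y = p y}
  zero_mem' := ⟨fun _ => zero_mem _, fun _ => ⟨0, zero_mem _, Filter.Eventually.of_forall
    fun _ => rfl⟩⟩
  add_mem' := by
    rintro s t ⟨hs, hs'⟩ ⟨ht, ht'⟩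
    refine ⟨fun x => add_mem (hs x) (ht x), fun x => ?_⟩
    obtain ⟨p, hp, hsp⟩ := hs' x
    obtain ⟨q, hq, htq⟩ := ht' x
    refine ⟨p + q, add_mem hp hq, ?_⟩
    filter_upwards [hsp, htq] with y h1 h2
    rw [Pi.add_apply, Pi.add_apply, h1, h2]
  smul_mem' := by
    rintro c s ⟨hs, hs'⟩
    refine ⟨fun x => Submodule.smul_mem _ c (hs x), fun x => ?_⟩
    obtain ⟨p, hp, hsp⟩ := hs' x
    refine ⟨c • p, Subalgebra.smul_mem _ hp c, ?_⟩
    filter_upwards [hsp] with y h1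
    rw [Pi.smul_apply, Pi.smul_apply, h1]

instance (V : GVB M) : SetLike.GradedMonoid V.homSec where
  one_mem := ⟨fun _ => SetLike.GradedOne.one_mem, fun _ => ⟨1, one_mem _,
    Filter.Eventually.of_forall fun _ => rfl⟩⟩
  mul_mem := by
    rintro i j s t ⟨hs, hs'⟩ ⟨ht, ht'⟩
    refine ⟨fun x => SetLike.GradedMul.mul_mem (hs x) (ht x), fun x => ?_⟩
    obtain ⟨p, hp, hsp⟩ := hs' x
    obtain ⟨q, hq, htq⟩ := ht' x
    refine ⟨p * q, mul_mem hp hq, ?_⟩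
    filter_upwards [hsp, htq] with y h1 h2
    rw [Pi.mul_apply, Pi.mul_apply, h1, h2]

/-- The component of degree `d` of a section. -/
def projSec (V : GVB M) (d : ℤ) : supAlg V.homSec →ₗ[ℝ] ∀ x, V.SymFiber x :=
  LinearMap.pi fun x => GradedAlgebra.proj (GSym.gr fun i => (V i).dual.Fiber x) d ∘ₗ
    LinearMap.proj x ∘ₗ (supAlg V.homSec).val.toLinearMap

theorem projSec_apply (V : GVB M) (d : ℤ) (s : supAlg V.homSec) (x : M) :
    V.projSec d s x = DirectSum.decompose (GSym.gr fun i => (V i).dual.Fiber x) (s.1 x) d := rfl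

instance (V : GVB M) : GradedAlgebra (supAlgGr V.homSec) where
  toDecomposition := (isInternal_of_separated _ (iSup_supAlgGr V.homSec) V.projSec
    (fun d s hs h => by
      have hs' : s.1 ∈ V.homSec d := hs
      refine Subtype.ext (funext fun x => ?_)
      have h1 := V.projSec_apply d s x
      rw [DirectSum.decompose_of_mem_same _ (hs'.1 x), h] at h1
      exact h1.symm)
    (fun d e hde s hs => by
      have hs' : s.1 ∈ V.homSec d := hs
      funext x
      rw [projSec_apply, DirectSum.decompose_of_mem_ne _ (hs'.1 x) hde]
      rfl)).chooseDecomposition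

/-- The `ℤ`-graded algebra `Γ (S^{≥ 0} V^*)`; its part of degree `d` consists of the smooth sections
of degree `d`. -/
def funAlg (V : GVB M) : GrAlg where
  carrier := supAlg V.homSec
  gr := supAlgGr V.homSec

/-- The section of `S^{≥ 0} V^*` given by an element of `Γ (S^{≥ 0} V^*)`. -/
def val (V : GVB M) (a : V.funAlg) : ∀ x, V.SymFiber x := Subtype.val (p := (· ∈ supAlg V.homSec)) a

/-- Smooth functions on the body as elements of arity `0`. -/
def ofFun (V : GVB M) (f : C^∞⟮𝓡 M.dim, M; ℝ⟯) : V.funAlg :=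
  (⟨fun x => algebraMap ℝ (V.SymFiber x) (f x), mem_supAlg _ (d := 0)
    ⟨fun x => SetLike.algebraMap_mem_graded _ (f x), fun _ => ⟨_, Algebra.subset_adjoin
      (Or.inl ⟨f, fun _ => rfl⟩), Filter.Eventually.of_forall fun _ => rfl⟩⟩⟩ : supAlg V.homSec)

/-- Smooth sections of `(V i)^*` as elements of arity `1`, of degree `-i`. -/
def ofSec (V : GVB M) (i : ℤ) (σ : (V i).dual.Sec) : V.funAlg :=
  (⟨fun x => GSym.ι i (σ x), mem_supAlg _ (d := -i)
    ⟨fun x => GSym.ι_mem (N := fun i => (V i).dual.Fiber x) i (σ x), fun _ => ⟨_, Algebra.subset_adjoin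
      (Or.inr ⟨i, σ, fun _ => rfl⟩), Filter.Eventually.of_forall fun _ => rfl⟩⟩⟩ :
        supAlg V.homSec)

theorem funAlg_comm (V : GVB M) (d e : ℤ) (a b : V.funAlg) (ha : a ∈ V.funAlg.gr d)
    (hb : b ∈ V.funAlg.gr e) : a * b = (-1 : ℤˣ) ^ (d * e) • (b * a) := by
  have ha' : V.val a ∈ V.homSec d := ha
  have hb' : V.val b ∈ V.homSec e := hb
  have key : V.val a * V.val b = (-1 : ℤˣ) ^ (d * e) • (V.val b * V.val a) :=
    funext fun x => GSym.graded_comm d e _ _ (ha'.1 x) (hb'.1 x)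
  apply Subtype.ext
  rcases Int.units_eq_one_or ((-1 : ℤˣ) ^ (d * e)) with h1 | h1 <;> rw [h1] at key ⊢
  · rw [one_smul] at key ⊢
    exact key
  · rw [Units.neg_smul, one_smul] at key ⊢
    exact key

end GVB

/-! ### Graded manifolds -/

/-- A `ℤ`-graded manifold: a `ℤ`-graded, graded-commutative algebra (the function algebra) that is
isomorphic to `Γ (S^{≥ 0} V^*)` for a graded vector bundle `V` over a manifold. -/
structure ZMfd where
  alg : GrAlg
  comm : ∀ (d e : ℤ) (a b : alg), a ∈ alg.gr d → b ∈ alg.gr e →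
    a * b = (-1 : ℤˣ) ^ (d * e) • (b * a)
  exists_splitting : ∃ (M : Mfd) (V : GVB M), Nonempty (alg ≅ V.funAlg)

namespace ZMfd

/-- A morphism `X ⟶ Y` is a morphism of graded algebras from the functions on `Y` to those on `X`. -/
instance : Category ZMfd where
  Hom X Y := Y.alg ⟶ X.alg
  id X := 𝟙 X.alg
  comp f g := g ≫ f

/-- The morphism of function algebras given by a morphism of graded manifolds. -/
def pullback {X Y : ZMfd} (f : X ⟶ Y) : Y.alg ⟶ X.alg := f

/-- A splitting of `X` by `V`: an isomorphism of the function algebra with `Γ (S^{≥ 0} V^*)`. -/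
abbrev Splitting (X : ZMfd) {M : Mfd} (V : GVB M) := X.alg ≅ V.funAlg

/-- The graded manifold `𝔖 (V)` given by a graded vector bundle. -/
def split {M : Mfd} (V : GVB M) : ZMfd where
  alg := V.funAlg
  comm := V.funAlg_comm
  exists_splitting := ⟨M, V, ⟨Iso.refl _⟩⟩

/-- The presheaf `Hom (A, X) : T ↦ hom (A × T, X)` for a graded manifold `A` over a point. The product
`A × T` is given by its function algebra, the graded tensor product of those of `A` and `T`, so
a morphism `A × T ⟶ X` is a morphism of graded algebras `C(X) ⟶ C(A) ⊗ C(T)`. -/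
def innerHom (A X : ZMfd) : ZMfdᵒᵖ ⥤ Type where
  obj T := X.alg ⟶ A.alg.tensor T.unop.alg
  map f := TypeCat.ofHom fun ψ => ψ ≫ A.alg.tensorLeft.map (pullback f.unop)
  map_id T := by
    refine ConcreteCategory.hom_ext _ _ fun ψ => ?_
    exact (congrArg (ψ ≫ ·) (A.alg.tensorLeft.map_id T.unop.alg)).trans (Category.comp_id ψ)
  map_comp f g := by
    refine ConcreteCategory.hom_ext _ _ fun ψ => ?_
    exact (congrArg (ψ ≫ ·) (A.alg.tensorLeft.map_comp (pullback f.unop)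
      (pullback g.unop))).trans (Category.assoc ψ _ _).symm

end ZMfd

/-- The one-point manifold. -/
def point : Mfd where
  carrier := PUnit
  dim := 0
  charted := ChartedSpace.ofDiscreteTopology
  smooth := IsManifold.of_discreteTopology _

instance : DiscreteTopology point := inferInstanceAs (DiscreteTopology PUnit)

/-- The graded vector bundle `ℝ[-1]` over a point: `ℝ` in degree `1`. -/
def fatBundle : GVB point := GVB.inDegree 1 (VB.trivial point ℝ)

/-- The graded manifold `D = ℝ[-1]`. -/
def fatPoint : ZMfd := ZMfd.split fatBundle

/-- The identity of `ℝ`, as an element of the dual of the degree `1` part of `ℝ[-1]`. -/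
def fatCoord : (fatBundle 1).dual.Sec where
  toFun x := VB.castL (GVB.inDegree_self 1 (VB.trivial point ℝ)) x
  contMDiff_toFun := contMDiff_of_discreteTopology

/-- The coordinate `ε` of `D`, of degree `-1`; the function algebra of `D` is `ℝ[ε]`. -/
def ε : fatPoint.alg := fatBundle.ofSec 1 fatCoord

namespace GVB
variable {M : Mfd}

/-- `V ⊕ T[1]M ⊕ V[1]`; here `T[1]M` is `TM` in degree `-1`. -/
def tangentShift (V : GVB M) : GVB M := V.sum ((inDegree (-1) (VB.tangent M)).sum (V.shift 1))

/-- A covector of `V i` at `x`, as a generator of `S^{≥ 0} (V ⊕ T[1]M ⊕ V[1])^*` of degree `-i`, through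
the summand `V`. -/
def genV (V : GVB M) (i : ℤ) (x : M) (ξ : (V i).dual.Fiber x) : V.tangentShift.SymFiber x :=
  GSym.ι (N := fun i => (V.tangentShift i).dual.Fiber x) i (ξ.comp (VB.fstL _ _ x))

/-- A covector of `M` at `x`, as a generator of degree `1`, through the summand `T[1]M`. -/
def genT (V : GVB M) (x : M) (α : (VB.tangent M).dual.Fiber x) : V.tangentShift.SymFiber x :=
  GSym.ι (N := fun i => (V.tangentShift i).dual.Fiber x) (-1)
    (α.comp ((VB.castL (inDegree_self (-1) (VB.tangent M)) x).comp
      ((VB.fstL _ _ x).comp (VB.sndL _ _ x))))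

/-- A covector of `V (1 + j) = V[1]_j` at `x`, as a generator of degree `-j`, through the summand
`V[1]`. -/
def genShift (V : GVB M) (j : ℤ) (x : M) (ξ : (V (1 + j)).dual.Fiber x) :
    V.tangentShift.SymFiber x :=
  GSym.ι (N := fun i => (V.tangentShift i).dual.Fiber x) j
    (ξ.comp ((VB.sndL _ _ x).comp (VB.sndL _ _ x)))

/-- The image of an element `L` of `Hom (T_x M, (V i)_x^*) = T_x^* M ⊗ (V i)_x^*` under the multiplication
`α ⊗ ξ ↦ α ξ`, of degree `1 - i`. It is computed in the standard basis of `T_x M`, on which it does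
not depend. -/
def genConn (V : GVB M) (i : ℤ) (x : M)
    (L : TangentSpace (𝓡 M.dim) x →L[ℝ] (V i).dual.Fiber x) : V.tangentShift.SymFiber x :=
  ∑ a : Fin M.dim, V.genT x (EuclideanSpace.proj a) *
    V.genV i x (L (EuclideanSpace.single a (1 : ℝ)))

end GVB

/-- Let `X` be split by `V` over `M`, through `s`, and let `u : C(X) ⟶ C(D) ⊗ C(R)` be an element of
`Hom (D, X) (R)`. The splitting `e` of `R` by `V ⊕ T[1]M ⊕ V[1]` is the one induced by the connection
`nabla` on `V^*` if, after the identifications `s` and `e`, the morphism `u` is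
`f ↦ f + ε df` on smooth functions, and `σ ↦ σ + ε (σ[1] + ∇σ)` on sections of `V^*`, where `σ[1]` is
`σ` as a section of `V[1]^*`, and `∇σ` is a section of `T^*M ⊗ V^*`. That is, the splitting
`J¹ V^* = V^* ⊕ (T^*M ⊗ V^*)` of the jet bundle by the connection identifies `j¹σ` with `σ[1] + ∇σ`.
(Every degree `i` is of the form `1 + j`.) -/
structure IsInducedSplitting {X : ZMfd} {M : Mfd} {V : GVB M} (s : X.Splitting V)
    (nabla : ∀ i, (V i).dual.Conn) {R : ZMfd} (u : X.alg ⟶ fatPoint.alg.tensor R.alg)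
    (e : R.Splitting V.tangentShift) : Prop where
  on_functions : ∀ f : C^∞⟮𝓡 M.dim, M; ℝ⟯, ∃ a b : V.tangentShift.funAlg,
    (∀ x, V.tangentShift.val a x = algebraMap ℝ _ (f x)) ∧
    (∀ x, V.tangentShift.val b x = V.genT x (mvfderiv (𝓡 M.dim) f x)) ∧
    fatPoint.alg.tensorMap e.hom (u (s.inv (V.ofFun f))) = GrAlg.tmul 1 a + GrAlg.tmul ε b
  on_sections : ∀ (j : ℤ) (σ : (V (1 + j)).dual.Sec), ∃ a b : V.tangentShift.funAlg,
    (∀ x, V.tangentShift.val a x = V.genV (1 + j) x (σ x)) ∧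
    (∀ x, V.tangentShift.val b x =
      V.genShift j x (σ x) + V.genConn (1 + j) x ((nabla (1 + j)).cov σ x)) ∧
    fatPoint.alg.tensorMap e.hom (u (s.inv (V.ofSec (1 + j) σ))) =
      GrAlg.tmul 1 a + GrAlg.tmul ε b

end ZGraded

end

open ZGraded

open CategoryTheory Bundle
open scoped Manifold ContDiff TensorProduct DirectSum Topology

noncomputable section
namespace ZGraded

/-! ### Arity on the graded symmetric algebra -/
namespace GSym
variable {N : ℤ → Type} [∀ i, AddCommGroup (N i)] [∀ i, Module ℝ (N i)]

/-! Since `ε² = 0` and `ε` has degree `-1`, a morphism `a ↦ φ a + ε δ a` from `C(X)` to `C(D) ⊗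
C(T)` is the same as a degree preserving homomorphism `φ` together with a derivation `δ` of degree
`1` along `φ` (`Fat.pack_mul`, `Fat.part1_mul`, `Fat.mkHom`). A representing algebra is therefore
`C(X)` with a universal differential adjoined. For `X` split by `V` it is generated by functions
`f`, sections `σ` of `V^*`, and the differentials `df` and `dσ`. The `df` give the `1`-forms, that
is, `T[1]M`. The rule `d(fσ) = df σ + f dσ` is not linear over functions, but `dσ - ∇σ` is; this
difference is `σ[1]`, which gives `V[1]`. The resulting universal morphism is built in
`GVB.exists_univ`.

Conversely, a pair `(φ, δ)` forces the values of the factoring homomorphism. In coordinates `h a`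
with dual vector fields `X a` they are `α ↦ ∑ φ(α(X a)) δ(h a)` on `1`-forms and `σ[1] ↦ δσ - ∑ δ(h
a) φ(∇_{X a} σ)`. `GVB.exists_fiberHom` shows that these formulas work at one point, and
`GVB.exists_lift` glues over all points.

As smooth functions are not polynomials in the coordinates, everything rests on locality. At a point
`y`, the arity `0` part of `φ` on functions is a character of `C^∞(M)`, hence evaluation at a point
`g y` (`Mfd.exists_eval`), and `g` is continuous. If `s` vanishes near `g y`, a bump function `χ`
gives `χ s = 0`, and `φ χ` has augmentation `1` at `y`. It need not be invertible, because elements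
of degree `0` and positive arity need not be nilpotent. It can still be cancelled: an element in all
powers of the augmentation ideal is zero, arities being finite (`GSym.eq_zero_of_mul_eq_zero`). So
`φ` and `δ` depend on germs only. The same filtration and Hadamard's lemma show that `δ` is
determined on functions by its values on coordinates (`Mfd.derivation_eq_zero`). In the other
direction, `GVB.exists_algHom` constructs homomorphisms from local data on functions and sections.

Some connection always exists (`VB.exists_conn`), which gives representability. Existence and
uniqueness of the splitting of an arbitrary representing object then follow from the Yoneda lemma.
-/

theorem adjoin_ι : Algebra.adjoin ℝ {z : GSym N | ∃ i a, z = GSym.ι i a} = ⊤ := by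
  rw [eq_top_iff]
  intro z _
  have hz : z ∈ ⨆ d, GSym.gr N d := by rw [GSym.iSup_gr]; trivial
  have hle : ⨆ d, GSym.gr N d ≤
      Subalgebra.toSubmodule (Algebra.adjoin ℝ {z : GSym N | ∃ i a, z = GSym.ι i a}) := by
    refine iSup_le fun d => Submodule.span_le.2 ?_
    rintro _ ⟨l, -, rfl⟩
    refine Subalgebra.list_prod_mem _ fun w hw => ?_
    obtain ⟨p, -, rfl⟩ := List.mem_map.1 hw
    exact Algebra.subset_adjoin ⟨p.1, p.2, rfl⟩
  exact hle hz

@[elab_as_elim]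
theorem induction {P : GSym N → Prop} (halg : ∀ r, P (algebraMap ℝ _ r))
    (hι : ∀ i a, P (GSym.ι i a)) (hadd : ∀ x y, P x → P y → P (x + y))
    (hmul : ∀ x y, P x → P y → P (x * y)) (z : GSym N) : P z := by
  have hz : z ∈ Algebra.adjoin ℝ {z : GSym N | ∃ i a, z = GSym.ι i a} := by
    rw [adjoin_ι]; trivial
  induction hz using Algebra.adjoin_induction with
  | mem x hx => obtain ⟨i, a, rfl⟩ := hx; exact hι i a
  | algebraMap r => exact halg r
  | add x y _ _ hx hy => exact hadd x y hx hy
  | mul x y _ _ hx hy => exact hmul x y hx hy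

/-- The augmentation, killing the generators. -/
def aug : GSym N →ₐ[ℝ] ℝ := GSym.lift (fun _ => 0) (by simp)

@[simp] theorem aug_ι (i : ℤ) (a : N i) : aug (GSym.ι i a) = 0 := by
  rw [aug, GSym.lift_ι]; rfl

/-- The coaction of the multiplicative monoid of `ℝ` that counts the arity: `ι a ↦ ι a * X`. -/
def arity : GSym N →ₐ[ℝ] Polynomial (GSym N) :=
  GSym.lift (fun i => (Polynomial.monomial 1).restrictScalars ℝ ∘ₗ GSym.ι i) (by
    intro i j a b
    simp only [LinearMap.comp_apply, LinearMap.coe_restrictScalars,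
      Polynomial.monomial_mul_monomial]
    rw [GSym.ι_mul_ι i j]
    rcases Int.units_eq_one_or ((-1 : ℤˣ) ^ (i * j)) with h | h <;> rw [h] <;>
      simp [Units.smul_def])

@[simp] theorem arity_ι (i : ℤ) (a : N i) :
    arity (GSym.ι i a) = Polynomial.monomial 1 (GSym.ι i a) := by
  rw [arity, GSym.lift_ι]; rfl

theorem coeff_zero_arity (z : GSym N) :
    (arity z).coeff 0 = algebraMap ℝ (GSym N) (aug z) := by
  induction z using GSym.induction with
  | halg r => simp [Polynomial.algebraMap_apply]
  | hι i a => simp [Polynomial.coeff_monomial]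
  | hadd x y hx hy => simp [hx, hy]
  | hmul x y hx hy => simp [Polynomial.mul_coeff_zero, hx, hy]

theorem eval_arity (z : GSym N) : (arity z).eval 1 = z := by
  induction z using GSym.induction with
  | halg r => simp [Polynomial.algebraMap_apply]
  | hι i a => simp
  | hadd x y hx hy => simp [hx, hy]
  | hmul x y hx hy =>
    rw [map_mul, Polynomial.eval, Polynomial.eval₂_mul_noncomm _ _ fun _ => Commute.one_right _]
    exact congrArg₂ (· * ·) hx hy

theorem X_dvd_arity {z : GSym N} (h : aug z = 0) : Polynomial.X ∣ arity z := by
  rw [Polynomial.X_dvd_iff, coeff_zero_arity, h, map_zero]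

/-- `arity z` has finitely many coefficients, and evaluating it at `1` gives back `z`. This
separatedness of the arity filtration stands in for nilpotency, which fails: a product of generators
of opposite even degrees has degree `0` and need not be nilpotent. -/
theorem eq_zero_of_forall_dvd {z : GSym N} (h : ∀ k : ℕ, Polynomial.X ^ k ∣ arity z) :
    z = 0 := by
  have h0 : arity z = 0 := by
    ext n
    rw [(Polynomial.X_pow_dvd_iff.1 (h (n + 1))) n (Nat.lt_succ_self n), Polynomial.coeff_zero]
  rw [← eval_arity z, h0, Polynomial.eval_zero]

/-- Powers of `X` are central in the polynomial ring even though its coefficients do not commute, so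
they can be collected from both factors. -/
theorem X_pow_succ_dvd_arity_mul {a b : GSym N} {k : ℕ} (ha : aug a = 0)
    (hb : Polynomial.X ^ k ∣ arity b) : Polynomial.X ^ (k + 1) ∣ arity (a * b) := by
  obtain ⟨p, hp⟩ := X_dvd_arity ha
  obtain ⟨q, hq⟩ := hb
  refine ⟨p * q, ?_⟩
  rw [map_mul, hp, hq, mul_assoc, ← mul_assoc p, ← (Polynomial.commute_X_pow p k).eq, pow_succ']
  simp only [mul_assoc]

/-- The identity `b = (1 - a) * b`, with `1 - a` in the augmentation ideal, moves `b` into every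
power of that ideal. No inverse of `a` is needed. -/
theorem eq_zero_of_mul_eq_zero {a b : GSym N} (ha : aug a = 1) (hab : a * b = 0) : b = 0 := by
  refine eq_zero_of_forall_dvd fun k => ?_
  induction k with
  | zero => simp
  | succ k ih =>
    have h : b = (1 - a) * b := by rw [sub_mul, hab, one_mul, sub_zero]
    rw [h]
    exact X_pow_succ_dvd_arity_mul (by simp [ha]) ih

/-- Elements of degree zero are central. -/
theorem commute_of_mem_zero {a : GSym N} (ha : a ∈ GSym.gr N 0) (b : GSym N) : Commute a b := by
  have hb : b ∈ ⨆ d, GSym.gr N d := by rw [GSym.iSup_gr]; trivial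
  induction hb using Submodule.iSup_induction' with
  | zero => exact Commute.zero_right a
  | add x y _ _ hx hy => exact hx.add_right hy
  | mem d x hx =>
    have h := GSym.graded_comm 0 d a x ha hx
    rwa [zero_mul, uzpow_zero, one_smul] at h

end GSym

/-! ### Smooth functions and sections -/

namespace Mfd

/-- The algebra of smooth functions. -/
abbrev Fun (M : Mfd) : Type := C^∞⟮𝓡 M.dim, M; ℝ⟯

instance (M : Mfd) : LocallyCompactSpace M := Manifold.locallyCompact_of_finiteDimensional (𝓡 M.dim)

variable {M : Mfd}

theorem exists_bump {x : M} {U : Set M} (hU : U ∈ 𝓝 x) :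
    ∃ χ : M.Fun, (∀ᶠ z in 𝓝 x, χ z = 1) ∧ tsupport χ ⊆ U := by
  obtain ⟨f, -, hf⟩ := (SmoothBumpFunction.nhds_basis_tsupport (I := 𝓡 M.dim) x).mem_iff.1 hU
  exact ⟨⟨f, f.contMDiff⟩, f.eventuallyEq_one, hf⟩

theorem exists_fun_eventuallyEq {x : M} {U : Set M} (hU : IsOpen U) (hx : x ∈ U) {f : M → ℝ}
    (hf : ContMDiffOn (𝓡 M.dim) 𝓘(ℝ, ℝ) ∞ f U) : ∃ g : M.Fun, ∀ᶠ z in 𝓝 x, g z = f z := by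
  obtain ⟨χ, h1, h2⟩ := exists_bump (hU.mem_nhds hx)
  refine ⟨⟨fun z => χ z * f z, contMDiff_of_tsupport fun z hz => ?_⟩, ?_⟩
  · have hz' : z ∈ U := h2 (closure_mono (Function.support_mul_subset_left _ _) hz)
    exact χ.contMDiff.contMDiffAt.mul (hf.contMDiffAt (hU.mem_nhds hz'))
  · filter_upwards [h1] with z hz
    change χ z * f z = f z
    rw [hz, one_mul]

end Mfd

namespace VB
variable {M : Mfd}

/-- The product of a smooth function and a section. -/
def fsmul {E : VB M} (f : M.Fun) (σ : E.Sec) : E.Sec :=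
  ⟨fun x => f x • σ x, f.contMDiff.smul_section σ.contMDiff⟩

@[simp] theorem fsmul_apply {E : VB M} (f : M.Fun) (σ : E.Sec) (x : M) :
    fsmul f σ x = f x • σ x := rfl

/-- The pairing of a section of the dual bundle with a section. -/
def pair {E : VB M} (α : E.dual.Sec) (v : E.Sec) : M.Fun :=
  ⟨fun z => α z (v z), fun x => (contMDiffAt_section x).1
    (ContMDiff.clm_bundle_apply (b := id) α.contMDiff v.contMDiff x)⟩

@[simp] theorem pair_apply {E : VB M} (α : E.dual.Sec) (v : E.Sec) (x : M) :
    pair α v x = α x (v x) := rfl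

theorem exists_sec_eventuallyEq {E : VB M} {x : M} {U : Set M} (hU : IsOpen U) (hx : x ∈ U)
    {s : ∀ x, E.Fiber x} (hs : ContMDiffOn (𝓡 M.dim) ((𝓡 M.dim).prod 𝓘(ℝ, E.Model)) ∞
      (fun x => TotalSpace.mk' E.Model x (s x)) U) : ∃ σ : E.Sec, ∀ᶠ z in 𝓝 x, σ z = s z := by
  obtain ⟨χ, h1, h2⟩ := Mfd.exists_bump (hU.mem_nhds hx)
  refine ⟨⟨fun z => χ z • s z,
    ContMDiffOn.smul_section_of_tsupport χ.contMDiff.contMDiffOn hU h2 hs⟩, ?_⟩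
  filter_upwards [h1] with z hz
  change χ z • s z = s z
  rw [hz, one_smul]

/-- The trivialization at `x`, as a family of linear maps to the model fiber (zero away from the
base set). -/
def triv (E : VB M) (x z : M) : E.Fiber z →ₗ[ℝ] E.Model :=
  (trivializationAt E.Model E.Fiber x).linearMapAt ℝ z

/-- Near every point there is a frame of global sections, which is constant in the trivialization. -/
theorem exists_frame (E : VB M) (x : M) :
    ∃ e : Fin (Module.finrank ℝ E.Model) → E.Sec,
      (∀ᶠ z in 𝓝 x, ∀ k, E.triv x z (e k z) = Module.finBasis ℝ E.Model k) ∧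
      ∀ σ : E.Sec, ∃ c : Fin (Module.finrank ℝ E.Model) → M.Fun,
        ∀ᶠ z in 𝓝 x, σ z = ∑ k, c k z • e k z := by
  let t := trivializationAt E.Model E.Fiber x
  have hx : x ∈ t.baseSet := FiberBundle.mem_baseSet_trivializationAt' x
  let b := Module.finBasis ℝ E.Model
  have h1 : ∀ k, ∃ σ : E.Sec, ∀ᶠ z in 𝓝 x, σ z = t.localFrame b k z := fun k =>
    exists_sec_eventuallyEq t.open_baseSet hx
      (t.contMDiffOn_localFrame_baseSet (I := 𝓡 M.dim) ∞ b k)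
  choose e he using h1
  have he' := Filter.eventually_all.2 he
  refine ⟨e, ?_, fun σ => ?_⟩
  · filter_upwards [he', t.open_baseSet.mem_nhds hx] with z hz hzt k
    rw [hz k, t.localFrame_apply_of_mem_baseSet b hzt, Trivialization.basisAt,
      Module.Basis.map_apply]
    refine (congrFun (t.coe_linearMapAt_of_mem (R := ℝ) hzt) _).trans ?_
    exact (t.linearEquivAt ℝ z hzt).apply_symm_apply _
  · have h2 : ∀ k, ∃ c : M.Fun, ∀ᶠ z in 𝓝 x, c z =
        (LinearMap.piApply (t.localFrameCoeff (𝓡 M.dim) b k)) σ z := fun k =>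
      Mfd.exists_fun_eventuallyEq t.open_baseSet hx
        (contMDiffOn_baseSet_localFrameCoeff b σ.contMDiff.contMDiffOn k)
    choose c hc using h2
    refine ⟨c, ?_⟩
    filter_upwards [he', Filter.eventually_all.2 hc, t.open_baseSet.mem_nhds hx] with z hz hz' hzt
    rw [Trivialization.eq_sum_localFrameCoeff_smul (I := 𝓡 M.dim) (e := t) (b := b) (s := σ) hzt]
    refine Finset.sum_congr rfl fun k _ => ?_
    rw [hz k, hz' k]
    rfl

/-- A family of covectors is smooth if its pairings with smooth sections are. -/
theorem contMDiff_dual {E : VB M} {α : ∀ x, E.dual.Fiber x}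
    (h : ∀ v : E.Sec, ContMDiff (𝓡 M.dim) 𝓘(ℝ, ℝ) ∞ fun z => (α z (v z) : ℝ)) :
    ContMDiff (𝓡 M.dim) ((𝓡 M.dim).prod 𝓘(ℝ, E.dual.Model)) ∞
      (fun x => TotalSpace.mk' E.dual.Model x (α x)) := by
  intro x
  obtain ⟨e, he, -⟩ := exists_frame E x
  rw [contMDiffAt_hom_bundle]
  refine ⟨contMDiffAt_id, ?_⟩
  let b := Module.finBasis ℝ E.Model
  -- In the trivialization the frame is the constant basis `b`, so the coefficients of the covector
  -- field are its pairings with the frame.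
  have hs : ContMDiffAt (𝓡 M.dim) 𝓘(ℝ, E.Model →L[ℝ] ℝ) ∞
      (fun z => ∑ k, (α z (e k z) : ℝ) • LinearMap.toContinuousLinearMap (b.coord k)) x :=
    contMDiffAt_finsetSum fun k _ => (h (e k) x).smul contMDiffAt_const
  refine hs.congr_of_eventuallyEq ?_
  let t := trivializationAt E.Model E.Fiber x
  have hx : x ∈ t.baseSet := FiberBundle.mem_baseSet_trivializationAt' x
  filter_upwards [he, t.open_baseSet.mem_nhds hx] with z hz hzt
  rw [ContinuousLinearMap.inCoordinates_eq hzt (Set.mem_univ _)]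
  refine ContinuousLinearMap.coe_injective (b.ext fun l => ?_)
  have h3 : (t.continuousLinearEquivAt ℝ z hzt).symm (b l) = e l z := by
    rw [ContinuousLinearEquiv.symm_apply_eq, ← hz l]
    exact congrFun (t.coe_linearMapAt_of_mem (R := ℝ) hzt) _
  simp only [FunLike.coe_sum, ContinuousLinearMap.coe_coe, Finset.sum_apply]
  have h4 : ∀ k, ((α z (e k z) : ℝ) • LinearMap.toContinuousLinearMap (b.coord k)) (b l) =
      if l = k then (α z (e k z) : ℝ) else 0 := by
    intro k
    simp [Finsupp.single_apply]
  change α z ((t.continuousLinearEquivAt ℝ z hzt).symm (b l)) = _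
  rw [h3]
  simp [h4]

end VB

/-! ### Hadamard's lemma, coordinates and connections -/

/-- The integral is the value at `0` of the convolution of the indicator of `(0, 1]` with `s ↦ χ s *
G (p, -s)`, so smoothness of convolutions with parameters applies. The bump `χ` is `1` on the ball
of radius `2`, which contains all the points `-t` that occur, and its support in radius `3` provides
the required compact support. -/
theorem contDiff_intervalIntegral_param {P : Type} [NormedAddCommGroup P] [NormedSpace ℝ P]
    {G : P × ℝ → ℝ} (hG : ContDiff ℝ ∞ G) : ContDiff ℝ ∞ fun p => ∫ t in (0 : ℝ)..1, G (p, t) := by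
  let χ : ContDiffBump (0 : ℝ) := ⟨2, 3, by norm_num, by norm_num⟩
  have h := MeasureTheory.contDiffOn_convolution_right_with_param (𝕜 := ℝ) (n := ⊤)
    (μ := MeasureTheory.volume) (f := Set.indicator (Set.Ioc (0 : ℝ) 1) fun _ => (1 : ℝ))
    (ContinuousLinearMap.mul ℝ ℝ) (g := fun p s => χ s * G (p, -s)) (s := Set.univ)
    (k := Metric.closedBall 0 3) isOpen_univ (isCompact_closedBall _ _)
    (fun p s _ hs => by
      have : χ s = 0 := χ.zero_of_le_dist (le_of_lt (not_le.1 hs))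
      simp [this])
    ((MeasureTheory.integrable_indicator_iff measurableSet_Ioc).2
      (MeasureTheory.integrableOn_const (by simp))).locallyIntegrable
    (ContDiff.contDiffOn (by
      change ContDiff ℝ ∞ fun q : P × ℝ => χ q.2 * G (q.1, -q.2)
      exact (χ.contDiff.comp contDiff_snd).mul
        (hG.comp (contDiff_fst.prodMk contDiff_snd.neg))))
  rw [Set.univ_prod_univ, contDiffOn_univ] at h
  have h2 := h.comp (contDiff_id.prodMk (contDiff_const (c := (0 : ℝ))) : ContDiff ℝ ∞ fun p : P => (p, (0 : ℝ)))
  convert h2 using 1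
  funext p
  rw [intervalIntegral.integral_of_le zero_le_one, Function.comp, MeasureTheory.convolution,
    ← MeasureTheory.integral_indicator measurableSet_Ioc]
  refine MeasureTheory.integral_congr_ae (Filter.Eventually.of_forall fun t => ?_)
  by_cases ht : t ∈ Set.Ioc (0 : ℝ) 1
  · have : χ (-t) = 1 := χ.one_of_mem_closedBall (by
      rw [mem_closedBall_zero_iff, norm_neg, Real.norm_eq_abs, abs_of_pos ht.1]
      exact ht.2.trans (by norm_num))
    simp [ht, this]
  · simp [ht]

/-- Hadamard's lemma. -/
theorem hadamard {n : ℕ} {F : EuclideanSpace ℝ (Fin n) → ℝ} (hF : ContDiff ℝ ∞ F)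
    (c : EuclideanSpace ℝ (Fin n)) : ∃ K : Fin n → EuclideanSpace ℝ (Fin n) → ℝ,
      (∀ a, ContDiff ℝ ∞ (K a)) ∧ ∀ p, F p = F c + ∑ a, (p a - c a) * K a p := by
  have hF' : ContDiff ℝ ∞ (fderiv ℝ F) := hF.fderiv_right (by simp)
  refine ⟨fun a p => ∫ t in (0 : ℝ)..1,
    fderiv ℝ F (c + t • (p - c)) (EuclideanSpace.single a (1 : ℝ)), fun a => ?_, fun p => ?_⟩
  · exact contDiff_intervalIntegral_param (G := fun q : EuclideanSpace ℝ (Fin n) × ℝ =>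
      fderiv ℝ F (c + q.2 • (q.1 - c)) (EuclideanSpace.single a (1 : ℝ)))
      ((hF'.comp (contDiff_const.add (contDiff_snd.smul (contDiff_fst.sub contDiff_const)))).clm_apply
        contDiff_const)
  · have hd : ∀ t : ℝ, HasDerivAt (fun t : ℝ => F (c + t • (p - c)))
        (fderiv ℝ F (c + t • (p - c)) (p - c)) t := by
      intro t
      have h1 : HasDerivAt (fun t : ℝ => c + t • (p - c)) (p - c) t := by
        simpa using ((hasDerivAt_id t).smul_const (p - c)).const_add c
      exact ((hF.differentiable (by simp)) _).hasFDerivAt.comp_hasDerivAt t h1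
    have hcont : ∀ v, Continuous fun t : ℝ => fderiv ℝ F (c + t • (p - c)) v := fun v =>
      (hF'.continuous.comp (by fun_prop)).clm_apply continuous_const
    have h2 := intervalIntegral.integral_eq_sub_of_hasDerivAt (a := 0) (b := 1)
      (fun t _ => hd t) ((hcont _).intervalIntegrable _ _)
    rw [one_smul, zero_smul, add_zero, add_sub_cancel] at h2
    rw [← sub_eq_iff_eq_add', ← h2]
    have h3 : p - c = ∑ a, (p a - c a) • EuclideanSpace.single a (1 : ℝ) := by
      have := (EuclideanSpace.basisFun (Fin n) ℝ).sum_repr (p - c)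
      simpa using this.symm
    simp_rw [← intervalIntegral.integral_const_mul]
    rw [← intervalIntegral.integral_finsetSum fun a _ =>
      ((hcont _).const_mul _).intervalIntegrable _ _]
    refine intervalIntegral.integral_congr fun t _ => ?_
    conv_lhs => rw [h3]
    rw [map_sum]
    exact Finset.sum_congr rfl fun a _ => by rw [map_smul, smul_eq_mul, h3]

namespace Mfd
variable {M : Mfd}

/-- The differential of a function, as a section of the cotangent bundle. -/
def dFun (f : M.Fun) : (VB.tangent M).dual.Sec :=
  ⟨fun x => mvfderiv (𝓡 M.dim) f x, VB.contMDiff_dual fun X => by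
    have h1 : ContMDiff (𝓡 M.dim).tangent 𝓘(ℝ, ℝ).tangent ∞ (tangentMap (𝓡 M.dim) 𝓘(ℝ, ℝ) f) :=
      f.contMDiff.contMDiff_tangentMap (by simp)
    exact (contMDiff_snd_tangentBundle_modelSpace ℝ 𝓘(ℝ, ℝ)).comp (h1.comp X.contMDiff)⟩

@[simp] theorem dFun_apply (f : M.Fun) (x : M) : dFun f x = mvfderiv (𝓡 M.dim) f x := rfl

/-- The functions are cut-off chart coordinates and the vector fields are cut-off coordinate fields.
They are global, so that homomorphisms of global function algebras can be applied to them, but their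
duality and the Hadamard expansion hold only near `x`. -/
theorem exists_coordinates (x : M) : ∃ (h : Fin M.dim → M.Fun) (X : Fin M.dim → (VB.tangent M).Sec),
    (∀ᶠ z in 𝓝 x, ∀ a b, VB.pair (dFun (h a)) (X b) z = if a = b then 1 else 0) ∧
    ∀ f : M.Fun, ∃ k : Fin M.dim → M.Fun,
      ∀ᶠ z in 𝓝 x, f z = f x + ∑ a, (h a z - h a x) * k a z := by
  let ψ := extChartAt (𝓡 M.dim) x
  have hs : IsOpen (chartAt (EuclideanSpace ℝ (Fin M.dim)) x).source :=
    (chartAt (EuclideanSpace ℝ (Fin M.dim)) x).open_source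
  have hxs : x ∈ (chartAt (EuclideanSpace ℝ (Fin M.dim)) x).source := mem_chart_source _ x
  have hψ : ContMDiffOn (𝓡 M.dim) 𝓘(ℝ, EuclideanSpace ℝ (Fin M.dim)) ∞ ψ
      (chartAt (EuclideanSpace ℝ (Fin M.dim)) x).source := contMDiffOn_extChartAt
  have h1 : ∀ a, ∃ h : M.Fun, ∀ᶠ z in 𝓝 x, h z = ψ z a := fun a =>
    exists_fun_eventuallyEq hs hxs
      ((EuclideanSpace.proj a : EuclideanSpace ℝ (Fin M.dim) →L[ℝ] ℝ).contMDiff.comp_contMDiffOn hψ)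
  choose h hh using h1
  let t := trivializationAt (VB.tangent M).Model (VB.tangent M).Fiber x
  let b := (EuclideanSpace.basisFun (Fin M.dim) ℝ).toBasis
  have hx : x ∈ t.baseSet := FiberBundle.mem_baseSet_trivializationAt' x
  have h2 : ∀ k, ∃ σ : (VB.tangent M).Sec, ∀ᶠ z in 𝓝 x, σ z = t.localFrame b k z := fun k =>
    VB.exists_sec_eventuallyEq t.open_baseSet hx
      (t.contMDiffOn_localFrame_baseSet (I := 𝓡 M.dim) ∞ b k)
  choose X hX using h2
  refine ⟨h, X, ?_, fun f => ?_⟩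
  · filter_upwards [Filter.eventually_all.2 fun a => eventually_eventually_nhds.2 (hh a),
      Filter.eventually_all.2 hX, hs.mem_nhds hxs] with z hz hz' hzs a c
    have hzt : z ∈ t.baseSet := by
      rwa [TangentBundle.trivializationAt_baseSet]
    have hd : HasMFDerivAt (𝓡 M.dim) 𝓘(ℝ, EuclideanSpace ℝ (Fin M.dim)) ψ z
        (t.continuousLinearMapAt ℝ z) := by
      rw [TangentBundle.continuousLinearMapAt_trivializationAt hzs]
      exact ((hψ.contMDiffAt (hs.mem_nhds hzs)).mdifferentiableAt (by simp)).hasMFDerivAt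
    have hd2 : HasMFDerivAt (𝓡 M.dim) 𝓘(ℝ, ℝ) (fun z => ψ z a) z
        ((EuclideanSpace.proj a : EuclideanSpace ℝ (Fin M.dim) →L[ℝ] ℝ).comp
          (t.continuousLinearMapAt ℝ z)) :=
      ((EuclideanSpace.proj a : EuclideanSpace ℝ (Fin M.dim) →L[ℝ] ℝ).hasMFDerivAt).comp z hd
    have hd3 := hd2.congr_of_eventuallyEq (hz a)
    have h4 : t.continuousLinearMapAt ℝ z (t.localFrame b c z) = b c := by
      rw [t.localFrame_apply_of_mem_baseSet b hzt, Trivialization.basisAt, Module.Basis.map_apply]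
      refine (congrFun (t.coe_linearMapAt_of_mem (R := ℝ) hzt) _).trans ?_
      exact (t.linearEquivAt ℝ z hzt).apply_symm_apply _
    rw [VB.pair_apply, hz' c]
    change mfderiv (𝓡 M.dim) 𝓘(ℝ, ℝ) (h a) z (t.localFrame b c z) = _
    rw [hd3.mfderiv]
    change (t.continuousLinearMapAt ℝ z (t.localFrame b c z)) a = _
    rw [h4]
    simp [b]
  · have htgt : ψ.target ∈ 𝓝 (ψ x) := extChartAt_target_mem_nhds x
    obtain ⟨r, hr, hr2⟩ := Metric.mem_nhds_iff.1 htgt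
    -- The cutoff makes `χ * (f ∘ ψ⁻¹)` smooth on the whole Euclidean space, where Hadamard's lemma
    -- needs no star-shaped domain. Its support lies in the closed ball of radius `r / 2`, hence
    -- inside the chart target.
    let χ : ContDiffBump (ψ x) := ⟨r / 4, r / 2, by positivity, by linarith⟩
    have hF : ContDiff ℝ ∞ fun p => χ p * f (ψ.symm p) := by
      refine (contMDiff_of_tsupport (I := 𝓘(ℝ, EuclideanSpace ℝ (Fin M.dim))) (I' := 𝓘(ℝ, ℝ))
        fun p hp => ContDiffAt.contMDiffAt ?_).contDiff
      have hp' : p ∈ ψ.target := hr2 (by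
        have h5 := closure_mono (Function.support_mul_subset_left (fun p => χ p) _) hp
        have h6 : p ∈ tsupport χ := h5
        rw [χ.tsupport_eq] at h6
        exact Metric.closedBall_subset_ball (by change r / 2 < r; linarith) h6)
      have h7 : ContMDiffAt 𝓘(ℝ, EuclideanSpace ℝ (Fin M.dim)) 𝓘(ℝ, ℝ) ∞ (fun p => f (ψ.symm p)) p :=
        f.contMDiff.contMDiffAt.comp p
          ((contMDiffOn_extChartAt_symm x).contMDiffAt ((isOpen_extChartAt_target x).mem_nhds hp'))
      exact χ.contDiff.contDiffAt.mul h7.contDiffAt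
    obtain ⟨K, hK, hK2⟩ := hadamard hF (ψ x)
    have h8 : ∀ a, ∃ k : M.Fun, ∀ᶠ z in 𝓝 x, k z = K a (ψ z) := fun a =>
      exists_fun_eventuallyEq hs hxs ((hK a).contMDiff.comp_contMDiffOn hψ)
    choose k hk using h8
    have hcont : ContinuousAt ψ x := continuousAt_extChartAt x
    refine ⟨k, ?_⟩
    filter_upwards [Filter.eventually_all.2 hk, Filter.eventually_all.2 hh, hs.mem_nhds hxs,
      hcont.eventually χ.eventuallyEq_one] with z hz1 hz2 hzs hz3
    have h9 := hK2 (ψ z)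
    rw [hz3, Pi.one_apply, one_mul, χ.one_of_mem_closedBall (Metric.mem_closedBall_self χ.rIn_pos.le), one_mul, extChartAt_to_inv x,
      (extChartAt (𝓡 M.dim) x).left_inv (by rwa [extChartAt_source])] at h9
    rw [h9]
    congr 1
    refine Finset.sum_congr rfl fun a _ => ?_
    rw [hz1 a, hz2 a, (hh a).self_of_nhds]

end Mfd

namespace VB.Conn
variable {M : Mfd} {E : VB M}

/-- The covariant derivative of a section along a vector field. -/
def along (D : E.Conn) (X : (VB.tangent M).Sec) (σ : E.Sec) : E.Sec :=
  ⟨fun x => D.cov σ x (X x), by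
    have h := D.smooth.contMDiff.contMDiff (σ := σ) (σ.contMDiff.contMDiffOn (s := Set.univ))
    exact ContMDiff.clm_bundle_apply (b := id) (contMDiffOn_univ.1 h) X.contMDiff⟩

theorem mdifferentiableAt (σ : E.Sec) (x : M) :
    MDifferentiableAt (𝓡 M.dim) ((𝓡 M.dim).prod 𝓘(ℝ, E.Model))
      (fun x => TotalSpace.mk' E.Model x (σ x)) x :=
  σ.contMDiff.contMDiffAt.mdifferentiableAt (by simp)

theorem cov_add (D : E.Conn) (σ τ : E.Sec) (x : M) :
    D.cov ⇑(σ + τ) x = D.cov σ x + D.cov τ x :=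
  D.cov.isCovariantDerivativeOnUniv.add (mdifferentiableAt σ x) (mdifferentiableAt τ x)

theorem cov_fsmul (D : E.Conn) (f : M.Fun) (σ : E.Sec) (x : M) :
    D.cov ⇑(fsmul f σ) x = f x • D.cov σ x + (mvfderiv (𝓡 M.dim) f x).smulRight (σ x) :=
  D.cov.isCovariantDerivativeOnUniv.leibniz (mdifferentiableAt σ x)
    (f.contMDiff.contMDiffAt.mdifferentiableAt (by simp))

theorem cov_smul (D : E.Conn) (r : ℝ) (σ : E.Sec) (x : M) :
    D.cov ⇑(r • σ) x = r • D.cov σ x :=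
  D.cov.isCovariantDerivativeOnUniv.smul_const r (mdifferentiableAt σ x)

end VB.Conn

/-! ### Function algebras of split graded manifolds -/
namespace GVB
variable {M : Mfd} (V : GVB M)

/-- The inclusion of `Γ (S^{≥ 0} V^*)` in the algebra of all sections. -/
def valHom : V.funAlg →ₐ[ℝ] ∀ x, V.SymFiber x := (supAlg V.homSec).val

/-- Evaluation at a point. -/
def evAt (x : M) : V.funAlg →ₐ[ℝ] V.SymFiber x :=
  (Pi.evalAlgHom ℝ (fun x => V.SymFiber x) x).comp V.valHom

variable {V} in
theorem funAlg_ext {s t : V.funAlg} (h : ∀ x, V.evAt x s = V.evAt x t) : s = t :=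
  Subtype.ext (funext h)

theorem mem_gr_iff {d : ℤ} {s : V.funAlg} : s ∈ V.funAlg.gr d ↔ V.val s ∈ V.homSec d := Iff.rfl

theorem evAt_mem_gr {d : ℤ} {s : V.funAlg} (hs : s ∈ V.funAlg.gr d) (x : M) :
    V.evAt x s ∈ GSym.gr (fun i => (V i).dual.Fiber x) d :=
  ((V.mem_gr_iff).1 hs).1 x

/-- Functions as elements of arity `0`. -/
def ofFunHom : M.Fun →ₐ[ℝ] V.funAlg where
  toFun := V.ofFun
  map_one' := funAlg_ext fun x => (algebraMap ℝ (V.SymFiber x)).map_one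
  map_mul' _ _ := funAlg_ext fun x => (algebraMap ℝ (V.SymFiber x)).map_mul _ _
  map_zero' := funAlg_ext fun x => (algebraMap ℝ (V.SymFiber x)).map_zero
  map_add' _ _ := funAlg_ext fun x => (algebraMap ℝ (V.SymFiber x)).map_add _ _
  commutes' _ := rfl

@[simp] theorem evAt_ofFunHom (f : M.Fun) (x : M) :
    V.evAt x (V.ofFunHom f) = algebraMap ℝ (V.SymFiber x) (f x) := rfl

@[simp] theorem evAt_ofFun (f : M.Fun) (x : M) :
    V.evAt x (V.ofFun f) = algebraMap ℝ (V.SymFiber x) (f x) := rfl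

theorem ofFun_mem (f : M.Fun) : V.ofFun f ∈ V.funAlg.gr 0 :=
  (V.mem_gr_iff).2 ⟨fun x => SetLike.algebraMap_mem_graded _ (f x), fun _ => ⟨_, Algebra.subset_adjoin
      (Or.inl ⟨f, fun _ => rfl⟩), Filter.Eventually.of_forall fun _ => rfl⟩⟩

/-- Sections as elements of arity `1`. -/
def ofSecLin (i : ℤ) : (V i).dual.Sec →ₗ[ℝ] V.funAlg where
  toFun := V.ofSec i
  map_add' _ _ := funAlg_ext fun x => (GSym.ι (N := fun i => (V i).dual.Fiber x) i).map_add _ _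
  map_smul' _ _ := funAlg_ext fun x => (GSym.ι (N := fun i => (V i).dual.Fiber x) i).map_smul _ _

@[simp] theorem evAt_ofSec (i : ℤ) (σ : (V i).dual.Sec) (x : M) :
    V.evAt x (V.ofSec i σ) = GSym.ι (N := fun i => (V i).dual.Fiber x) i (σ x) := rfl

theorem ofSec_mem (i : ℤ) (σ : (V i).dual.Sec) : V.ofSec i σ ∈ V.funAlg.gr (-i) :=
  (V.mem_gr_iff).2 ⟨fun x => GSym.ι_mem (N := fun i => (V i).dual.Fiber x) i (σ x), fun _ =>
    ⟨_, Algebra.subset_adjoin (Or.inr ⟨i, σ, fun _ => rfl⟩), Filter.Eventually.of_forall fun _ => rfl⟩⟩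

theorem ofSec_fsmul (i : ℤ) (f : M.Fun) (σ : (V i).dual.Sec) :
    V.ofSec i (VB.fsmul f σ) = V.ofFun f * V.ofSec i σ := funAlg_ext fun x => by
  rw [map_mul, evAt_ofSec, evAt_ofFun, evAt_ofSec, VB.fsmul_apply, map_smul, Algebra.smul_def]

/-- The elements that are globally polynomial in functions and sections of the `(V i)^*`. -/
def polyAlg : Subalgebra ℝ V.funAlg :=
  Algebra.adjoin ℝ ({s | ∃ f, s = V.ofFun f} ∪ {s | ∃ i σ, s = V.ofSec i σ})

variable {V} in
theorem poly_induction {P : V.funAlg → Prop} (hf : ∀ f, P (V.ofFun f))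
    (hσ : ∀ i σ, P (V.ofSec i σ)) (hadd : ∀ s t, P s → P t → P (s + t))
    (hmul : ∀ s t, P s → P t → P (s * t)) {s : V.funAlg} (hs : s ∈ V.polyAlg) : P s := by
  induction hs using Algebra.adjoin_induction with
  | mem x hx =>
    rcases hx with ⟨f, rfl⟩ | ⟨i, σ, rfl⟩
    · exact hf f
    · exact hσ i σ
  | algebraMap r => exact hf (algebraMap ℝ _ r)
  | add x y _ _ hx hy => exact hadd x y hx hy
  | mul x y _ _ hx hy => exact hmul x y hx hy

/-- Smooth sections are polynomial only near each point, and the arity of a homogeneous section need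
not be bounded globally. This is why homomorphisms are compared on germs and not simply on
generators. -/
theorem exists_poly (s : V.funAlg) (x : M) :
    ∃ p ∈ V.polyAlg, ∀ᶠ z in 𝓝 x, V.evAt z s = V.evAt z p := by
  have key : ∀ t ∈ V.polySec, ∃ p ∈ V.polyAlg, V.val p = t := by
    intro t ht
    have hle : V.polySec ≤ V.polyAlg.map V.valHom := by
      refine Algebra.adjoin_le ?_
      rintro t (⟨f, hf⟩ | ⟨i, σ, hσ⟩)
      · exact ⟨V.ofFun f, Algebra.subset_adjoin (Or.inl ⟨f, rfl⟩), funext fun z => (hf z).symm⟩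
      · exact ⟨V.ofSec i σ, Algebra.subset_adjoin (Or.inr ⟨i, σ, rfl⟩),
          funext fun z => (hσ z).symm⟩
    exact hle ht
  have hs : V.val s ∈ ⨆ d, V.homSec d := s.2
  have main : ∀ t ∈ ⨆ d, V.homSec d, ∃ p ∈ V.polyAlg, ∀ᶠ z in 𝓝 x, t z = V.val p z := by
    intro t ht
    induction ht using Submodule.iSup_induction' with
    | zero => exact ⟨0, zero_mem _, Filter.Eventually.of_forall fun _ => rfl⟩
    | add a b _ _ ha hb =>
      obtain ⟨p, hp, h1⟩ := ha
      obtain ⟨q, hq, h2⟩ := hb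
      refine ⟨p + q, add_mem hp hq, ?_⟩
      filter_upwards [h1, h2] with z h1 h2
      rw [Pi.add_apply, h1, h2]
      rfl
    | mem d a ha =>
      obtain ⟨p, hp, h1⟩ := ha.2 x
      obtain ⟨q, hq, rfl⟩ := key p hp
      exact ⟨q, hq, h1⟩
  exact main _ hs

/-- Being a smooth section is a local condition. -/
theorem mem_homSec_of_local {d : ℤ} {t : ∀ x, V.SymFiber x}
    (hd : ∀ x, t x ∈ GSym.gr (fun i => (V i).dual.Fiber x) d)
    (h : ∀ x, ∃ p : V.funAlg, ∀ᶠ z in 𝓝 x, t z = V.evAt z p) : t ∈ V.homSec d := by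
  refine ⟨hd, fun x => ?_⟩
  obtain ⟨p, hp⟩ := h x
  obtain ⟨q, hq, hpq⟩ := V.exists_poly p x
  have hle : V.polyAlg.map V.valHom ≤ V.polySec := by
    rw [polyAlg, AlgHom.map_adjoin, polySec]
    refine Algebra.adjoin_mono ?_
    rintro _ ⟨_, ⟨f, rfl⟩ | ⟨i, σ, rfl⟩, rfl⟩
    · exact Or.inl ⟨f, fun _ => rfl⟩
    · exact Or.inr ⟨i, σ, fun _ => rfl⟩
  refine ⟨V.val q, hle ⟨q, hq, rfl⟩, ?_⟩
  filter_upwards [hp, hpq] with z h1 h2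
  rw [h1, h2]
  rfl

variable {V} in
/-- The element of `Γ (S^{≥ 0} V^*)` given by a homogeneous section. -/
def mk {d : ℤ} (t : ∀ x, V.SymFiber x) (ht : t ∈ V.homSec d) : V.funAlg :=
  (⟨t, mem_supAlg _ ht⟩ : supAlg V.homSec)

variable {V} in
theorem mk_mem {d : ℤ} (t : ∀ x, V.SymFiber x) (ht : t ∈ V.homSec d) :
    mk t ht ∈ V.funAlg.gr d := ht

section Local
variable {V} {B : Type} [Ring B] [Algebra ℝ B]

/-- A linear map on `Γ (S^{≥ 0} V^*)` that depends only on germs at `x`. -/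
def IsLocalAt (x : M) (F : V.funAlg →ₗ[ℝ] B) : Prop :=
  ∀ s : V.funAlg, (∀ᶠ z in 𝓝 x, V.evAt z s = 0) → F s = 0

theorem IsLocalAt.congr {x : M} {F : V.funAlg →ₗ[ℝ] B} (hF : IsLocalAt x F) {s t : V.funAlg}
    (h : ∀ᶠ z in 𝓝 x, V.evAt z s = V.evAt z t) : F s = F t := by
  rw [← sub_eq_zero, ← map_sub]
  refine hF _ ?_
  filter_upwards [h] with z hz
  rw [map_sub, hz, sub_self]

/-- Two homomorphisms that depend on germs only and agree on generators are equal. -/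
theorem algHom_ext {x : M} {F G : V.funAlg →ₐ[ℝ] B} (hF : IsLocalAt x F.toLinearMap)
    (hG : IsLocalAt x G.toLinearMap) (h0 : ∀ f, F (V.ofFun f) = G (V.ofFun f))
    (h1 : ∀ i σ, F (V.ofSec i σ) = G (V.ofSec i σ)) : F = G := by
  ext s
  obtain ⟨p, hp, hsp⟩ := V.exists_poly s x
  have e1 : F s = F p := hF.congr hsp
  have e2 : G s = G p := hG.congr hsp
  rw [e1, e2]
  refine poly_induction (P := fun p => F p = G p) h0 h1 (fun s t hs ht => ?_) (fun s t hs ht => ?_) hp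
  · rw [map_add, map_add, hs, ht]
  · rw [map_mul, map_mul, hs, ht]

/-- A homomorphism that depends on germs only is compatible with the gradings if it is so on
generators. -/
theorem map_mem_of_gens {x : M} {F : V.funAlg →ₐ[ℝ] B} (hF : IsLocalAt x F.toLinearMap)
    (𝒢 : ℤ → Submodule ℝ B) [SetLike.GradedMonoid 𝒢] (h0 : ∀ f, F (V.ofFun f) ∈ 𝒢 0)
    (h1 : ∀ i σ, F (V.ofSec i σ) ∈ 𝒢 (-i)) {d : ℤ} {s : V.funAlg} (hs : s ∈ V.funAlg.gr d) :
    F s ∈ 𝒢 d := by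
  -- The elements of each degree whose image has the right degree form a graded family containing
  -- the generators, so its sum contains all polynomial elements.
  let 𝒜 : ℤ → Submodule ℝ V.funAlg := fun e => V.funAlg.gr e ⊓ (𝒢 e).comap F.toLinearMap
  have : SetLike.GradedMonoid 𝒜 :=
    { one_mem := ⟨SetLike.GradedOne.one_mem, by
        change F 1 ∈ 𝒢 0
        rw [map_one]; exact SetLike.GradedOne.one_mem⟩
      mul_mem := fun i j a b ha hb => ⟨SetLike.GradedMul.mul_mem ha.1 hb.1, by
        change F (a * b) ∈ 𝒢 (i + j)
        rw [map_mul]; exact SetLike.GradedMul.mul_mem ha.2 hb.2⟩ }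
  obtain ⟨p, hp, hsp⟩ := V.exists_poly s x
  have hle : V.polyAlg ≤ supAlg 𝒜 := by
    refine Algebra.adjoin_le ?_
    rintro _ (⟨f, rfl⟩ | ⟨i, σ, rfl⟩)
    · exact mem_supAlg 𝒜 (d := 0) ⟨V.ofFun_mem f, h0 f⟩
    · exact mem_supAlg 𝒜 (d := -i) ⟨V.ofSec_mem i σ, h1 i σ⟩
  have hp' : p ∈ ⨆ e, 𝒜 e := hle hp
  have key : ∀ q ∈ ⨆ e, 𝒜 e, (DirectSum.decompose V.funAlg.gr q d : V.funAlg) ∈ 𝒜 d := by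
    intro q hq
    induction hq using Submodule.iSup_induction' with
    | zero => rw [DirectSum.decompose_zero]; exact zero_mem _
    | add a b _ _ ha hb =>
      rw [DirectSum.decompose_add]
      exact add_mem ha hb
    | mem e a ha =>
      by_cases hed : e = d
      · subst hed
        rwa [DirectSum.decompose_of_mem_same _ ha.1]
      · rw [DirectSum.decompose_of_mem_ne _ ha.1 hed]
        exact zero_mem _
  have hdec : ∀ (q : V.funAlg) (z : M), V.evAt z (DirectSum.decompose V.funAlg.gr q d) =
      DirectSum.decompose (GSym.gr fun i => (V i).dual.Fiber z) (V.evAt z q) d := by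
    intro q z
    induction q using DirectSum.Decomposition.inductionOn V.funAlg.gr with
    | zero => simp
    | add a b ha hb => simp [DirectSum.decompose_add, ha, hb]
    | @homogeneous e a =>
      by_cases hed : e = d
      · subst hed
        rw [DirectSum.decompose_of_mem_same _ a.2,
          DirectSum.decompose_of_mem_same _ (V.evAt_mem_gr a.2 z)]
      · rw [DirectSum.decompose_of_mem_ne _ a.2 hed, map_zero,
          DirectSum.decompose_of_mem_ne _ (V.evAt_mem_gr a.2 z) hed]
  -- The polynomial `p` may have components of other degrees away from `x`. Near `x` it equals the
  -- homogeneous `s`, so there its component of degree `d` has the germ of `s`.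
  have e1 : F s = F (DirectSum.decompose V.funAlg.gr p d) := hF.congr (by
    filter_upwards [hsp] with z hz
    rw [hdec, ← hz, DirectSum.decompose_of_mem_same _ (V.evAt_mem_gr hs z)])
  rw [e1]
  exact (key p hp').2

end Local
end GVB

/-! ### Homomorphisms from germs of functions on a split graded manifold -/
namespace GVB
variable {M : Mfd} (V : GVB M)

/-- The graded symmetric algebra on the model fibers. -/
abbrev SymModel : Type := GSym fun i => (V i).dual.Model

/-- The trivializations at `x`, on the fiber at `z` of `S^{≥ 0} V^*`. -/
def symTriv (x z : M) : V.SymFiber z →ₐ[ℝ] V.SymModel :=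
  GSym.lift (fun i => GSym.ι i ∘ₗ (V i).dual.triv x z) fun _ _ _ _ => GSym.ι_mul_ι _ _ _ _

@[simp] theorem symTriv_ι (x z : M) (i : ℤ) (ξ : (V i).dual.Fiber z) :
    V.symTriv x z (GSym.ι (N := fun i => (V i).dual.Fiber z) i ξ) =
      GSym.ι (N := fun i => (V i).dual.Model) i ((V i).dual.triv x z ξ) := by
  rw [symTriv, GSym.lift_ι]; rfl

/-- Smooth functions as functions with values in an algebra. -/
def funTo (M : Mfd) (S : Type) [Ring S] [Algebra ℝ S] : M.Fun →ₐ[ℝ] (M → S) where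
  toFun f z := algebraMap ℝ S (f z)
  map_one' := funext fun _ => (algebraMap ℝ S).map_one
  map_mul' _ _ := funext fun _ => (algebraMap ℝ S).map_mul _ _
  map_zero' := funext fun _ => (algebraMap ℝ S).map_zero
  map_add' _ _ := funext fun _ => (algebraMap ℝ S).map_add _ _
  commutes' _ := rfl

theorem funTo_commute {S : Type} [Ring S] [Algebra ℝ S] (f : M.Fun) (a : S) :
    Commute (funTo M S f) (Pi.constAlgHom ℝ M S a) :=
  funext fun z => Algebra.commutes (f z) a

/-- Elements of `C^∞(M) ⊗ S` as functions with values in `S`. -/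
def spread (M : Mfd) (S : Type) [Ring S] [Algebra ℝ S] : M.Fun ⊗[ℝ] S →ₐ[ℝ] (M → S) :=
  Algebra.TensorProduct.lift (funTo M S) (Pi.constAlgHom ℝ M S) funTo_commute

theorem spread_tmul {S : Type} [Ring S] [Algebra ℝ S] (f : M.Fun) (a : S) (z : M) :
    spread M S (f ⊗ₜ a) z = f z • a := by
  rw [spread, Algebra.TensorProduct.lift_tmul, Algebra.smul_def]
  rfl

/-- A total multiplicative linear relation on which a homomorphism is constant along the fibers
defines a homomorphism. -/
theorem exists_algHom_of_rel {A B C : Type} [Ring A] [Algebra ℝ A] [Ring B] [Algebra ℝ B] [Ring C]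
    [Algebra ℝ C] (θ : C →ₐ[ℝ] B) (R : A → C → Prop) (hex : ∀ s, ∃ t, R s t)
    (huniq : ∀ s t t', R s t → R s t' → θ t = θ t') (h1 : R 1 1)
    (hadd : ∀ s s' t t', R s t → R s' t' → R (s + s') (t + t'))
    (hmul : ∀ s s' t t', R s t → R s' t' → R (s * s') (t * t'))
    (hsmul : ∀ (r : ℝ) s t, R s t → R (r • s) (r • t)) :
    ∃ F : A →ₐ[ℝ] B, ∀ s t, R s t → F s = θ t := by
  choose T hT using hex
  refine ⟨AlgHom.ofLinearMap
    { toFun := fun s => θ (T s)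
      map_add' := fun s s' => by
        rw [← map_add]
        exact huniq _ _ _ (hT _) (hadd _ _ _ _ (hT s) (hT s'))
      map_smul' := fun r s => by
        rw [RingHom.id_apply, ← map_smul]
        exact huniq _ _ _ (hT _) (hsmul r _ _ (hT s)) }
    ((huniq _ _ _ (hT 1) h1).trans (map_one θ))
    (fun s s' => (huniq _ _ _ (hT _) (hmul _ _ _ _ (hT s) (hT s'))).trans (map_mul θ _ _)),
    fun s t h => huniq _ _ _ (hT s) h⟩

/-- A homomorphism on `C^∞(M) ⊗ S` depends only on germs if it does so on `C^∞(M)`. -/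
theorem lift_eq_zero_of_spread {S B : Type} [Ring S] [Algebra ℝ S] [Ring B] [Algebra ℝ B] {x : M}
    (φ : M.Fun →ₐ[ℝ] B) (hφ : ∀ f : M.Fun, (∀ᶠ z in 𝓝 x, f z = 0) → φ f = 0)
    (L : S →ₐ[ℝ] B) (hL : ∀ f a, Commute (φ f) (L a)) (t : M.Fun ⊗[ℝ] S)
    (ht : ∀ᶠ z in 𝓝 x, spread M S t z = 0) : Algebra.TensorProduct.lift φ L hL t = 0 := by
  classical
  let b := Module.Free.chooseBasis ℝ S
  -- Expanding in a basis of `S` reduces the claim to functions: `∑ c k z • b k = 0` forces every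
  -- coefficient `c k` to vanish near `x`.
  let c := TensorProduct.equivFinsuppOfBasisRight (M := M.Fun) b t
  have h1 : t = c.sum fun k f => f ⊗ₜ b k := by
    rw [← TensorProduct.equivFinsuppOfBasisRight_symm_apply, LinearEquiv.symm_apply_apply]
  have h2 : ∀ k, φ (c k) = 0 := fun k => by
    refine hφ _ ?_
    filter_upwards [ht] with z hz
    rw [h1, Finsupp.sum, map_sum, Finset.sum_apply] at hz
    simp only [spread_tmul] at hz
    by_cases hk : k ∈ c.support
    · exact linearIndependent_iff'.1 b.linearIndependent c.support (fun k => c k z) hz k hk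
    · rw [Finsupp.notMem_support_iff.1 hk]
      rfl
  rw [h1, Finsupp.sum, map_sum]
  refine Finset.sum_eq_zero fun k _ => ?_
  rw [Algebra.TensorProduct.lift_tmul, h2, zero_mul]

variable {V} in
/-- A homomorphism on functions and semilinear maps on sections, which satisfy the Koszul rule and
depend on germs only, define a homomorphism on `Γ (S^{≥ 0} V^*)`. -/
theorem exists_algHom {B : Type} [Ring B] [Algebra ℝ B] (x : M) (φ : M.Fun →ₐ[ℝ] B)
    (hφ : ∀ f : M.Fun, (∀ᶠ z in 𝓝 x, f z = 0) → φ f = 0)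
    (Ψ : ∀ i, (V i).dual.Sec →ₗ[ℝ] B)
    (hΨ : ∀ i f σ, Ψ i (VB.fsmul f σ) = φ f * Ψ i σ)
    (hc : ∀ f i σ, Commute (φ f) (Ψ i σ))
    (hk : ∀ i j σ τ, Ψ i σ * Ψ j τ = (-1 : ℤˣ) ^ (i * j) • (Ψ j τ * Ψ i σ)) :
    ∃ F : V.funAlg →ₐ[ℝ] B, IsLocalAt x F.toLinearMap ∧ (∀ f, F (V.ofFun f) = φ f) ∧
      ∀ i σ, F (V.ofSec i σ) = Ψ i σ := by
  -- Semilinearity passes locality from functions to sections: a section vanishing near `x` equals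
  -- `(1 - χ) σ` for a bump function `χ`.
  have hΨ0 : ∀ i σ, (∀ᶠ z in 𝓝 x, σ z = 0) → Ψ i σ = 0 := by
    intro i σ hσ
    obtain ⟨χ, h1, h2⟩ := Mfd.exists_bump hσ
    have h3 : σ = VB.fsmul (1 - χ) σ := by
      ext1 z
      rw [VB.fsmul_apply]
      change σ z = (1 - χ z) • σ z
      by_cases hz : z ∈ tsupport χ
      · have : σ z = 0 := h2 hz
        rw [this, smul_zero]
      · rw [image_eq_zero_of_notMem_tsupport hz, sub_zero, one_smul]
    rw [h3, hΨ, hφ, zero_mul]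
    filter_upwards [h1] with z hz
    change 1 - χ z = 0
    rw [hz, sub_self]
  -- Each degree has a frame on its own neighborhood, and no neighborhood need serve all degrees at
  -- once. Only finitely many degrees enter any one polynomial, so germs suffice.
  choose e he hc' using fun i => VB.exists_frame (V i).dual x
  let b := fun i => Module.finBasis ℝ (V i).dual.Model
  let ℓ : ∀ i, (V i).dual.Model →ₗ[ℝ] B := fun i => (b i).constr ℝ fun k => Ψ i (e i k)
  have hℓ : ∀ i n, ℓ i n = ∑ k, (b i).equivFun n k • Ψ i (e i k) := fun i n =>
    (b i).constr_apply_fintype ℝ _ n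
  let L : V.SymModel →ₐ[ℝ] B := GSym.lift ℓ (by
    intro i j m n
    rw [hℓ, hℓ, Finset.sum_mul_sum, Finset.sum_mul_sum, Finset.sum_comm, Finset.smul_sum]
    refine Finset.sum_congr rfl fun l _ => ?_
    rw [Finset.smul_sum]
    refine Finset.sum_congr rfl fun k _ => ?_
    rw [smul_mul_smul_comm, smul_mul_smul_comm, hk, smul_comm, mul_comm ((b i).equivFun m k)])
  have hL : ∀ f a, Commute (φ f) (L a) := by
    intro f a
    induction a using GSym.induction with
    | halg r => rw [AlgHom.commutes]; exact (Algebra.commutes r (φ f)).symm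
    | hι i n =>
      rw [GSym.lift_ι, hℓ]
      exact Commute.sum_right _ _ _ fun k _ => (hc f i _).smul_right _
    | hadd a b ha hb => rw [map_add]; exact ha.add_right hb
    | hmul a b ha hb => rw [map_mul]; exact ha.mul_right hb
  let θ := Algebra.TensorProduct.lift φ L hL
  have hθ : ∀ t t', (∀ᶠ z in 𝓝 x, spread M V.SymModel t z = spread M V.SymModel t' z) →
      θ t = θ t' := by
    intro t t' h
    rw [← sub_eq_zero, ← map_sub]
    refine lift_eq_zero_of_spread φ hφ L hL _ ?_
    filter_upwards [h] with z hz
    rw [map_sub, Pi.sub_apply, hz, sub_self]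
  have hfun : ∀ f : M.Fun, ∀ z, spread M V.SymModel (f ⊗ₜ 1) z = V.symTriv x z (V.evAt z (V.ofFun f)) :=
    fun f z => by
      rw [spread_tmul, evAt_ofFun, AlgHom.commutes, Algebra.algebraMap_eq_smul_one]
  have hsec : ∀ i σ, ∃ t, (∀ᶠ z in 𝓝 x, spread M V.SymModel t z =
      V.symTriv x z (V.evAt z (V.ofSec i σ))) ∧ θ t = Ψ i σ := by
    intro i σ
    obtain ⟨c, hc⟩ := hc' i σ
    refine ⟨∑ k, c k ⊗ₜ GSym.ι (N := fun i => (V i).dual.Model) i (b i k), ?_, ?_⟩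
    · filter_upwards [he i, hc] with z h1 h2
      rw [map_sum, Finset.sum_apply, evAt_ofSec, symTriv_ι, h2, map_sum, map_sum]
      refine Finset.sum_congr rfl fun k _ => ?_
      rw [spread_tmul, map_smul, map_smul, h1 k]
    · have h3 : Ψ i σ = Ψ i (∑ k, VB.fsmul (c k) (e i k)) := by
        rw [← sub_eq_zero, ← map_sub]
        refine hΨ0 i _ ?_
        filter_upwards [hc] with z hz
        rw [ContMDiffSection.coe_sub, Pi.sub_apply, hz, sub_eq_zero]
        have h4 : ∀ s : Finset (Fin (Module.finrank ℝ (V i).dual.Model)),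
            (∑ k ∈ s, VB.fsmul (c k) (e i k)) z = ∑ k ∈ s, c k z • e i k z := by
          intro s
          induction s using Finset.cons_induction with
          | empty => rfl
          | cons k s hk ih =>
            rw [Finset.sum_cons, Finset.sum_cons, ContMDiffSection.coe_add, Pi.add_apply, ih,
              VB.fsmul_apply]
        rw [h4]
      rw [h3, map_sum, map_sum]
      refine Finset.sum_congr rfl fun k _ => ?_
      rw [hΨ, Algebra.TensorProduct.lift_tmul, GSym.lift_ι, Module.Basis.constr_basis]
  have hex : ∀ s : V.funAlg, ∃ t, ∀ᶠ z in 𝓝 x, spread M V.SymModel t z = V.symTriv x z (V.evAt z s) := by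
    intro s
    obtain ⟨p, hp, hsp⟩ := V.exists_poly s x
    have main : ∃ t, ∀ᶠ z in 𝓝 x, spread M V.SymModel t z = V.symTriv x z (V.evAt z p) := by
      refine poly_induction (P := fun p => ∃ t, ∀ᶠ z in 𝓝 x, spread M V.SymModel t z =
        V.symTriv x z (V.evAt z p)) (fun f => ⟨_, Filter.Eventually.of_forall (hfun f)⟩)
        (fun i σ => (hsec i σ).imp fun t ht => ht.1) ?_ ?_ hp
      · rintro a b ⟨t, ht⟩ ⟨t', ht'⟩
        refine ⟨t + t', ?_⟩
        filter_upwards [ht, ht'] with z h1 h2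
        rw [map_add, map_add, map_add, Pi.add_apply, h1, h2]
      · rintro a b ⟨t, ht⟩ ⟨t', ht'⟩
        refine ⟨t * t', ?_⟩
        filter_upwards [ht, ht'] with z h1 h2
        rw [map_mul, map_mul, map_mul, Pi.mul_apply, h1, h2]
    obtain ⟨t, ht⟩ := main
    refine ⟨t, ?_⟩
    filter_upwards [ht, hsp] with z h1 h2
    rw [h1, h2]
  -- The relation says that `t` represents the germ of `s` in the trivializations. It is total by
  -- `hex`, and `θ` does not depend on the representative by `hθ`, so `F s = θ t` is well defined
  -- and multiplicative.
  obtain ⟨F, hF⟩ := exists_algHom_of_rel θ (fun s t => ∀ᶠ z in 𝓝 x, spread M V.SymModel t z =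
      V.symTriv x z (V.evAt z s)) hex
    (fun s t t' h h' => hθ t t' (by filter_upwards [h, h'] with z h1 h2; rw [h1, h2]))
    (Filter.Eventually.of_forall fun z => by rw [map_one, map_one, map_one, Pi.one_apply])
    (fun s s' t t' h h' => by
      filter_upwards [h, h'] with z h1 h2
      rw [map_add, map_add, map_add, Pi.add_apply, h1, h2])
    (fun s s' t t' h h' => by
      filter_upwards [h, h'] with z h1 h2
      rw [map_mul, map_mul, map_mul, Pi.mul_apply, h1, h2])
    (fun r s t h => by
      filter_upwards [h] with z h1
      rw [map_smul, map_smul, map_smul, Pi.smul_apply, h1])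
  refine ⟨F, fun s hs => ?_, fun f => ?_, fun i σ => ?_⟩
  · refine (hF s 0 ?_).trans (map_zero θ)
    filter_upwards [hs] with z hz
    rw [hz, map_zero, map_zero, Pi.zero_apply]
  · refine (hF _ _ (Filter.Eventually.of_forall (hfun f))).trans ?_
    rw [Algebra.TensorProduct.lift_tmul, map_one, mul_one]
  · obtain ⟨t, ht, ht'⟩ := hsec i σ
    exact (hF _ _ ht).trans ht'

end GVB

/-! ### The underlying map of a morphism -/
namespace Mfd
variable {M : Mfd}

instance (M : Mfd) : SigmaCompactSpace M := inferInstance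

/-- A smooth function with compact level sets. -/
theorem exists_exhaustion (M : Mfd) : ∃ ρ : M.Fun, ∀ r : ℝ, ∃ K : Set M, IsCompact K ∧
    ∀ z, ρ z = r → z ∈ K := by
  let K := CompactExhaustion.choice M
  obtain ⟨ρ, hρ⟩ := exists_contMDiffMap_forall_mem_convex_of_local_const (𝓡 M.dim) (n := ⊤)
    (t := fun x : M => Set.Ici ((K.find x : ℕ) : ℝ)) (fun x => convex_Ici _) (fun x => by
      -- Points near `x` lie in the compact set with index `K.find x + 1`, so this constant is an
      -- admissible local value. The resulting `ρ` satisfies `K.find z ≤ ρ z`.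
      refine ⟨((K.find x + 1 : ℕ) : ℝ), ?_⟩
      have h : K (K.find x + 1) ∈ 𝓝 x :=
        mem_interior_iff_mem_nhds.1 (K.subset_interior_succ _ (K.mem_find x))
      filter_upwards [h] with y hy
      exact (Nat.cast_le (α := ℝ)).2 (K.mem_iff_find_le.1 hy))
  refine ⟨ρ, fun r => ⟨K ⌈r⌉₊, K.isCompact _, fun z hz => K.mem_iff_find_le.2 ?_⟩⟩
  have h1 : ((K.find z : ℕ) : ℝ) ≤ r := hz ▸ hρ z
  exact_mod_cast h1.trans (Nat.le_ceil r)

/-- Every character of the algebra of smooth functions is the evaluation at a point. -/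
theorem exists_eval (χ : M.Fun →ₐ[ℝ] ℝ) : ∃ x : M, ∀ f, χ f = f x := by
  by_contra! h
  choose f hf using h
  let g : M → M.Fun := fun x => f x - algebraMap ℝ _ (χ (f x))
  have hg : ∀ x, χ (g x) = 0 := fun x => by simp [g]
  have hgx : ∀ x, g x x ≠ 0 := fun x => sub_ne_zero.2 (hf x).symm
  obtain ⟨ρ, hρ⟩ := M.exists_exhaustion
  obtain ⟨K, hK, hK'⟩ := hρ (χ ρ)
  obtain ⟨t, -, ht⟩ := hK.elim_nhds_subcover (fun x => {z | g x z ≠ 0}) fun x _ =>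
    (isOpen_ne.preimage (g x).contMDiff.continuous).mem_nhds (hgx x)
  -- Outside the level set of `ρ` the first square is positive; on it, which lies in the compact
  -- `K`, one of the finitely many `g x` is nonzero. Thus `G` is invertible although `χ G = 0`.
  let G : M.Fun := (ρ - algebraMap ℝ _ (χ ρ)) ^ 2 + ∑ x ∈ t, g x ^ 2
  have hG : ∀ z, G z = (ρ z - χ ρ) ^ 2 + ∑ x ∈ t, g x z ^ 2 := fun z => by
    have h := map_sum (ContMDiffMap.evalRingHom (I := 𝓡 M.dim) (I' := 𝓘(ℝ, ℝ)) (n := ∞) (R := ℝ) z)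
      (fun x => g x ^ 2) t
    exact congrArg₂ (· + ·) (by rfl) h
  have hpos : ∀ z, G z ≠ 0 := fun z => by
    rw [hG]
    have h1 : 0 ≤ ∑ x ∈ t, g x z ^ 2 := Finset.sum_nonneg fun x _ => sq_nonneg _
    by_cases hz : ρ z = χ ρ
    · obtain ⟨x, hx, hxz⟩ := Set.mem_iUnion₂.1 (ht (hK' z hz))
      have h2 : g x z ^ 2 ≤ ∑ x ∈ t, g x z ^ 2 :=
        Finset.single_le_sum (f := fun x => g x z ^ 2) (fun x _ => sq_nonneg _) hx
      have h3 : 0 < g x z ^ 2 := sq_pos_of_ne_zero hxz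
      have h4 := sq_nonneg (ρ z - χ ρ)
      exact (add_pos_of_nonneg_of_pos h4 (h3.trans_le h2)).ne'
    · have h3 : 0 < (ρ z - χ ρ) ^ 2 := by
        have := sub_ne_zero.2 hz
        positivity
      exact (add_pos_of_pos_of_nonneg h3 h1).ne'
  let H : M.Fun := ⟨fun z => (G z)⁻¹, G.contMDiff.inv₀ hpos⟩
  have hGH : G * H = 1 := by
    ext z
    exact mul_inv_cancel₀ (hpos z)
  have hχG : χ G = 0 := by
    simp only [G, map_add, map_pow, map_sub, map_sum, hg, AlgHom.commutes]
    simp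
  have := congrArg χ hGH
  rw [map_mul, hχG, zero_mul, map_one] at this
  exact zero_ne_one this

end Mfd

namespace GVB
variable {M N : Mfd} {V : GVB M} {W : GVB N}

/-- This gives continuity of the underlying map: composed with a smooth function, that map is the
augmentation of an element of the target algebra. -/
theorem continuous_aug (s : W.funAlg) : Continuous fun y => GSym.aug (W.evAt y s) := by
  rw [continuous_iff_continuousAt]
  intro y
  obtain ⟨p, hp, hsp⟩ := W.exists_poly s y
  have hc : Continuous fun y => GSym.aug (W.evAt y p) := by
    refine poly_induction (P := fun p => Continuous fun y => GSym.aug (W.evAt y p)) ?_ ?_ ?_ ?_ hp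
    · intro f
      simpa using f.contMDiff.continuous
    · intro i σ
      simpa using continuous_const
    · intro a b ha hb
      simp only [map_add]
      exact ha.add hb
    · intro a b ha hb
      simp only [map_mul]
      exact ha.mul hb
  refine hc.continuousAt.congr ?_
  filter_upwards [hsp] with z hz
  rw [hz]

/-- A homomorphism of function algebras has an underlying continuous map. -/
theorem exists_body (φ : V.funAlg →ₐ[ℝ] W.funAlg) : ∃ g : N → M, Continuous g ∧
    ∀ y f, GSym.aug (W.evAt y (φ (V.ofFun f))) = f (g y) := by
  choose g hg using fun y => Mfd.exists_eval
    (((GSym.aug.comp (W.evAt y)).comp φ).comp V.ofFunHom)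
  refine ⟨g, ?_, hg⟩
  rw [continuous_iff_continuousAt]
  intro y U hU
  obtain ⟨χ, h1, h2⟩ := Mfd.exists_bump hU
  -- Bump functions detect neighborhoods: `χ ∘ g` is continuous and nonzero at `y`, so near `y` the
  -- values of `g` stay in the support of `χ`, inside `U`.
  have hc : Continuous fun y => χ (g y) := by
    have := continuous_aug (φ (V.ofFun χ))
    exact this.congr fun y => hg y χ
  have hne : χ (g y) ≠ 0 := by rw [h1.self_of_nhds]; exact one_ne_zero
  have := hc.continuousAt.eventually_ne hne
  refine Filter.mem_map.2 (Filter.mem_of_superset this fun y' hy' => ?_)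
  exact h2 (subset_tsupport _ hy')

/-! ### Locality of homomorphisms and derivations, and gluing of fiberwise maps -/

theorem exists_bump_mul_eq_zero {x : M} {s : V.funAlg} (hs : ∀ᶠ z in 𝓝 x, V.evAt z s = 0) :
    ∃ χ : M.Fun, χ x = 1 ∧ V.ofFun χ * s = 0 := by
  obtain ⟨χ, h1, h2⟩ := Mfd.exists_bump hs
  refine ⟨χ, h1.self_of_nhds, funAlg_ext fun z => ?_⟩
  rw [map_mul, map_zero, evAt_ofFun]
  by_cases hz : z ∈ tsupport χ
  · have : V.evAt z s = 0 := h2 hz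
    rw [this, mul_zero]
  · rw [image_eq_zero_of_notMem_tsupport hz, map_zero, zero_mul]

/-- If `s` vanishes near `x`, then `χ s = 0` for a function with `χ x = 1`. At `y` the image of `χ`
has augmentation `1`, so it can be cancelled from the image of `χ s`. -/
theorem isLocalAt_of_aug {φ : V.funAlg →ₐ[ℝ] W.funAlg} {x : M} {y : N}
    (h : ∀ f, GSym.aug (W.evAt y (φ (V.ofFun f))) = f x) :
    IsLocalAt x ((W.evAt y).comp φ).toLinearMap := by
  intro s hs
  obtain ⟨χ, h1, h2⟩ := exists_bump_mul_eq_zero hs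
  refine GSym.eq_zero_of_mul_eq_zero ((h χ).trans h1) ?_
  have h3 := map_mul ((W.evAt y).comp φ) (V.ofFun χ) s
  rw [h2, map_zero] at h3
  exact h3.symm

/-- Applying `δ` to `χ s = 0` leaves `φ χ * δ s = 0` at `y`, since `φ s` already vanishes there by
locality of `φ`. Then `φ χ` is cancelled as before. -/
theorem isLocalAt_derivation {φ : V.funAlg →ₐ[ℝ] W.funAlg} {x : M} {y : N}
    (h : ∀ f, GSym.aug (W.evAt y (φ (V.ofFun f))) = f x) (δ : V.funAlg →ₗ[ℝ] W.funAlg)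
    (hδ : ∀ f s, δ (V.ofFun f * s) = δ (V.ofFun f) * φ s + φ (V.ofFun f) * δ s) :
    IsLocalAt x ((W.evAt y).toLinearMap ∘ₗ δ) := by
  intro s hs
  have h0 : W.evAt y (φ s) = 0 := isLocalAt_of_aug h s hs
  obtain ⟨χ, h1, h2⟩ := exists_bump_mul_eq_zero hs
  refine GSym.eq_zero_of_mul_eq_zero ((h χ).trans h1) ?_
  have h3 := hδ χ s
  rw [h2, map_zero] at h3
  have h4 := congrArg (W.evAt y) h3
  rw [map_zero, map_add, map_mul, map_mul, h0, mul_zero, zero_add] at h4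
  exact h4.symm

/-- Local linear maps to the fibers that are smooth on polynomial elements define a linear map. -/
theorem exists_linearMap {g : N → M} (hg : Continuous g)
    (F : ∀ y, V.funAlg →ₗ[ℝ] W.SymFiber y) (hF : ∀ y, IsLocalAt (g y) (F y)) (k : ℤ)
    (hgr : ∀ y d s, s ∈ V.funAlg.gr d → F y s ∈ GSym.gr (fun i => (W i).dual.Fiber y) (d + k))
    (hp : ∀ p ∈ V.polyAlg, ∀ y, ∃ a : W.funAlg, ∀ᶠ z in 𝓝 y, F z p = W.evAt z a) :
    ∃ δ : V.funAlg →ₗ[ℝ] W.funAlg, (∀ y s, W.evAt y (δ s) = F y s) ∧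
      ∀ d s, s ∈ V.funAlg.gr d → δ s ∈ W.funAlg.gr (d + k) := by
  have hhom : ∀ d s, s ∈ V.funAlg.gr d → (fun y => F y s) ∈ W.homSec (d + k) := fun d s hs =>
    W.mem_homSec_of_local (fun y => hgr y d s hs) fun y => by
      obtain ⟨p, hp1, hp2⟩ := V.exists_poly s (g y)
      obtain ⟨a, ha⟩ := hp p hp1 y
      refine ⟨a, ?_⟩
      -- By continuity of `g`, the germs of `s` and `p` agree at `g z` for all `z` near `y`, so one
      -- element `a` describes `F z s` on a whole neighborhood.
      filter_upwards [hg.continuousAt.eventually (eventually_eventually_nhds.2 hp2), ha] with z hz ha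
      rw [← ha]
      exact (hF z).congr hz
  have hex : ∀ s, ∃ a : W.funAlg, ∀ y, W.evAt y a = F y s := by
    intro s
    induction s using DirectSum.Decomposition.inductionOn V.funAlg.gr with
    | zero => exact ⟨0, fun y => by rw [map_zero, map_zero]⟩
    | add a b ha hb =>
      obtain ⟨a', ha⟩ := ha
      obtain ⟨b', hb⟩ := hb
      exact ⟨a' + b', fun y => by rw [map_add, map_add, ha, hb]⟩
    | @homogeneous d s => exact ⟨mk _ (hhom d s s.2), fun y => rfl⟩
  choose δ hδ using hex
  refine ⟨{ toFun := δ
            map_add' := fun a b => funAlg_ext fun y => by rw [map_add, hδ, hδ, hδ, map_add]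
            map_smul' := fun r a => funAlg_ext fun y => by
              rw [RingHom.id_apply, map_smul, hδ, hδ, map_smul] }, fun y s => hδ s y, ?_⟩
  intro d s hs
  have : δ s = mk _ (hhom d s hs) := funAlg_ext fun y => hδ s y
  change δ s ∈ _
  rw [this]
  exact mk_mem _ _

/-- Local homomorphisms to the fibers that are smooth on generators define a homomorphism. -/
theorem exists_algHom_of_fiberwise {g : N → M} (hg : Continuous g)
    (F : ∀ y, V.funAlg →ₐ[ℝ] W.SymFiber y) (hF : ∀ y, IsLocalAt (g y) (F y).toLinearMap)
    (h0 : ∀ f y, ∃ a ∈ W.funAlg.gr 0, ∀ᶠ z in 𝓝 y, F z (V.ofFun f) = W.evAt z a)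
    (h1 : ∀ i σ y, ∃ a ∈ W.funAlg.gr (-i), ∀ᶠ z in 𝓝 y, F z (V.ofSec i σ) = W.evAt z a) :
    ∃ ψ : V.funAlg →ₐ[ℝ] W.funAlg, (∀ y s, W.evAt y (ψ s) = F y s) ∧
      ∀ d s, s ∈ V.funAlg.gr d → ψ s ∈ W.funAlg.gr d := by
  obtain ⟨ψ, hψ, hψ'⟩ := exists_linearMap (W := W) hg (fun y => (F y).toLinearMap) hF 0
    (fun y d s hs => by
      rw [add_zero]
      refine map_mem_of_gens (hF y) (GSym.gr fun i => (W i).dual.Fiber y) (fun f => ?_)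
        (fun i σ => ?_) hs
      · obtain ⟨a, ha, ha'⟩ := h0 f y
        exact ha'.self_of_nhds ▸ W.evAt_mem_gr ha y
      · obtain ⟨a, ha, ha'⟩ := h1 i σ y
        exact ha'.self_of_nhds ▸ W.evAt_mem_gr ha y)
    (fun p hp y => poly_induction
      (P := fun p => ∃ a : W.funAlg, ∀ᶠ z in 𝓝 y, F z p = W.evAt z a)
      (fun f => (h0 f y).imp fun a ha => ha.2) (fun i σ => (h1 i σ y).imp fun a ha => ha.2)
      (by
        rintro s t ⟨a, ha⟩ ⟨b, hb⟩
        refine ⟨a + b, ?_⟩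
        filter_upwards [ha, hb] with z ha hb
        rw [map_add, map_add, ha, hb])
      (by
        rintro s t ⟨a, ha⟩ ⟨b, hb⟩
        refine ⟨a * b, ?_⟩
        filter_upwards [ha, hb] with z ha hb
        rw [map_mul, map_mul, ha, hb]) hp)
  refine ⟨AlgHom.ofLinearMap ψ (funAlg_ext fun y => ?_) (fun s t => funAlg_ext fun y => ?_), hψ,
    fun d s hs => ?_⟩
  · exact (hψ y 1).trans ((map_one (F y)).trans (map_one (W.evAt y)).symm)
  · refine (hψ y _).trans ((map_mul (F y) s t).trans ?_)
    rw [map_mul]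
    exact congrArg₂ _ (hψ y s).symm (hψ y t).symm
  · have := hψ' d s hs
    rwa [add_zero] at this

end GVB

/-! ### Tensor products with the functions on the fat point -/

namespace GSym
variable {N : ℤ → Type} [∀ i, AddCommGroup (N i)] [∀ i, Module ℝ (N i)]

theorem aug_eq_zero_of_mem {d : ℤ} (hd : d ≠ 0) {z : GSym N} (hz : z ∈ GSym.gr N d) :
    aug z = 0 := by
  induction hz using Submodule.span_induction with
  | zero => exact map_zero _
  | add x y _ _ hx hy => rw [map_add, hx, hy, add_zero]
  | smul c x _ hx => rw [map_smul, hx, smul_zero]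
  | mem z hz =>
    obtain ⟨l, rfl, rfl⟩ := hz
    cases l with
    | nil => exact absurd rfl hd
    | cons p l => simp

/-- The homomorphism to the dual numbers given by a linear form in each degree. -/
def toDual (f : ∀ i, N i →ₗ[ℝ] ℝ) : GSym N →ₐ[ℝ] TrivSqZeroExt ℝ ℝ :=
  GSym.lift (fun i => TrivSqZeroExt.inrHom ℝ ℝ ∘ₗ f i) (by
    intro i j a b
    simp)

end GSym

/-- The homomorphism underlying a morphism of graded algebras. -/
def GrAlg.toAlgHom {A B : GrAlg} (u : A ⟶ B) : A →ₐ[ℝ] B :=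
  (ConcreteCategory.hom u : A.gr →ₐᵍ[ℝ] B.gr).toAlgHom

namespace GrAlg
variable {A B C : GrAlg}

theorem toAlgHom_mem (u : A ⟶ B) {d : ℤ} {a : A} (ha : a ∈ A.gr d) : toAlgHom u a ∈ B.gr d :=
  (ConcreteCategory.hom u : A.gr →ₐᵍ[ℝ] B.gr).map_mem ha

theorem hom_ext_apply {u v : A ⟶ B} (h : ∀ a, toAlgHom u a = toAlgHom v a) : u = v :=
  ConcreteCategory.hom_ext (C := GrAlg) u v h

/-- A degree preserving homomorphism, as a morphism. -/
def ofAlgHom (f : A →ₐ[ℝ] B) (hf : ∀ d a, a ∈ A.gr d → f a ∈ B.gr d) : A ⟶ B :=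
  ConcreteCategory.ofHom (C := GrAlg) (X := A) (Y := B)
    { f with map_mem := fun {d} {a} ha => hf d a ha }

theorem mem_of_mem_of_mem {d e : ℤ} (hde : d ≠ e) {a : A} (h : a ∈ A.gr d) (h' : a ∈ A.gr e) :
    a = 0 := by
  have h1 := DirectSum.decompose_of_mem_same _ h
  rw [DirectSum.decompose_of_mem_ne _ h' hde.symm] at h1
  exact h1.symm

end GrAlg

namespace VB

theorem castL_symm_castL {M : Mfd} {E F : VB M} (h : E = F) (x : M) (v : F.Fiber x) :
    castL h x (castL h.symm x v) = v := by
  subst h; rfl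

theorem exists_eq_smul_castL {E : VB point} (h : E = VB.trivial point ℝ) (x : point)
    (ξ : E.dual.Fiber x) : ∃ c : ℝ, ξ = c • (castL h x : E.dual.Fiber x) := by
  subst h
  refine ⟨ξ (1 : ℝ), ContinuousLinearMap.ext fun v => ?_⟩
  have h1 : (v : ℝ) • (1 : ℝ) = v := mul_one _
  have h2 := ξ.map_smul (v : ℝ) (1 : ℝ)
  rw [h1] at h2
  rw [h2]
  exact mul_comm (v : ℝ) (ξ (1 : ℝ) : ℝ)

theorem dual_eq_zero_of_eq {M : Mfd} {E : VB M} (h : E = VB.trivial M PUnit) (x : M)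
    (ξ : E.dual.Fiber x) : ξ = 0 := by
  subst h
  refine ContinuousLinearMap.ext fun v => ?_
  have : v = 0 := Subsingleton.elim (α := PUnit) _ _
  rw [this, map_zero, map_zero]

end VB

namespace Fat

/-- The base point. -/
def pt : point := PUnit.unit

/-- The covector `ε`. -/
def coord : (fatBundle 1).dual.Fiber pt := fatCoord pt

theorem evAt_ε : fatBundle.evAt pt ε =
    GSym.ι (N := fun i => (fatBundle i).dual.Fiber pt) 1 coord := rfl

theorem ι_mul_self (ξ : (fatBundle 1).dual.Fiber pt) :
    GSym.ι (N := fun i => (fatBundle i).dual.Fiber pt) 1 ξ *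
      GSym.ι (N := fun i => (fatBundle i).dual.Fiber pt) 1 ξ = 0 := by
  have h := GSym.ι_mul_ι (N := fun i => (fatBundle i).dual.Fiber pt) 1 1 ξ ξ
  rw [mul_one, uzpow_one, Units.neg_smul, one_smul] at h
  have h2 := eq_neg_iff_add_eq_zero.1 h
  rw [← two_smul ℝ] at h2
  exact (smul_eq_zero_iff_right two_ne_zero).1 h2

theorem ε_mul_ε : ε * ε = 0 := GVB.funAlg_ext (V := fatBundle) fun _ =>
  (map_mul (fatBundle.evAt pt) ε ε).trans ((ι_mul_self coord).trans (map_zero _).symm)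

theorem ε_mem : ε ∈ fatPoint.alg.gr (-1) := fatBundle.ofSec_mem 1 fatCoord

/-- The coefficient of `1`. -/
def c0 : fatPoint.alg →ₗ[ℝ] ℝ :=
  (GSym.aug (N := fun i => (fatBundle i).dual.Fiber pt)).toLinearMap ∘ₗ
    (fatBundle.evAt pt).toLinearMap

/-- The linear form dual to `ε`. -/
def form : ∀ i, (fatBundle i).dual.Fiber pt →ₗ[ℝ] ℝ :=
  Pi.single (M := fun i => (fatBundle i).dual.Fiber pt →ₗ[ℝ] ℝ) 1
    { toFun := fun ξ => ξ (VB.castL (GVB.inDegree_self 1 (VB.trivial point ℝ)).symm pt (1 : ℝ))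
      map_add' := fun _ _ => rfl
      map_smul' := fun _ _ => rfl }

/-- The coefficient of `ε`. -/
def c1 : fatPoint.alg →ₗ[ℝ] ℝ :=
  TrivSqZeroExt.sndHom ℝ ℝ ∘ₗ (GSym.toDual form).toLinearMap ∘ₗ (fatBundle.evAt pt).toLinearMap

theorem c0_one : c0 1 = 1 := by
  change GSym.aug (fatBundle.evAt pt 1) = 1
  rw [map_one, map_one]

theorem c0_ε : c0 ε = 0 := GSym.aug_ι (N := fun i => (fatBundle i).dual.Fiber pt) 1 coord

theorem c1_one : c1 1 = 0 := by
  have h : (GSym.toDual form) (fatBundle.evAt pt 1) = 1 := by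
    rw [map_one (fatBundle.evAt pt), map_one]
  exact (congrArg TrivSqZeroExt.snd h).trans TrivSqZeroExt.snd_one

theorem c1_ε : c1 ε = 1 := by
  change TrivSqZeroExt.snd (GSym.toDual form (fatBundle.evAt pt ε)) = 1
  rw [evAt_ε, GSym.toDual, GSym.lift_ι, form, Pi.single_eq_same]
  exact VB.castL_symm_castL (GVB.inDegree_self 1 (VB.trivial point ℝ)) pt (1 : ℝ)

/-- The bundle is zero outside degree `1`, covectors in degree `1` are multiples of `coord`, and
`coord` squares to zero because an odd generator anticommutes with itself. So the span of `1` and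
`ε` is closed under products; the forms `c0` and `c1` show that the two are independent. -/
theorem exists_gsym (w : fatBundle.SymFiber pt) : ∃ a b : ℝ,
    w = a • 1 + b • GSym.ι (N := fun i => (fatBundle i).dual.Fiber pt) 1 coord := by
  induction w using GSym.induction with
  | halg r => exact ⟨r, 0, by rw [zero_smul, add_zero, Algebra.algebraMap_eq_smul_one]⟩
  | hι i ξ =>
    by_cases hi : i = 1
    · subst hi
      obtain ⟨c, hc⟩ := VB.exists_eq_smul_castL (GVB.inDegree_self 1 (VB.trivial point ℝ)) pt ξ
      have hc' : ξ = c • coord := hc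
      refine ⟨0, c, ?_⟩
      rw [hc', map_smul, zero_smul, zero_add]
    · refine ⟨0, 0, ?_⟩
      have hξ : ξ = 0 := VB.dual_eq_zero_of_eq (E := fatBundle i) (if_neg hi) pt ξ
      rw [hξ, map_zero, zero_smul, zero_smul, add_zero]
  | hadd x y hx hy =>
    obtain ⟨a, b, rfl⟩ := hx
    obtain ⟨a', b', rfl⟩ := hy
    exact ⟨a + a', b + b', by module⟩
  | hmul x y hx hy =>
    obtain ⟨a, b, rfl⟩ := hx
    obtain ⟨a', b', rfl⟩ := hy
    refine ⟨a * a', a * b' + b * a', ?_⟩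
    rw [add_mul, mul_add, mul_add, smul_mul_smul_comm, smul_mul_smul_comm, smul_mul_smul_comm,
      smul_mul_smul_comm, ι_mul_self, smul_zero, one_mul, one_mul, mul_one, add_zero, add_assoc,
      ← add_smul]

theorem eq_smul_add_smul (z : fatPoint.alg) : z = c0 z • (1 : fatPoint.alg) + c1 z • ε := by
  obtain ⟨a, b, h⟩ := exists_gsym (fatBundle.evAt pt z)
  have hz : z = a • (1 : fatPoint.alg) + b • ε := GVB.funAlg_ext (V := fatBundle) fun _ =>
    h.trans (by
      have h1 := map_add (fatBundle.evAt pt) (a • (1 : fatBundle.funAlg)) (b • ε)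
      rw [map_smul, map_one] at h1
      exact (h1.trans (congrArg _ (map_smul (fatBundle.evAt pt) b ε))).symm)
  have h0 : c0 z = a := by rw [hz, map_add, map_smul, map_smul, c0_one, c0_ε]; simp
  have h1 : c1 z = b := by rw [hz, map_add, map_smul, map_smul, c1_one, c1_ε]; simp
  rw [h0, h1]
  exact hz

theorem c0_eq_zero {i : ℤ} (hi : i ≠ 0) {z : fatPoint.alg} (hz : z ∈ fatPoint.alg.gr i) :
    c0 z = 0 :=
  GSym.aug_eq_zero_of_mem hi (fatBundle.evAt_mem_gr hz pt)

theorem c1_eq_zero {i : ℤ} (hi : i ≠ -1) {z : fatPoint.alg} (hz : z ∈ fatPoint.alg.gr i) :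
    c1 z = 0 := by
  have h1 : c0 z • (1 : fatPoint.alg) ∈ fatPoint.alg.gr i := by
    by_cases h : i = 0
    · subst h
      exact Submodule.smul_mem _ _ SetLike.GradedOne.one_mem
    · rw [c0_eq_zero h hz, zero_smul]
      exact zero_mem _
  have h2 : c1 z • ε ∈ fatPoint.alg.gr i := by
    rw [← sub_eq_iff_eq_add'.2 (eq_smul_add_smul z)]
    exact sub_mem hz h1
  have h3 := GrAlg.mem_of_mem_of_mem hi h2 (Submodule.smul_mem _ _ ε_mem)
  have h4 := congrArg c1 h3
  rwa [map_smul, c1_ε, map_zero, smul_eq_mul, mul_one] at h4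

variable {A B C : GrAlg}

/-- The coefficient of a tensor with respect to a linear form on the functions on the fat point. -/
def comp (B : GrAlg) (c : fatPoint.alg →ₗ[ℝ] ℝ) : GrAlg.Tensor fatPoint.alg B →ₗ[ℝ] B :=
  (TensorProduct.lid ℝ B).toLinearMap ∘ₗ TensorProduct.map c LinearMap.id ∘ₗ
    (GrAlg.tensorEquiv fatPoint.alg B).symm.toLinearMap

theorem comp_tmul (c : fatPoint.alg →ₗ[ℝ] ℝ) (a : fatPoint.alg) (b : B) :
    comp B c (GrAlg.tmul a b) = c a • b := rfl

/-- The element `b₀ + ε b₁`. -/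
def pack (b0 b1 : B) : GrAlg.Tensor fatPoint.alg B := GrAlg.tmul 1 b0 + GrAlg.tmul ε b1

@[simp] theorem comp_c0_pack (b0 b1 : B) : comp B c0 (pack b0 b1) = b0 := by
  rw [pack, map_add, comp_tmul, comp_tmul, c0_one, c0_ε, one_smul, zero_smul, add_zero]

@[simp] theorem comp_c1_pack (b0 b1 : B) : comp B c1 (pack b0 b1) = b1 := by
  rw [pack, map_add, comp_tmul, comp_tmul, c1_one, c1_ε, one_smul, zero_smul, zero_add]

theorem pack_add (b0 b1 b0' b1' : B) :
    pack b0 b1 + pack b0' b1' = pack (b0 + b0') (b1 + b1') := by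
  change GrAlg.tensorEquiv fatPoint.alg B (1 ⊗ₜ b0) + GrAlg.tensorEquiv fatPoint.alg B (ε ⊗ₜ b1) +
    (GrAlg.tensorEquiv fatPoint.alg B (1 ⊗ₜ b0') + GrAlg.tensorEquiv fatPoint.alg B (ε ⊗ₜ b1')) =
    GrAlg.tensorEquiv fatPoint.alg B (1 ⊗ₜ (b0 + b0')) +
      GrAlg.tensorEquiv fatPoint.alg B (ε ⊗ₜ (b1 + b1'))
  rw [TensorProduct.tmul_add, TensorProduct.tmul_add, map_add, map_add]
  abel

theorem smul_pack (r : ℝ) (b0 b1 : B) : r • pack b0 b1 = pack (r • b0) (r • b1) := by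
  change r • (GrAlg.tensorEquiv fatPoint.alg B (1 ⊗ₜ b0) +
    GrAlg.tensorEquiv fatPoint.alg B (ε ⊗ₜ b1)) =
    GrAlg.tensorEquiv fatPoint.alg B (1 ⊗ₜ (r • b0)) +
      GrAlg.tensorEquiv fatPoint.alg B (ε ⊗ₜ (r • b1))
  rw [TensorProduct.tmul_smul, TensorProduct.tmul_smul, map_smul, map_smul, smul_add]

theorem pack_comp (z : GrAlg.Tensor fatPoint.alg B) : pack (comp B c0 z) (comp B c1 z) = z := by
  obtain ⟨z, rfl⟩ := (GrAlg.tensorEquiv fatPoint.alg B).surjective z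
  induction z with
  | zero =>
    rw [map_zero, map_zero, map_zero]
    have := smul_pack (0 : ℝ) (0 : B) 0
    rwa [zero_smul, zero_smul, eq_comm] at this
  | add x y hx hy => rw [map_add, map_add, map_add, ← pack_add, hx, hy]
  | tmul a b =>
    change GrAlg.tensorEquiv fatPoint.alg B (1 ⊗ₜ (c0 a • b)) +
      GrAlg.tensorEquiv fatPoint.alg B (ε ⊗ₜ (c1 a • b)) = _
    rw [← map_add, ← TensorProduct.smul_tmul, ← TensorProduct.smul_tmul, ← TensorProduct.add_tmul,
      ← eq_smul_add_smul]

theorem pack_mem {d : ℤ} {b0 b1 : B} (h0 : b0 ∈ B.gr d) (h1 : b1 ∈ B.gr (d + 1)) :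
    pack b0 b1 ∈ GrAlg.tensorGr fatPoint.alg B d :=
  add_mem (Submodule.subset_span ⟨0, d, zero_add d, 1, SetLike.GradedOne.one_mem, b0, h0, rfl⟩)
    (Submodule.subset_span ⟨-1, d + 1, by ring, ε, ε_mem, b1, h1, rfl⟩)

theorem comp_c0_mem {d : ℤ} {z : GrAlg.Tensor fatPoint.alg B}
    (hz : z ∈ GrAlg.tensorGr fatPoint.alg B d) : comp B c0 z ∈ B.gr d := by
  have hle : GrAlg.tensorGr fatPoint.alg B d ≤ (B.gr d).comap (comp B c0) := by
    refine Submodule.span_le.2 ?_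
    rintro _ ⟨i, j, rfl, a, ha, b, hb, rfl⟩
    change c0 a • b ∈ B.gr (i + j)
    by_cases hi : i = 0
    · subst hi
      rw [zero_add]
      exact Submodule.smul_mem _ _ hb
    · rw [c0_eq_zero hi ha, zero_smul]
      exact zero_mem _
  exact hle hz

theorem comp_c1_mem {d : ℤ} {z : GrAlg.Tensor fatPoint.alg B}
    (hz : z ∈ GrAlg.tensorGr fatPoint.alg B d) : comp B c1 z ∈ B.gr (d + 1) := by
  have hle : GrAlg.tensorGr fatPoint.alg B d ≤ (B.gr (d + 1)).comap (comp B c1) := by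
    refine Submodule.span_le.2 ?_
    rintro _ ⟨i, j, rfl, a, ha, b, hb, rfl⟩
    change c1 a • b ∈ B.gr (i + j + 1)
    by_cases hi : i = -1
    · subst hi
      rw [show (-1 + j + 1 : ℤ) = j by ring]
      exact Submodule.smul_mem _ _ hb
    · rw [c1_eq_zero hi ha, zero_smul]
      exact zero_mem _
  exact hle hz

/-- The sign comes from moving `ε`, of degree `-1`, to the left past `b0`, of degree `d`; the term
with `ε * ε` vanishes. In total degree `d` the coefficient of `ε` has degree `d + 1`. -/
theorem pack_mul {d : ℤ} {b0 b1 : B} (h0 : b0 ∈ B.gr d) (h1 : b1 ∈ B.gr (d + 1)) (b0' b1' : B) :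
    pack b0 b1 * pack b0' b1' = pack (b0 * b0') (b1 * b0' + (-1 : ℤˣ) ^ d • (b0 * b1')) := by
  have hone : (1 : fatPoint.alg) ∈ fatPoint.alg.gr 0 := SetLike.GradedOne.one_mem
  have e1 := GrAlg.tmul_mul_tmul (1 : fatPoint.alg) 1 b0 b0' d 0 h0 hone
  have e2 := GrAlg.tmul_mul_tmul (1 : fatPoint.alg) ε b0 b1' d (-1) h0 ε_mem
  have e3 := GrAlg.tmul_mul_tmul ε (1 : fatPoint.alg) b1 b0' (d + 1) 0 h1 hone
  have e4 := GrAlg.tmul_mul_tmul ε ε b1 b1' (d + 1) (-1) h1 ε_mem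
  have hz : (GrAlg.tmul (0 : fatPoint.alg) (b1 * b1') : GrAlg.Tensor fatPoint.alg B) = 0 := by
    change GrAlg.tensorEquiv fatPoint.alg B (0 ⊗ₜ (b1 * b1')) = 0
    rw [TensorProduct.zero_tmul, map_zero]
  have hadd : ∀ b b' : B, (GrAlg.tmul ε (b + b') : GrAlg.Tensor fatPoint.alg B) =
      GrAlg.tmul ε b + GrAlg.tmul ε b' := fun b b' => by
    change GrAlg.tensorEquiv fatPoint.alg B (ε ⊗ₜ (b + b')) = _
    rw [TensorProduct.tmul_add, map_add]
    rfl
  have hsgn : (-1 : ℤˣ) ^ (d * -1) = (-1 : ℤˣ) ^ d := by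
    rw [mul_neg, mul_one, uzpow_neg, Int.units_inv_eq_self]
  have hsmul : ∀ (c : ℤˣ) (b : B), (c • GrAlg.tmul ε b : GrAlg.Tensor fatPoint.alg B) =
      GrAlg.tmul ε (c • b) := fun c b => by
    change c • GrAlg.tensorEquiv fatPoint.alg B (ε ⊗ₜ b) =
      GrAlg.tensorEquiv fatPoint.alg B (ε ⊗ₜ (c • b))
    rcases Int.units_eq_one_or c with rfl | rfl
    · rw [one_smul, one_smul]
    · rw [Units.neg_smul, one_smul, Units.neg_smul, one_smul, TensorProduct.tmul_neg, map_neg]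
  rw [mul_zero, uzpow_zero, one_smul, one_mul] at e1
  rw [hsgn, one_mul, hsmul] at e2
  rw [mul_zero, uzpow_zero, one_smul, mul_one] at e3
  rw [ε_mul_ε, hz, smul_zero] at e4
  rw [pack, pack, pack, add_mul, mul_add, mul_add, e1, e2, e3, e4, add_zero, hadd, add_assoc,
    add_comm (GrAlg.tmul ε (b1 * b0'))]

/-- The component of degree `0` of a morphism `A ⟶ C(D) ⊗ B`. -/
def part0Lin (u : A ⟶ fatPoint.alg.tensor B) : A →ₗ[ℝ] B :=
  comp B c0 ∘ₗ (GrAlg.toAlgHom u).toLinearMap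

/-- The coefficient of `ε` of a morphism `A ⟶ C(D) ⊗ B`. -/
def part1 (u : A ⟶ fatPoint.alg.tensor B) : A →ₗ[ℝ] B :=
  comp B c1 ∘ₗ (GrAlg.toAlgHom u).toLinearMap

theorem apply_eq_pack (u : A ⟶ fatPoint.alg.tensor B) (a : A) :
    GrAlg.toAlgHom u a = (pack (part0Lin u a) (part1 u a) : GrAlg.Tensor fatPoint.alg B) :=
  (pack_comp _).symm

theorem part1_mem (u : A ⟶ fatPoint.alg.tensor B) {d : ℤ} {a : A} (ha : a ∈ A.gr d) :
    part1 u a ∈ B.gr (d + 1) :=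
  comp_c1_mem (GrAlg.toAlgHom_mem u ha)

theorem part0Lin_mem (u : A ⟶ fatPoint.alg.tensor B) {d : ℤ} {a : A} (ha : a ∈ A.gr d) :
    part0Lin u a ∈ B.gr d :=
  comp_c0_mem (GrAlg.toAlgHom_mem u ha)

theorem apply_mul (u : A ⟶ fatPoint.alg.tensor B) {d : ℤ} {a : A} (ha : a ∈ A.gr d) (a' : A) :
    (GrAlg.toAlgHom u (a * a') : GrAlg.Tensor fatPoint.alg B) =
      pack (part0Lin u a * part0Lin u a')
        (part1 u a * part0Lin u a' + (-1 : ℤˣ) ^ d • (part0Lin u a * part1 u a')) := by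
  rw [← pack_mul (part0Lin_mem u ha) (part1_mem u ha), ← apply_eq_pack, ← apply_eq_pack]
  exact map_mul (GrAlg.toAlgHom u) a a'

/-- The component of degree `0` of a morphism `A ⟶ C(D) ⊗ B`, as a homomorphism. -/
def part0 (u : A ⟶ fatPoint.alg.tensor B) : A →ₐ[ℝ] B :=
  AlgHom.ofLinearMap (part0Lin u)
    (by
      have h1 : (GrAlg.toAlgHom u 1 : GrAlg.Tensor fatPoint.alg B) = GrAlg.tmul 1 1 :=
        map_one (GrAlg.toAlgHom u)
      change comp B c0 (GrAlg.toAlgHom u 1) = 1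
      rw [h1, comp_tmul, c0_one, one_smul])
    (fun a a' => by
      induction a using DirectSum.Decomposition.inductionOn A.gr with
      | zero => rw [zero_mul, map_zero, zero_mul]
      | add x y hx hy => rw [add_mul, map_add, hx, hy, map_add, add_mul]
      | @homogeneous d a =>
        change comp B c0 (GrAlg.toAlgHom u (a * a')) = _
        rw [apply_mul u a.2, comp_c0_pack])

theorem part0_mem (u : A ⟶ fatPoint.alg.tensor B) {d : ℤ} {a : A} (ha : a ∈ A.gr d) :
    part0 u a ∈ B.gr d := part0Lin_mem u ha

theorem apply_eq (u : A ⟶ fatPoint.alg.tensor B) (a : A) :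
    GrAlg.toAlgHom u a = (pack (part0 u a) (part1 u a) : GrAlg.Tensor fatPoint.alg B) :=
  apply_eq_pack u a

/-- The coefficient of `ε` is a derivation of degree `1` along `part0 u`. Together with the converse
construction `mkHom`, this describes the points of `Hom (D, X)` by pairs of a homomorphism and such
a derivation. -/
theorem part1_mul (u : A ⟶ fatPoint.alg.tensor B) {d : ℤ} {a : A} (ha : a ∈ A.gr d) (a' : A) :
    part1 u (a * a') = part1 u a * part0 u a' + (-1 : ℤˣ) ^ d • (part0 u a * part1 u a') := by
  change comp B c1 (GrAlg.toAlgHom u (a * a')) = _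
  rw [apply_mul u ha, comp_c1_pack]
  rfl

theorem hom_ext {u v : A ⟶ fatPoint.alg.tensor B} (h0 : ∀ a, part0 u a = part0 v a)
    (h1 : ∀ a, part1 u a = part1 v a) : u = v :=
  GrAlg.hom_ext_apply fun a => by rw [apply_eq, apply_eq, h0, h1]

theorem map_one_eq_zero {φ : A →ₐ[ℝ] B} {δ : A →ₗ[ℝ] B}
    (hmul : ∀ d a a', a ∈ A.gr d → δ (a * a') = δ a * φ a' + (-1 : ℤˣ) ^ d • (φ a * δ a')) :
    δ 1 = 0 := by
  have h1 := hmul 0 1 1 SetLike.GradedOne.one_mem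
  rwa [mul_one, map_one φ, mul_one, one_mul, uzpow_zero, one_smul, left_eq_add] at h1

/-- The homomorphism given by a homomorphism and a derivation of degree `1` along it. -/
def mkAlgHom (φ : A →ₐ[ℝ] B) (δ : A →ₗ[ℝ] B) (hφ : ∀ d a, a ∈ A.gr d → φ a ∈ B.gr d)
    (hδ : ∀ d a, a ∈ A.gr d → δ a ∈ B.gr (d + 1))
    (hmul : ∀ d a a', a ∈ A.gr d → δ (a * a') = δ a * φ a' + (-1 : ℤˣ) ^ d • (φ a * δ a')) :
    A →ₐ[ℝ] GrAlg.Tensor fatPoint.alg B :=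
  AlgHom.ofLinearMap
    { toFun := fun a => pack (φ a) (δ a)
      map_add' := fun a a' => by rw [map_add, map_add, pack_add]
      map_smul' := fun r a => by rw [map_smul, map_smul, RingHom.id_apply, smul_pack] }
    (by
      change pack (φ 1) (δ 1) = GrAlg.tmul 1 1
      rw [map_one_eq_zero hmul, map_one, pack]
      have h2 : (GrAlg.tmul ε (0 : B) : GrAlg.Tensor fatPoint.alg B) = 0 := by
        change GrAlg.tensorEquiv fatPoint.alg B (ε ⊗ₜ 0) = 0
        rw [TensorProduct.tmul_zero, map_zero]
      rw [h2, add_zero])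
    (fun a a' => by
      induction a using DirectSum.Decomposition.inductionOn A.gr with
      | zero => rw [zero_mul, map_zero, zero_mul]
      | add x y hx hy => rw [add_mul, map_add, hx, hy, map_add, add_mul]
      | @homogeneous d a =>
        change pack (φ (a * a')) (δ (a * a')) = pack (φ a) (δ a) * pack (φ a') (δ a')
        rw [pack_mul (hφ d a a.2) (hδ d a a.2), map_mul, hmul d a a' a.2])

/-- The morphism given by a homomorphism and a derivation of degree `1` along it. -/
def mkHom (φ : A →ₐ[ℝ] B) (δ : A →ₗ[ℝ] B) (hφ : ∀ d a, a ∈ A.gr d → φ a ∈ B.gr d)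
    (hδ : ∀ d a, a ∈ A.gr d → δ a ∈ B.gr (d + 1))
    (hmul : ∀ d a a', a ∈ A.gr d → δ (a * a') = δ a * φ a' + (-1 : ℤˣ) ^ d • (φ a * δ a')) :
    A ⟶ fatPoint.alg.tensor B :=
  GrAlg.ofAlgHom (B := fatPoint.alg.tensor B) (mkAlgHom φ δ hφ hδ hmul)
    (fun d a ha => pack_mem (hφ d a ha) (hδ d a ha))

theorem tensorMap_pack (ψ : B ⟶ C) (b0 b1 : B) :
    GrAlg.toAlgHom (fatPoint.alg.tensorMap ψ) (pack b0 b1 : GrAlg.Tensor fatPoint.alg B) =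
      (pack (GrAlg.toAlgHom ψ b0) (GrAlg.toAlgHom ψ b1) : GrAlg.Tensor fatPoint.alg C) :=
  map_add (GrAlg.tensorMapAlg fatPoint.alg ψ) _ _

theorem part0_comp_tensorMap (u : A ⟶ fatPoint.alg.tensor B) (ψ : B ⟶ C) (a : A) :
    part0 (u ≫ fatPoint.alg.tensorMap ψ) a = GrAlg.toAlgHom ψ (part0 u a) := by
  change comp C c0 (GrAlg.toAlgHom (fatPoint.alg.tensorMap ψ) (GrAlg.toAlgHom u a)) = _
  rw [apply_eq u a, tensorMap_pack, comp_c0_pack]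

theorem part1_comp_tensorMap (u : A ⟶ fatPoint.alg.tensor B) (ψ : B ⟶ C) (a : A) :
    part1 (u ≫ fatPoint.alg.tensorMap ψ) a = GrAlg.toAlgHom ψ (part1 u a) := by
  change comp C c1 (GrAlg.toAlgHom (fatPoint.alg.tensorMap ψ) (GrAlg.toAlgHom u a)) = _
  rw [apply_eq u a, tensorMap_pack, comp_c1_pack]

end Fat

/-! ### Sections of direct sums -/

namespace VB
variable {M : Mfd} {E F : VB M}

theorem contMDiff_fst (v : (E.prod F).Sec) : ContMDiff (𝓡 M.dim) ((𝓡 M.dim).prod 𝓘(ℝ, E.Model)) ∞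
    (fun x => TotalSpace.mk' E.Model x (fstL E F x (v x))) := by
  intro x
  rw [contMDiffAt_section]
  have h := (contMDiffAt_section (s := v) x).1 (v.contMDiff x)
  exact (ContinuousLinearMap.fst ℝ E.Model F.Model).contMDiff.contMDiffAt.comp x h

theorem contMDiff_snd (v : (E.prod F).Sec) : ContMDiff (𝓡 M.dim) ((𝓡 M.dim).prod 𝓘(ℝ, F.Model)) ∞
    (fun x => TotalSpace.mk' F.Model x (sndL E F x (v x))) := by
  intro x
  rw [contMDiffAt_section]
  have h := (contMDiffAt_section (s := v) x).1 (v.contMDiff x)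
  exact (ContinuousLinearMap.snd ℝ E.Model F.Model).contMDiff.contMDiffAt.comp x h

/-- The section of a direct sum with given components. -/
def prodSec (v : E.Sec) (w : F.Sec) : (E.prod F).Sec :=
  ⟨fun x => ((v x, w x) : E.Fiber x × F.Fiber x), by
    intro x
    rw [contMDiffAt_section]
    have hv := (contMDiffAt_section (s := v) x).1 (v.contMDiff x)
    have hw := (contMDiffAt_section (s := w) x).1 (w.contMDiff x)
    exact hv.prodMk_space hw⟩

/-- The pullback of covectors to a direct sum, through the first summand. -/
def fstDual (E F : VB M) : E.dual.Sec →ₗ[ℝ] (E.prod F).dual.Sec where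
  toFun σ := ⟨fun x => (σ x).comp (fstL E F x), contMDiff_dual fun v =>
    (pair σ ⟨_, contMDiff_fst v⟩).contMDiff⟩
  map_add' _ _ := rfl
  map_smul' _ _ := rfl

/-- The pullback of covectors to a direct sum, through the second summand. -/
def sndDual (E F : VB M) : F.dual.Sec →ₗ[ℝ] (E.prod F).dual.Sec where
  toFun σ := ⟨fun x => (σ x).comp (sndL E F x), contMDiff_dual fun v =>
    (pair σ ⟨_, contMDiff_snd v⟩).contMDiff⟩
  map_add' _ _ := rfl
  map_smul' _ _ := rfl

/-- The restriction of covectors of a direct sum to the first summand. -/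
def inlDual (E F : VB M) : (E.prod F).dual.Sec →ₗ[ℝ] E.dual.Sec where
  toFun τ := ⟨fun x => (τ x).comp (ContinuousLinearMap.inl ℝ (E.Fiber x) (F.Fiber x)),
    contMDiff_dual fun v => (pair τ (prodSec v 0)).contMDiff⟩
  map_add' _ _ := rfl
  map_smul' _ _ := rfl

/-- The restriction of covectors of a direct sum to the second summand. -/
def inrDual (E F : VB M) : (E.prod F).dual.Sec →ₗ[ℝ] F.dual.Sec where
  toFun τ := ⟨fun x => (τ x).comp (ContinuousLinearMap.inr ℝ (E.Fiber x) (F.Fiber x)),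
    contMDiff_dual fun v => (pair τ (prodSec 0 v)).contMDiff⟩
  map_add' _ _ := rfl
  map_smul' _ _ := rfl

theorem fstDual_inlDual_add (τ : (E.prod F).dual.Sec) :
    fstDual E F (inlDual E F τ) + sndDual E F (inrDual E F τ) = τ := by
  refine ContMDiffSection.ext fun x => ContinuousLinearMap.ext fun v => ?_
  refine ((τ x).map_add (v.1, 0) (0, v.2)).symm.trans ?_
  exact congrArg (τ x) (Prod.ext (add_zero _) (zero_add _))

theorem inlDual_sndDual (σ : F.dual.Sec) : inlDual E F (sndDual E F σ) = 0 := by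
  exact ContMDiffSection.ext fun x => ContinuousLinearMap.ext fun v => map_zero (σ x)

theorem inrDual_fstDual (σ : E.dual.Sec) : inrDual E F (fstDual E F σ) = 0 := by
  exact ContMDiffSection.ext fun x => ContinuousLinearMap.ext fun v => map_zero (σ x)

/-- The identification of the covectors of equal bundles. -/
def castDual (h : E = F) : F.dual.Sec →ₗ[ℝ] E.dual.Sec where
  toFun σ := ⟨fun x => (σ x).comp (castL h x), by subst h; exact σ.contMDiff⟩
  map_add' _ _ := rfl
  map_smul' _ _ := rfl

theorem castDual_symm_castDual (h : E = F) (σ : F.dual.Sec) : castDual h.symm (castDual h σ) = σ := by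
  subst h; rfl

theorem castDual_castDual_symm (h : E = F) (σ : E.dual.Sec) : castDual h (castDual h.symm σ) = σ := by
  subst h; rfl

end VB

namespace GVB
variable {M : Mfd} (V : GVB M)

theorem inDegree_of_eq {i j : ℤ} (E : VB M) (h : i = j) : inDegree j E i = E := if_pos h

/-- A section of `(V i)^*` as a section of `(V ⊕ T[1]M ⊕ V[1])^*`. -/
def secV (i : ℤ) : (V i).dual.Sec →ₗ[ℝ] (V.tangentShift i).dual.Sec :=
  VB.fstDual (V i) ((inDegree (-1) (VB.tangent M) i).prod (V (1 + i)))

/-- A section of `(T[1]M)^*` as a section of `(V ⊕ T[1]M ⊕ V[1])^*`. -/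
def secMid (i : ℤ) : (inDegree (-1) (VB.tangent M) i).dual.Sec →ₗ[ℝ] (V.tangentShift i).dual.Sec :=
  VB.sndDual (V i) ((inDegree (-1) (VB.tangent M) i).prod (V (1 + i))) ∘ₗ
    VB.fstDual (inDegree (-1) (VB.tangent M) i) (V (1 + i))

/-- A `1`-form as a section of `(V ⊕ T[1]M ⊕ V[1])^*`. -/
def secT : (VB.tangent M).dual.Sec →ₗ[ℝ] (V.tangentShift (-1)).dual.Sec :=
  V.secMid (-1) ∘ₗ VB.castDual (inDegree_self (-1) (VB.tangent M))

/-- A section of `(V (1 + i))^*` as a section of `(V ⊕ T[1]M ⊕ V[1])^*`, through `V[1]`. -/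
def secShift (i : ℤ) : (V (1 + i)).dual.Sec →ₗ[ℝ] (V.tangentShift i).dual.Sec :=
  VB.sndDual (V i) ((inDegree (-1) (VB.tangent M) i).prod (V (1 + i))) ∘ₗ
    VB.sndDual (inDegree (-1) (VB.tangent M) i) (V (1 + i))

/-- The component of a section in `V^*`. -/
def compV (i : ℤ) : (V.tangentShift i).dual.Sec →ₗ[ℝ] (V i).dual.Sec :=
  VB.inlDual (V i) ((inDegree (-1) (VB.tangent M) i).prod (V (1 + i)))

/-- The component of a section in `(T[1]M)^*`. -/
def compMid (i : ℤ) : (V.tangentShift i).dual.Sec →ₗ[ℝ] (inDegree (-1) (VB.tangent M) i).dual.Sec :=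
  VB.inlDual (inDegree (-1) (VB.tangent M) i) (V (1 + i)) ∘ₗ
    VB.inrDual (V i) ((inDegree (-1) (VB.tangent M) i).prod (V (1 + i)))

/-- The component of a section in `V[1]^*`. -/
def compShift (i : ℤ) : (V.tangentShift i).dual.Sec →ₗ[ℝ] (V (1 + i)).dual.Sec :=
  VB.inrDual (inDegree (-1) (VB.tangent M) i) (V (1 + i)) ∘ₗ
    VB.inrDual (V i) ((inDegree (-1) (VB.tangent M) i).prod (V (1 + i)))

theorem sec_decomp (i : ℤ) (τ : (V.tangentShift i).dual.Sec) :
    τ = V.secV i (V.compV i τ) + (V.secMid i (V.compMid i τ) + V.secShift i (V.compShift i τ)) := by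
  have h1 := VB.fstDual_inlDual_add (E := V i)
    (F := (inDegree (-1) (VB.tangent M) i).prod (V (1 + i))) τ
  have h2 := VB.fstDual_inlDual_add (E := inDegree (-1) (VB.tangent M) i) (F := V (1 + i))
    (VB.inrDual (V i) ((inDegree (-1) (VB.tangent M) i).prod (V (1 + i))) τ)
  rw [← h2, map_add] at h1
  exact h1.symm

/-- The component of a section in `T^*M`, which is `0` unless the degree is `1`. -/
def compT (i : ℤ) : (V.tangentShift i).dual.Sec →ₗ[ℝ] (VB.tangent M).dual.Sec :=
  if h : i = -1 then VB.castDual (inDegree_of_eq (VB.tangent M) h).symm ∘ₗ V.compMid i else 0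

theorem compT_of_ne {i : ℤ} (h : i ≠ -1) : V.compT i = 0 := dif_neg h

theorem secMid_eq (τ : (V.tangentShift (-1)).dual.Sec) :
    V.secMid (-1) (V.compMid (-1) τ) = V.secT (V.compT (-1) τ) := by
  rw [compT, dif_pos rfl, secT]
  exact congrArg (V.secMid (-1)) (VB.castDual_castDual_symm _ _).symm

theorem compMid_of_ne {i : ℤ} (h : i ≠ -1) (τ : (V.tangentShift i).dual.Sec) : V.compMid i τ = 0 := by
  refine ContMDiffSection.ext fun x => ?_
  exact VB.dual_eq_zero_of_eq (E := inDegree (-1) (VB.tangent M) i) (if_neg h) x _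

theorem compV_secV (i : ℤ) (σ : (V i).dual.Sec) : V.compV i (V.secV i σ) = σ := rfl

theorem compV_secMid (i : ℤ) (β : (inDegree (-1) (VB.tangent M) i).dual.Sec) :
    V.compV i (V.secMid i β) = 0 := VB.inlDual_sndDual _

theorem compV_secShift (i : ℤ) (σ : (V (1 + i)).dual.Sec) : V.compV i (V.secShift i σ) = 0 :=
  VB.inlDual_sndDual _

theorem compMid_secV (i : ℤ) (σ : (V i).dual.Sec) : V.compMid i (V.secV i σ) = 0 :=
  (congrArg (VB.inlDual (inDegree (-1) (VB.tangent M) i) (V (1 + i)))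
    (VB.inrDual_fstDual σ)).trans (map_zero _)

theorem compMid_secShift (i : ℤ) (σ : (V (1 + i)).dual.Sec) : V.compMid i (V.secShift i σ) = 0 :=
  VB.inlDual_sndDual σ

theorem compShift_secV (i : ℤ) (σ : (V i).dual.Sec) : V.compShift i (V.secV i σ) = 0 :=
  (congrArg (VB.inrDual (inDegree (-1) (VB.tangent M) i) (V (1 + i)))
    (VB.inrDual_fstDual σ)).trans (map_zero _)

theorem compShift_secMid (i : ℤ) (β : (inDegree (-1) (VB.tangent M) i).dual.Sec) :
    V.compShift i (V.secMid i β) = 0 := VB.inrDual_fstDual β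

theorem compShift_secShift (i : ℤ) (σ : (V (1 + i)).dual.Sec) :
    V.compShift i (V.secShift i σ) = σ := rfl

theorem compT_eq_zero {i : ℤ} {τ : (V.tangentShift i).dual.Sec} (h : V.compMid i τ = 0) :
    V.compT i τ = 0 := by
  unfold compT
  split_ifs with hi
  · rw [LinearMap.comp_apply, h, map_zero]
  · rfl

theorem compT_secT (α : (VB.tangent M).dual.Sec) : V.compT (-1) (V.secT α) = α := by
  rw [compT, dif_pos rfl]
  exact VB.castDual_symm_castDual _ α

theorem compV_fsmul (i : ℤ) (f : M.Fun) (τ : (V.tangentShift i).dual.Sec) :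
    V.compV i (VB.fsmul f τ) = VB.fsmul f (V.compV i τ) := rfl

theorem compShift_fsmul (i : ℤ) (f : M.Fun) (τ : (V.tangentShift i).dual.Sec) :
    V.compShift i (VB.fsmul f τ) = VB.fsmul f (V.compShift i τ) := rfl

theorem compT_fsmul (i : ℤ) (f : M.Fun) (τ : (V.tangentShift i).dual.Sec) :
    V.compT i (VB.fsmul f τ) = VB.fsmul f (V.compT i τ) := by
  unfold compT
  split_ifs
  · rfl
  · exact ContMDiffSection.ext fun x => (smul_zero (f x)).symm

/-- A property of elements of `Γ (S^{≥ 0} (V ⊕ T[1]M ⊕ V[1])^*)` that is closed under sums holds for all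
sections of `(V ⊕ T[1]M ⊕ V[1])^*` if it holds for those of the three summands. -/
theorem sec_induction {P : ∀ i, (V.tangentShift i).dual.Sec → Prop}
    (hV : ∀ i σ, P i (V.secV i σ)) (hT : ∀ α, P (-1) (V.secT α))
    (hS : ∀ i σ, P i (V.secShift i σ)) (hadd : ∀ i σ τ, P i σ → P i τ → P i (σ + τ)) (i : ℤ)
    (τ : (V.tangentShift i).dual.Sec) : P i τ := by
  rw [V.sec_decomp i τ]
  by_cases hi : i = -1
  · subst hi
    refine hadd _ _ _ (hV _ _) (hadd _ _ _ ?_ (hS _ _))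
    rw [secMid_eq]
    exact hT _
  · rw [V.compMid_of_ne hi, map_zero, zero_add]
    exact hadd _ _ _ (hV _ _) (hS _ _)

end GVB

namespace Fat
variable {A B : GrAlg} (φ : A →ₐ[ℝ] B) (δ : A →ₗ[ℝ] B) (hφ : ∀ d a, a ∈ A.gr d → φ a ∈ B.gr d)
  (hδ : ∀ d a, a ∈ A.gr d → δ a ∈ B.gr (d + 1))
  (hmul : ∀ d a a', a ∈ A.gr d → δ (a * a') = δ a * φ a' + (-1 : ℤˣ) ^ d • (φ a * δ a'))

@[simp] theorem part0_mkHom (a : A) : part0 (mkHom φ δ hφ hδ hmul) a = φ a := comp_c0_pack (φ a) (δ a)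

@[simp] theorem part1_mkHom (a : A) : part1 (mkHom φ δ hφ hδ hmul) a = δ a := comp_c1_pack (φ a) (δ a)

end Fat

/-! ### Gluing morphisms to `C(D) ⊗ Γ(S W^*)` from fibers, and the extension lemma for `V ⊕ T[1]M ⊕
V[1]` -/

namespace GVB
variable {M : Mfd}

/-- The fiber of `S^{≥ 0} V^*` as a graded algebra. -/
def fiberAlg (V : GVB M) (x : M) : GrAlg where
  carrier := V.SymFiber x
  gr := GSym.gr fun i => (V i).dual.Fiber x

/-- Evaluation at a point, as a morphism of graded algebras. -/
def evHom (V : GVB M) (x : M) : V.funAlg ⟶ V.fiberAlg x :=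
  GrAlg.ofAlgHom (B := V.fiberAlg x) (V.evAt x) fun _ _ ha => V.evAt_mem_gr ha x

theorem evHom_apply (V : GVB M) (x : M) (s : V.funAlg) :
    GrAlg.toAlgHom (V.evHom x) s = V.evAt x s := rfl

/-- Local homomorphisms to the tensor products of the fibers with the functions on the fat point that
are smooth on generators define a morphism. -/
theorem exists_hom_of_fiberwise {V W : GVB M}
    (F : ∀ x, V.funAlg →ₐ[ℝ] GrAlg.Tensor fatPoint.alg (W.fiberAlg x))
    (hF : ∀ x, IsLocalAt x (F x).toLinearMap)
    (h0 : ∀ f, ∃ a ∈ W.funAlg.gr 0, ∃ b ∈ W.funAlg.gr (0 + 1), ∀ x,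
      F x (V.ofFun f) = Fat.pack (B := W.fiberAlg x) (W.evAt x a) (W.evAt x b))
    (h1 : ∀ i σ, ∃ a ∈ W.funAlg.gr (-i), ∃ b ∈ W.funAlg.gr (-i + 1), ∀ x,
      F x (V.ofSec i σ) = Fat.pack (B := W.fiberAlg x) (W.evAt x a) (W.evAt x b)) :
    ∃ u : V.funAlg ⟶ fatPoint.alg.tensor W.funAlg, ∀ x s,
      F x s = Fat.pack (B := W.fiberAlg x) (W.evAt x (Fat.part0 u s)) (W.evAt x (Fat.part1 u s)) := by
  have hmem : ∀ x d s, s ∈ V.funAlg.gr d → F x s ∈ GrAlg.tensorGr fatPoint.alg (W.fiberAlg x) d := by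
    intro x d s hs
    refine map_mem_of_gens (hF x) (GrAlg.tensorGr fatPoint.alg (W.fiberAlg x)) (fun f => ?_)
      (fun i σ => ?_) hs
    · obtain ⟨a, ha, b, hb, h⟩ := h0 f
      rw [h]
      exact Fat.pack_mem (GrAlg.toAlgHom_mem (W.evHom x) ha) (GrAlg.toAlgHom_mem (W.evHom x) hb)
    · obtain ⟨a, ha, b, hb, h⟩ := h1 i σ
      rw [h]
      exact Fat.pack_mem (GrAlg.toAlgHom_mem (W.evHom x) ha) (GrAlg.toAlgHom_mem (W.evHom x) hb)
  let G : ∀ x, V.funAlg ⟶ fatPoint.alg.tensor (W.fiberAlg x) := fun x =>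
    GrAlg.ofAlgHom (B := fatPoint.alg.tensor (W.fiberAlg x)) (F x) (hmem x)
  have hG : ∀ x s, F x s = Fat.pack (Fat.part0 (G x) s) (Fat.part1 (G x) s) := fun x s =>
    Fat.apply_eq (G x) s
  -- On generators the maps `F x` are the evaluations at `x` of one global tensor. As everything is
  -- multiplicative, this extends to polynomial elements and supplies the smoothness needed for
  -- gluing.
  have hpoly : ∀ p ∈ V.polyAlg, ∃ z : GrAlg.Tensor fatPoint.alg W.funAlg, ∀ x,
      F x p = GrAlg.tensorMapAlg fatPoint.alg (W.evHom x) z := by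
    intro p hp
    refine poly_induction (P := fun p => ∃ z : GrAlg.Tensor fatPoint.alg W.funAlg, ∀ x,
      F x p = GrAlg.tensorMapAlg fatPoint.alg (W.evHom x) z) ?_ ?_ ?_ ?_ hp
    · intro f
      obtain ⟨a, -, b, -, h⟩ := h0 f
      exact ⟨Fat.pack a b, fun x => (h x).trans (Fat.tensorMap_pack (W.evHom x) a b).symm⟩
    · intro i σ
      obtain ⟨a, -, b, -, h⟩ := h1 i σ
      exact ⟨Fat.pack a b, fun x => (h x).trans (Fat.tensorMap_pack (W.evHom x) a b).symm⟩
    · rintro s t ⟨z, hz⟩ ⟨w, hw⟩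
      exact ⟨z + w, fun x => by rw [map_add, map_add, hz, hw]⟩
    · rintro s t ⟨z, hz⟩ ⟨w, hw⟩
      exact ⟨z * w, fun x => by rw [map_mul, map_mul, hz, hw]⟩
  have hpoly' : ∀ p ∈ V.polyAlg, ∃ a b : W.funAlg, ∀ x, Fat.part0 (G x) p = W.evAt x a ∧
      Fat.part1 (G x) p = W.evAt x b := by
    intro p hp
    obtain ⟨z, hz⟩ := hpoly p hp
    refine ⟨Fat.comp W.funAlg Fat.c0 z, Fat.comp W.funAlg Fat.c1 z, fun x => ?_⟩
    have h2 := hz x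
    rw [← Fat.pack_comp z] at h2
    have h3 := h2.trans (Fat.tensorMap_pack (W.evHom x) _ _)
    rw [hG] at h3
    have h4 := congrArg (Fat.comp (W.fiberAlg x) Fat.c0) h3
    have h5 := congrArg (Fat.comp (W.fiberAlg x) Fat.c1) h3
    rw [Fat.comp_c0_pack, Fat.comp_c0_pack] at h4
    rw [Fat.comp_c1_pack, Fat.comp_c1_pack] at h5
    exact ⟨h4, h5⟩
  have hloc0 : ∀ x, IsLocalAt x ((Fat.part0 (G x)).toLinearMap) := fun x s hs => by
    have h : F x s = 0 := hF x s hs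
    exact (congrArg (Fat.comp (W.fiberAlg x) Fat.c0) h).trans (map_zero _)
  have hloc1 : ∀ x, IsLocalAt x (Fat.part1 (G x)) := fun x s hs => by
    have h : F x s = 0 := hF x s hs
    exact (congrArg (Fat.comp (W.fiberAlg x) Fat.c1) h).trans (map_zero _)
  -- The two coefficients are glued separately as linear maps, with degree shifts `0` and `1`.
  -- Multiplicativity and the Leibniz rule are then checked pointwise and the pair is reassembled by
  -- `Fat.mkHom`.
  obtain ⟨φ, hφ, hφ'⟩ := exists_linearMap (V := V) (W := W) (g := id) continuous_id
    (fun x => (Fat.part0 (G x)).toLinearMap) hloc0 0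
    (fun x d s hs => by
      rw [add_zero]
      exact Fat.part0_mem (G x) hs)
    (fun p hp y => by
      obtain ⟨a, b, h⟩ := hpoly' p hp
      exact ⟨a, Filter.Eventually.of_forall fun x => (h x).1⟩)
  obtain ⟨δ, hδ, hδ'⟩ := exists_linearMap (V := V) (W := W) (g := id) continuous_id
    (fun x => Fat.part1 (G x)) hloc1 1 (fun x d s hs => Fat.part1_mem (G x) hs)
    (fun p hp y => by
      obtain ⟨a, b, h⟩ := hpoly' p hp
      exact ⟨b, Filter.Eventually.of_forall fun x => (h x).2⟩)
  let φ' : V.funAlg →ₐ[ℝ] W.funAlg := AlgHom.ofLinearMap φ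
    (funAlg_ext fun x => (hφ x 1).trans ((map_one (Fat.part0 (G x))).trans (map_one (W.evAt x)).symm))
    (fun s t => funAlg_ext fun x => by
      refine (hφ x _).trans ((map_mul (Fat.part0 (G x)) s t).trans ?_)
      rw [map_mul]
      exact congrArg₂ _ (hφ x s).symm (hφ x t).symm)
  have hφ2 : ∀ x s, GrAlg.toAlgHom (W.evHom x) (φ' s) = Fat.part0 (G x) s := hφ
  have hδ2 : ∀ x s, GrAlg.toAlgHom (W.evHom x) (δ s) = Fat.part1 (G x) s := hδ
  let u : V.funAlg ⟶ fatPoint.alg.tensor W.funAlg := Fat.mkHom φ' δ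
    (fun d s hs => by
      have := hφ' d s hs
      rwa [add_zero] at this) hδ' (fun d s t hs => funAlg_ext fun x => by
        refine (hδ x _).trans ((Fat.part1_mul (G x) hs t).trans ?_)
        rw [← hφ2, ← hφ2, ← hδ2, ← hδ2, ← evHom_apply, map_add, map_mul, Units.smul_def,
          Units.smul_def, map_zsmul, map_mul])
  refine ⟨u, fun x s => ?_⟩
  have hu0 : Fat.part0 u s = φ' s := Fat.part0_mkHom _ _ _ _ _ s
  have hu1 : Fat.part1 u s = δ s := Fat.part1_mkHom _ _ _ _ _ s
  exact (hG x s).trans (congrArg₂ Fat.pack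
    ((hφ2 x s).symm.trans (congrArg (GrAlg.toAlgHom (W.evHom x)) hu0.symm))
    ((hδ2 x s).symm.trans (congrArg (GrAlg.toAlgHom (W.evHom x)) hu1.symm)))

/-- The extension lemma for `V ⊕ T[1]M ⊕ V[1]`. -/
theorem exists_algHom_tangentShift (V : GVB M) {B : Type} [Ring B] [Algebra ℝ B]
    (𝒢 : ℤ → Submodule ℝ B) [SetLike.GradedMonoid 𝒢]
    (hcomm : ∀ d e, ∀ a ∈ 𝒢 d, ∀ b ∈ 𝒢 e, a * b = (-1 : ℤˣ) ^ (d * e) • (b * a)) (x : M)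
    (φ : M.Fun →ₐ[ℝ] B) (hφ : ∀ f : M.Fun, (∀ᶠ z in 𝓝 x, f z = 0) → φ f = 0)
    (hφ0 : ∀ f, φ f ∈ 𝒢 0)
    (P : ∀ i, (V i).dual.Sec →ₗ[ℝ] B) (hP : ∀ i f σ, P i (VB.fsmul f σ) = φ f * P i σ)
    (hPm : ∀ i σ, P i σ ∈ 𝒢 (-i))
    (Q : (VB.tangent M).dual.Sec →ₗ[ℝ] B) (hQ : ∀ f α, Q (VB.fsmul f α) = φ f * Q α)
    (hQm : ∀ α, Q α ∈ 𝒢 1)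
    (S : ∀ i, (V (1 + i)).dual.Sec →ₗ[ℝ] B) (hS : ∀ i f σ, S i (VB.fsmul f σ) = φ f * S i σ)
    (hSm : ∀ i σ, S i σ ∈ 𝒢 (-i)) :
    ∃ F : V.tangentShift.funAlg →ₐ[ℝ] B, IsLocalAt x F.toLinearMap ∧
      (∀ f, F (V.tangentShift.ofFun f) = φ f) ∧
      (∀ i σ, F (V.tangentShift.ofSec i (V.secV i σ)) = P i σ) ∧
      (∀ α, F (V.tangentShift.ofSec (-1) (V.secT α)) = Q α) ∧
      ∀ i σ, F (V.tangentShift.ofSec i (V.secShift i σ)) = S i σ := by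
  let Ψ : ∀ i, (V.tangentShift i).dual.Sec →ₗ[ℝ] B := fun i =>
    P i ∘ₗ V.compV i + (Q ∘ₗ V.compT i + S i ∘ₗ V.compShift i)
  have hΨa : ∀ i τ, Ψ i τ = P i (V.compV i τ) + (Q (V.compT i τ) + S i (V.compShift i τ)) :=
    fun i τ => rfl
  have hm : ∀ i τ, Ψ i τ ∈ 𝒢 (-i) := by
    intro i τ
    refine add_mem (hPm i _) (add_mem ?_ (hSm i _))
    by_cases hi : i = -1
    · subst hi
      exact hQm _
    · rw [compT_of_ne V hi, LinearMap.comp_zero]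
      exact zero_mem _
  -- Commutation with functions and the Koszul rule both come from graded commutativity of `𝒢`,
  -- because `Ψ i` takes values in degree `-i`.
  obtain ⟨F, hF, h0, h1⟩ := exists_algHom (V := V.tangentShift) x φ hφ Ψ
    (fun i f τ => by
      rw [hΨa, hΨa, compV_fsmul, compT_fsmul, compShift_fsmul, hP, hQ, hS, mul_add, mul_add])
    (fun f i τ => by
      have h := hcomm 0 (-i) _ (hφ0 f) _ (hm i τ)
      rwa [zero_mul, uzpow_zero, one_smul] at h)
    (fun i j σ τ => by
      have h := hcomm (-i) (-j) _ (hm i σ) _ (hm j τ)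
      rwa [neg_mul_neg] at h)
  refine ⟨F, hF, h0, fun i σ => ?_, fun α => ?_, fun i σ => ?_⟩
  · rw [h1, hΨa, compV_secV, compT_eq_zero V (compMid_secV V i σ), compShift_secV, map_zero, map_zero,
      add_zero, add_zero]
  · have e1 : V.compV (-1) (V.secT α) = 0 := compV_secMid V _ _
    have e2 : V.compShift (-1) (V.secT α) = 0 := compShift_secMid V _ _
    rw [h1, hΨa, e1, e2, compT_secT, map_zero, map_zero, add_zero, zero_add]
  · rw [h1, hΨa, compV_secShift, compT_eq_zero V (compMid_secShift V i σ), compShift_secShift,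
      map_zero, map_zero, zero_add, zero_add]

end GVB

/-! ### The universal morphism -/

namespace Mfd
variable {M : Mfd}

theorem Fun.mdifferentiableAt (f : M.Fun) (x : M) : MDifferentiableAt (𝓡 M.dim) 𝓘(ℝ, ℝ) f x :=
  f.contMDiff.contMDiffAt.mdifferentiableAt (by simp)

theorem dFun_add (f g : M.Fun) : dFun (f + g) = dFun f + dFun g :=
  ContMDiffSection.ext fun x => mvfderiv_add (f.mdifferentiableAt x) (g.mdifferentiableAt x)

theorem dFun_mul (f g : M.Fun) : dFun (f * g) = VB.fsmul f (dFun g) + VB.fsmul g (dFun f) :=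
  ContMDiffSection.ext fun x => mvfderiv_mul (f.mdifferentiableAt x) (g.mdifferentiableAt x)

theorem dFun_const (r : ℝ) : dFun (algebraMap ℝ M.Fun r) = 0 :=
  ContMDiffSection.ext fun _ => mvfderiv_const r

theorem dFun_apply_of_eventually {f : M.Fun} {x : M} (h : ∀ᶠ z in 𝓝 x, f z = 0) : dFun f x = 0 := by
  have h1 : (f : M → ℝ) =ᶠ[𝓝 x] fun _ => (0 : ℝ) := h
  have h2 := h1.mfderiv_eq (I := 𝓡 M.dim) (I' := 𝓘(ℝ, ℝ))
  rw [mfderiv_const] at h2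
  rw [dFun_apply, mvfderiv, h2]
  rfl

end Mfd

namespace Fat

theorem pack_inj {B : GrAlg} {a b a' b' : B} (h : pack a b = pack a' b') : a = a' ∧ b = b' := by
  have h0 := congrArg (comp B c0) h
  have h1 := congrArg (comp B c1) h
  rw [comp_c0_pack, comp_c0_pack] at h0
  rw [comp_c1_pack, comp_c1_pack] at h1
  exact ⟨h0, h1⟩

/-- The tensor product of the functions on the fat point with a graded-commutative algebra is
graded-commutative. -/
theorem tensor_comm {B : GrAlg} (hB : ∀ d e : ℤ, ∀ a ∈ B.gr d, ∀ b ∈ B.gr e,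
      a * b = (-1 : ℤˣ) ^ (d * e) • (b * a)) (d e : ℤ) {z w : GrAlg.Tensor fatPoint.alg B}
    (hz : z ∈ GrAlg.tensorGr fatPoint.alg B d) (hw : w ∈ GrAlg.tensorGr fatPoint.alg B e) :
    z * w = (-1 : ℤˣ) ^ (d * e) • (w * z) := by
  have z0 := comp_c0_mem hz
  have z1 := comp_c1_mem hz
  have w0 := comp_c0_mem hw
  have w1 := comp_c1_mem hw
  rw [← pack_comp z, ← pack_comp w, pack_mul z0 z1, pack_mul w0 w1]
  have hs : ∀ (c : ℤˣ) (a b : B), c • pack a b = pack (c • a) (c • b) := fun c a b => by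
    rcases Int.units_eq_one_or c with rfl | rfl
    · rw [one_smul, one_smul, one_smul]
    · have h := smul_pack (-1 : ℝ) a b
      simpa only [Units.neg_smul, one_smul, neg_smul] using h
  rw [hs, hB d e _ z0 _ w0, hB (d + 1) e _ z1 _ w0, hB d (e + 1) _ z0 _ w1, smul_add, smul_smul,
    smul_smul]
  congr 1
  rw [add_comm]
  have e1 : (-1 : ℤˣ) ^ d * (-1 : ℤˣ) ^ (d * (e + 1)) = (-1 : ℤˣ) ^ (d * e) := by
    rw [← uzpow_add, show d + d * (e + 1) = d * e + (d + d) by ring, uzpow_add, uzpow_add _ d d,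
      Int.units_mul_self, mul_one]
  have e2 : (-1 : ℤˣ) ^ (d * e) * (-1 : ℤˣ) ^ e = (-1 : ℤˣ) ^ ((d + 1) * e) := by
    rw [← uzpow_add, show d * e + e = (d + 1) * e by ring]
  rw [e1, e2]

end Fat

namespace GVB
variable {M : Mfd}

/-- A morphism to the tensor product with the functions on the fat point may be defined on functions
and sections. -/
theorem exists_hom_tensor {V W : GVB M} (a b : ∀ i, (V i).dual.Sec → W.funAlg) (d : M.Fun → W.funAlg)
    (hd : ∀ f, d f ∈ W.funAlg.gr 1) (hd_add : ∀ f g, d (f + g) = d f + d g)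
    (hd_const : ∀ r : ℝ, d (algebraMap ℝ M.Fun r) = 0)
    (hd_mul : ∀ f g, d (f * g) = W.ofFun g * d f + W.ofFun f * d g)
    (hd_loc : ∀ (f : M.Fun) x, (∀ᶠ z in 𝓝 x, f z = 0) → W.evAt x (d f) = 0)
    (ha : ∀ i σ, a i σ ∈ W.funAlg.gr (-i)) (ha_add : ∀ i σ τ, a i (σ + τ) = a i σ + a i τ)
    (ha_smul : ∀ i (r : ℝ) σ, a i (r • σ) = r • a i σ)
    (ha_fsmul : ∀ i f σ, a i (VB.fsmul f σ) = W.ofFun f * a i σ)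
    (hb : ∀ i σ, b i σ ∈ W.funAlg.gr (-i + 1)) (hb_add : ∀ i σ τ, b i (σ + τ) = b i σ + b i τ)
    (hb_smul : ∀ i (r : ℝ) σ, b i (r • σ) = r • b i σ)
    (hb_fsmul : ∀ i f σ, b i (VB.fsmul f σ) = d f * a i σ + W.ofFun f * b i σ) :
    ∃ u : V.funAlg ⟶ fatPoint.alg.tensor W.funAlg,
      (∀ f, Fat.part0 u (V.ofFun f) = W.ofFun f) ∧ (∀ f, Fat.part1 u (V.ofFun f) = d f) ∧
      (∀ i σ, Fat.part0 u (V.ofSec i σ) = a i σ) ∧ ∀ i σ, Fat.part1 u (V.ofSec i σ) = b i σ := by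
  have hpm : ∀ f g : M.Fun, Fat.pack (W.ofFun f) (d f) * Fat.pack (W.ofFun g) (d g) =
      Fat.pack (W.ofFun (f * g)) (d (f * g)) := fun f g => by
    rw [Fat.pack_mul (W.ofFun_mem f) (hd f), hd_mul, uzpow_zero, one_smul]
    have h1 := W.funAlg_comm 0 1 _ _ (W.ofFun_mem g) (hd f)
    rw [zero_mul, uzpow_zero, one_smul] at h1
    rw [h1]
    exact congrArg (Fat.pack · _) (map_mul W.ofFunHom f g).symm
  have hpc : ∀ r : ℝ, (Fat.pack (W.ofFun (algebraMap ℝ M.Fun r)) (d (algebraMap ℝ M.Fun r)) :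
      GrAlg.Tensor fatPoint.alg W.funAlg) = algebraMap ℝ _ r := fun r => by
    have h0 : W.ofFun (algebraMap ℝ M.Fun r) = r • (1 : W.funAlg) :=
      (W.ofFunHom.commutes r).trans (Algebra.algebraMap_eq_smul_one r)
    have h2 : (GrAlg.tmul ε (0 : W.funAlg) : GrAlg.Tensor fatPoint.alg W.funAlg) = 0 := by
      change GrAlg.tensorEquiv fatPoint.alg W.funAlg (ε ⊗ₜ 0) = 0
      rw [TensorProduct.tmul_zero, map_zero]
    have h3 := Fat.smul_pack r (1 : W.funAlg) 0
    rw [smul_zero] at h3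
    rw [hd_const, h0, ← h3, Fat.pack, h2, add_zero, Algebra.algebraMap_eq_smul_one]
    rfl
  let Φ : M.Fun →ₐ[ℝ] GrAlg.Tensor fatPoint.alg W.funAlg :=
    { toFun := fun f => Fat.pack (W.ofFun f) (d f)
      map_one' := by
        have h := hpc 1
        rwa [map_one, map_one] at h
      map_mul' := fun f g => (hpm f g).symm
      map_zero' := by
        have h := hpc 0
        rwa [map_zero, map_zero] at h
      map_add' := fun f g => by
        rw [Fat.pack_add, hd_add]
        exact congrArg (Fat.pack · _) (map_add W.ofFunHom f g)
      commutes' := hpc }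
  let P : ∀ i, (V i).dual.Sec →ₗ[ℝ] GrAlg.Tensor fatPoint.alg W.funAlg := fun i =>
    { toFun := fun σ => Fat.pack (a i σ) (b i σ)
      map_add' := fun σ τ => by rw [Fat.pack_add, ha_add, hb_add]
      map_smul' := fun r σ => by rw [RingHom.id_apply, Fat.smul_pack, ha_smul, hb_smul] }
  have hΦm : ∀ f, Φ f ∈ GrAlg.tensorGr fatPoint.alg W.funAlg 0 := fun f =>
    Fat.pack_mem (W.ofFun_mem f) (hd f)
  have hPm : ∀ i σ, P i σ ∈ GrAlg.tensorGr fatPoint.alg W.funAlg (-i) := fun i σ =>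
    Fat.pack_mem (ha i σ) (hb i σ)
  have hcomm := fun d e z w => @Fat.tensor_comm W.funAlg
    (fun d e a ha b hb => W.funAlg_comm d e a b ha hb) d e z w
  have hΦP : ∀ f i σ, Commute (Φ f) (P i σ) := fun f i σ => by
    have h := hcomm 0 (-i) _ _ (hΦm f) (hPm i σ)
    rwa [zero_mul, uzpow_zero, one_smul] at h
  have hPf : ∀ i f σ, P i (VB.fsmul f σ) = Φ f * P i σ := fun i f σ => by
    change Fat.pack _ _ = Fat.pack _ _ * Fat.pack _ _
    rw [Fat.pack_mul (W.ofFun_mem f) (hd f), uzpow_zero, one_smul, ha_fsmul, hb_fsmul]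
  have hPP : ∀ i j σ τ, P i σ * P j τ = (-1 : ℤˣ) ^ (i * j) • (P j τ * P i σ) := fun i j σ τ => by
    have h := hcomm (-i) (-j) _ _ (hPm i σ) (hPm j τ)
    rwa [neg_mul_neg] at h
  have hev : ∀ (x : M) (s t : W.funAlg), GrAlg.tensorMapAlg fatPoint.alg (W.evHom x) (Fat.pack s t) =
      Fat.pack (B := W.fiberAlg x) (W.evAt x s) (W.evAt x t) := fun x s t =>
    Fat.tensorMap_pack (W.evHom x) s t
  -- `exists_algHom` needs data depending only on germs at one point. This becomes true after
  -- evaluating the coefficients at `x`, so the extension is made at each point and glued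
  -- afterwards.
  have hex := fun x => exists_algHom (V := V) x
    ((GrAlg.tensorMapAlg fatPoint.alg (W.evHom x)).comp Φ)
    (fun f hf => by
      refine (hev x _ _).trans ?_
      have h1 : W.evAt x (W.ofFun f) = 0 := by rw [evAt_ofFun, hf.self_of_nhds, map_zero]
      rw [h1, hd_loc f x hf]
      have h2 := Fat.smul_pack (B := W.fiberAlg x) 0 0 0
      rwa [zero_smul, zero_smul, eq_comm] at h2)
    (fun i => (GrAlg.tensorMapAlg fatPoint.alg (W.evHom x)).toLinearMap ∘ₗ P i)
    (fun i f σ => (congrArg (GrAlg.tensorMapAlg fatPoint.alg (W.evHom x)) (hPf i f σ)).trans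
      (map_mul (GrAlg.tensorMapAlg fatPoint.alg (W.evHom x)) (Φ f) (P i σ)))
    (fun f i σ => (hΦP f i σ).map (GrAlg.tensorMapAlg fatPoint.alg (W.evHom x)))
    (fun i j σ τ => by
      have h := congrArg (GrAlg.tensorMapAlg fatPoint.alg (W.evHom x)) (hPP i j σ τ)
      rw [Units.smul_def, map_zsmul, map_mul, map_mul] at h
      exact h)
  choose F hF hF0 hF1 using hex
  obtain ⟨u, hu⟩ := exists_hom_of_fiberwise F hF
    (fun f => ⟨W.ofFun f, W.ofFun_mem f, d f, hd f, fun x => (hF0 x f).trans (hev x _ _)⟩)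
    (fun i σ => ⟨a i σ, ha i σ, b i σ, hb i σ, fun x => (hF1 x i σ).trans (hev x _ _)⟩)
  have key : ∀ s p q, (∀ x, F x s = Fat.pack (B := W.fiberAlg x) (W.evAt x p) (W.evAt x q)) →
      Fat.part0 u s = p ∧ Fat.part1 u s = q := fun s p q h =>
    ⟨funAlg_ext fun x => (Fat.pack_inj ((hu x s).symm.trans (h x))).1,
    funAlg_ext fun x => (Fat.pack_inj ((hu x s).symm.trans (h x))).2⟩
  exact ⟨u, fun f => (key _ _ _ fun x => (hF0 x f).trans (hev x _ _)).1,
    fun f => (key _ _ _ fun x => (hF0 x f).trans (hev x _ _)).2,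
    fun i σ => (key _ _ _ fun x => (hF1 x i σ).trans (hev x _ _)).1,
    fun i σ => (key _ _ _ fun x => (hF1 x i σ).trans (hev x _ _)).2⟩

end GVB

/-! ### Dual bases, the element `∇σ` of arity `2`, and the universal morphism -/

namespace Mfd
variable {M : Mfd}

/-- The standard basis of the tangent space. -/
def stdVec (x : M) (a : Fin M.dim) : TangentSpace (𝓡 M.dim) x := EuclideanSpace.single a (1 : ℝ)

/-- The dual of the standard basis of the tangent space. -/
def stdCo (x : M) (a : Fin M.dim) : (VB.tangent M).dual.Fiber x := EuclideanSpace.proj a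

theorem sum_stdVec {x : M} (v : TangentSpace (𝓡 M.dim) x) :
    v = ∑ c, (stdCo x c v : ℝ) • stdVec x c := by
  have h1 := (EuclideanSpace.basisFun (Fin M.dim) ℝ).toBasis.sum_repr v
  simp only [EuclideanSpace.basisFun_toBasis, PiLp.basisFun_apply] at h1
  exact h1.symm

theorem sum_stdCo {x : M} (β : (VB.tangent M).dual.Fiber x) :
    β = ∑ c, (β (stdVec x c) : ℝ) • stdCo x c := by
  refine ContinuousLinearMap.ext fun v => ?_
  conv_lhs => rw [sum_stdVec (x := x) v]
  rw [map_sum, sum_apply]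
  refine Finset.sum_congr rfl fun c _ => ?_
  rw [map_smul]
  exact mul_comm (stdCo x c v : ℝ) (β (stdVec x c) : ℝ)

/-- In the standard basis, the duality of `α` and `w` says that their coefficient matrices satisfy
`D * Y = 1`. For square matrices this gives `Y * D = 1`, which is the expansion of covectors. -/
theorem eq_sum_of_dual {x : M} {α : Fin M.dim → (VB.tangent M).dual.Fiber x}
    {w : Fin M.dim → TangentSpace (𝓡 M.dim) x} (h : ∀ a b, α a (w b) = if a = b then (1 : ℝ) else 0)
    (β : (VB.tangent M).dual.Fiber x) : β = ∑ a, (β (w a) : ℝ) • α a := by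
  let D : Matrix (Fin M.dim) (Fin M.dim) ℝ := fun a c => α a (stdVec x c)
  let Y : Matrix (Fin M.dim) (Fin M.dim) ℝ := fun c a => stdCo x c (w a)
  have hw : ∀ (γ : (VB.tangent M).dual.Fiber x) a,
      (γ (w a) : ℝ) = ∑ c, (γ (stdVec x c) : ℝ) * Y c a := by
    intro γ a
    conv_lhs => rw [sum_stdVec (w a)]
    rw [map_sum]
    refine Finset.sum_congr rfl fun c _ => ?_
    rw [map_smul]
    exact mul_comm (Y c a) (γ (stdVec x c) : ℝ)
  have hYD : Y * D = 1 := mul_eq_one_comm.1 (by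
    ext a b
    rw [Matrix.mul_apply, Matrix.one_apply, ← h a b, hw])
  have h2 : ∀ c, (β (stdVec x c) : ℝ) = ∑ a, (β (w a) : ℝ) * D a c := by
    intro c
    have h3 : ∀ d, (β (stdVec x d) : ℝ) * (Y * D) d c =
        ∑ a, (β (stdVec x d) : ℝ) * Y d a * D a c := fun d => by
      rw [Matrix.mul_apply, Finset.mul_sum]
      exact Finset.sum_congr rfl fun a _ => (mul_assoc _ _ _).symm
    calc (β (stdVec x c) : ℝ) = ∑ d, (β (stdVec x d) : ℝ) * (Y * D) d c := by
          simp [hYD, Matrix.one_apply]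
      _ = ∑ a, (β (w a) : ℝ) * D a c := by
          rw [Finset.sum_congr rfl fun d _ => h3 d, Finset.sum_comm]
          refine Finset.sum_congr rfl fun a _ => ?_
          rw [hw β a, Finset.sum_mul]
  have h4 : ∀ a, α a = ∑ c, D a c • stdCo x c := fun a => sum_stdCo (α a)
  conv_lhs => rw [sum_stdCo β]
  rw [Finset.sum_congr rfl fun a _ => congrArg ((β (w a) : ℝ) • ·) (h4 a)]
  simp only [Finset.smul_sum, smul_smul]
  rw [Finset.sum_comm]
  refine Finset.sum_congr rfl fun c _ => ?_
  rw [h2 c, Finset.sum_smul]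

end Mfd

namespace GVB
variable {M : Mfd} (V : GVB M)

/-- A covector of `M` at `x`, as a covector of `V ⊕ T[1]M ⊕ V[1]`. -/
def covT (x : M) (α : (VB.tangent M).dual.Fiber x) : (V.tangentShift (-1)).dual.Fiber x :=
  α.comp ((VB.castL (inDegree_self (-1) (VB.tangent M)) x).comp
    ((VB.fstL _ _ x).comp (VB.sndL _ _ x)))

/-- A covector of `V i` at `x`, as a covector of `V ⊕ T[1]M ⊕ V[1]`. -/
def covV (i : ℤ) (x : M) (ξ : (V i).dual.Fiber x) : (V.tangentShift i).dual.Fiber x :=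
  ξ.comp (VB.fstL _ _ x)

theorem genT_add (x : M) (α β : (VB.tangent M).dual.Fiber x) :
    V.genT x (α + β) = V.genT x α + V.genT x β :=
  (GSym.ι (N := fun i => (V.tangentShift i).dual.Fiber x) (-1)).map_add (V.covT x α) (V.covT x β)

theorem genT_smul (x : M) (r : ℝ) (α : (VB.tangent M).dual.Fiber x) :
    V.genT x (r • α) = r • V.genT x α :=
  (GSym.ι (N := fun i => (V.tangentShift i).dual.Fiber x) (-1)).map_smul r (V.covT x α)

theorem genV_add (i : ℤ) (x : M) (ξ η : (V i).dual.Fiber x) :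
    V.genV i x (ξ + η) = V.genV i x ξ + V.genV i x η :=
  (GSym.ι (N := fun i => (V.tangentShift i).dual.Fiber x) i).map_add (V.covV i x ξ) (V.covV i x η)

theorem genV_smul (i : ℤ) (x : M) (r : ℝ) (ξ : (V i).dual.Fiber x) :
    V.genV i x (r • ξ) = r • V.genV i x ξ :=
  (GSym.ι (N := fun i => (V.tangentShift i).dual.Fiber x) i).map_smul r (V.covV i x ξ)

/-- The product of a `1`-form and a section, as a bilinear map at a point. -/
def genMul (i : ℤ) (x : M) : (VB.tangent M).dual.Fiber x →ₗ[ℝ] (V i).dual.Fiber x →ₗ[ℝ]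
    V.tangentShift.SymFiber x :=
  LinearMap.mk₂ ℝ (fun α ξ => V.genT x α * V.genV i x ξ)
    (fun α β ξ => by rw [genT_add, add_mul]) (fun r α ξ => by rw [genT_smul, smul_mul_assoc])
    (fun α ξ η => by rw [genV_add, mul_add]) (fun r α ξ => by rw [genV_smul, mul_smul_comm])

theorem genConn_def (i : ℤ) (x : M) (L : TangentSpace (𝓡 M.dim) x →L[ℝ] (V i).dual.Fiber x) :
    V.genConn i x L = ∑ a, V.genMul i x (Mfd.stdCo x a) (L (Mfd.stdVec x a)) := rfl

variable {V} in
/-- The image of an element of `T^*M ⊗ V^*` under the multiplication may be computed in dual bases. -/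
theorem genConn_eq {i : ℤ} {x : M} {α : Fin M.dim → (VB.tangent M).dual.Fiber x}
    {w : Fin M.dim → TangentSpace (𝓡 M.dim) x} (h : ∀ a b, α a (w b) = if a = b then (1 : ℝ) else 0)
    (L : TangentSpace (𝓡 M.dim) x →L[ℝ] (V i).dual.Fiber x) :
    V.genConn i x L = ∑ a, V.genMul i x (α a) (L (w a)) := by
  have h1 : ∀ c, V.genMul i x (Mfd.stdCo x c) (L (Mfd.stdVec x c)) =
      ∑ a, V.genMul i x (α a) (L ((Mfd.stdCo x c (w a) : ℝ) • Mfd.stdVec x c)) := by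
    intro c
    conv_lhs => rw [Mfd.eq_sum_of_dual h (Mfd.stdCo x c)]
    rw [map_sum, LinearMap.sum_apply]
    refine Finset.sum_congr rfl fun a _ => ?_
    rw [map_smul (V.genMul i x), map_smul L, map_smul (V.genMul i x _), LinearMap.smul_apply]
  rw [genConn_def, Finset.sum_congr rfl fun c _ => h1 c, Finset.sum_comm]
  refine Finset.sum_congr rfl fun a _ => ?_
  rw [← map_sum, ← map_sum, ← Mfd.sum_stdVec]

theorem genConn_add (i : ℤ) (x : M) (L L' : TangentSpace (𝓡 M.dim) x →L[ℝ] (V i).dual.Fiber x) :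
    V.genConn i x (L + L') = V.genConn i x L + V.genConn i x L' := by
  rw [genConn_def, genConn_def, genConn_def, ← Finset.sum_add_distrib]
  exact Finset.sum_congr rfl fun a _ => (V.genMul i x (Mfd.stdCo x a)).map_add _ _

theorem genConn_smul (i : ℤ) (x : M) (r : ℝ) (L : TangentSpace (𝓡 M.dim) x →L[ℝ] (V i).dual.Fiber x) :
    V.genConn i x (r • L) = r • V.genConn i x L := by
  rw [genConn_def, genConn_def, Finset.smul_sum]
  exact Finset.sum_congr rfl fun a _ => (V.genMul i x (Mfd.stdCo x a)).map_smul _ _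

theorem genConn_smulRight (i : ℤ) (x : M) (α : (VB.tangent M).dual.Fiber x)
    (ξ : (V i).dual.Fiber x) :
    V.genConn i x (ContinuousLinearMap.smulRight α ξ) = V.genMul i x α ξ := by
  conv_rhs => rw [Mfd.sum_stdCo α]
  rw [map_sum, LinearMap.sum_apply, genConn_def]
  refine Finset.sum_congr rfl fun a _ => ?_
  rw [map_smul (V.genMul i x), LinearMap.smul_apply]
  exact (V.genMul i x (Mfd.stdCo x a)).map_smul (α (Mfd.stdVec x a) : ℝ) ξ

theorem genT_mul_genV_mem (i : ℤ) (x : M) (α : (VB.tangent M).dual.Fiber x)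
    (ξ : (V i).dual.Fiber x) : V.genT x α * V.genV i x ξ ∈
      GSym.gr (fun i => (V.tangentShift i).dual.Fiber x) (-i + 1) := by
  have h := SetLike.GradedMul.mul_mem
    (GSym.ι_mem (N := fun i => (V.tangentShift i).dual.Fiber x) (-1) (V.covT x α))
    (GSym.ι_mem (N := fun i => (V.tangentShift i).dual.Fiber x) i (V.covV i x ξ))
  rwa [neg_neg, add_comm] at h

theorem genConn_mem (i : ℤ) (x : M) (L : TangentSpace (𝓡 M.dim) x →L[ℝ] (V i).dual.Fiber x) :
    V.genConn i x L ∈ GSym.gr (fun i => (V.tangentShift i).dual.Fiber x) (-i + 1) :=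
  Submodule.sum_mem _ fun _ _ => V.genT_mul_genV_mem i x _ _

/-- A `1`-form, as an element of arity `1`. -/
def algT : (VB.tangent M).dual.Sec →ₗ[ℝ] V.tangentShift.funAlg :=
  V.tangentShift.ofSecLin (-1) ∘ₗ V.secT

theorem algT_mem (α : (VB.tangent M).dual.Sec) : V.algT α ∈ V.tangentShift.funAlg.gr 1 :=
  V.tangentShift.ofSec_mem (-1) (V.secT α)

theorem algT_fsmul (f : M.Fun) (α : (VB.tangent M).dual.Sec) :
    V.algT (VB.fsmul f α) = V.tangentShift.ofFun f * V.algT α :=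
  V.tangentShift.ofSec_fsmul (-1) f (V.secT α)

theorem evAt_algT (α : (VB.tangent M).dual.Sec) (x : M) :
    V.tangentShift.evAt x (V.algT α) = V.genT x (α x) := rfl

/-- A section of `(V i)^*`, as an element of arity `1`. -/
def algV (i : ℤ) : (V i).dual.Sec →ₗ[ℝ] V.tangentShift.funAlg :=
  V.tangentShift.ofSecLin i ∘ₗ V.secV i

theorem algV_mem (i : ℤ) (σ : (V i).dual.Sec) : V.algV i σ ∈ V.tangentShift.funAlg.gr (-i) :=
  V.tangentShift.ofSec_mem i (V.secV i σ)

theorem algV_fsmul (i : ℤ) (f : M.Fun) (σ : (V i).dual.Sec) :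
    V.algV i (VB.fsmul f σ) = V.tangentShift.ofFun f * V.algV i σ :=
  V.tangentShift.ofSec_fsmul i f (V.secV i σ)

variable {V} in
-- In coordinates `∇σ = ∑ dh_a ∇_{X_a} σ` near `x`. This proves that `∇σ` is smooth, and it
-- expresses its germ through differentials and sections of `V^*`, on which morphisms are known.
theorem genConn_eventuallyEq {i : ℤ} (D : (V i).dual.Conn) {x : M} {h : Fin M.dim → M.Fun}
    {X : Fin M.dim → (VB.tangent M).Sec}
    (hX : ∀ᶠ z in 𝓝 x, ∀ a b, VB.pair (Mfd.dFun (h a)) (X b) z = if a = b then 1 else 0)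
    (σ : (V i).dual.Sec) : ∀ᶠ z in 𝓝 x, V.genConn i z (D.cov σ z) = V.tangentShift.evAt z
      (∑ a, V.algT (Mfd.dFun (h a)) * V.algV i (D.along (X a) σ)) := by
  filter_upwards [hX] with z hz
  rw [genConn_eq (α := fun a => Mfd.dFun (h a) z) (w := fun a => X a z) hz, map_sum]
  refine Finset.sum_congr rfl fun a _ => ?_
  rw [map_mul]
  rfl

/-- The section `∇σ` of `T^*M ⊗ V^*`, as an element of arity `2`. -/
def connAlg {i : ℤ} (D : (V i).dual.Conn) (σ : (V i).dual.Sec) : V.tangentShift.funAlg :=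
  GVB.mk (d := -i + 1) (fun x => V.genConn i x (D.cov σ x))
    (V.tangentShift.mem_homSec_of_local (fun x => V.genConn_mem i x _) fun x => by
      obtain ⟨h, X, hX, -⟩ := Mfd.exists_coordinates x
      exact ⟨_, genConn_eventuallyEq D hX σ⟩)

theorem evAt_connAlg {i : ℤ} (D : (V i).dual.Conn) (σ : (V i).dual.Sec) (x : M) :
    V.tangentShift.evAt x (V.connAlg D σ) = V.genConn i x (D.cov σ x) := rfl

theorem connAlg_mem {i : ℤ} (D : (V i).dual.Conn) (σ : (V i).dual.Sec) :
    V.connAlg D σ ∈ V.tangentShift.funAlg.gr (-i + 1) := mk_mem _ _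

theorem connAlg_add {i : ℤ} (D : (V i).dual.Conn) (σ τ : (V i).dual.Sec) :
    V.connAlg D (σ + τ) = V.connAlg D σ + V.connAlg D τ := funAlg_ext fun x => by
  rw [map_add, evAt_connAlg, evAt_connAlg, evAt_connAlg, D.cov_add, genConn_add]

theorem connAlg_smul {i : ℤ} (D : (V i).dual.Conn) (r : ℝ) (σ : (V i).dual.Sec) :
    V.connAlg D (r • σ) = r • V.connAlg D σ := funAlg_ext fun x => by
  rw [map_smul, evAt_connAlg, evAt_connAlg, D.cov_smul, genConn_smul]

/-- The Leibniz term `df σ` is the cross term in `(f + ε df)(σ + ε dσ)`. Since `σ[1]` is linear over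
functions, adding `∇σ` makes the universal formula compatible with multiplication by functions. -/
theorem connAlg_fsmul {i : ℤ} (D : (V i).dual.Conn) (f : M.Fun) (σ : (V i).dual.Sec) :
    V.connAlg D (VB.fsmul f σ) = V.tangentShift.ofFun f * V.connAlg D σ +
      V.algT (Mfd.dFun f) * V.algV i σ :=
  funAlg_ext fun x => by
    rw [map_add, map_mul, map_mul, evAt_connAlg, evAt_connAlg, D.cov_fsmul, genConn_add,
      genConn_smul, evAt_ofFun, ← Algebra.smul_def]
    exact congrArg _ (V.genConn_smulRight i x (Mfd.dFun f x) (σ x))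

theorem shift_index (i : ℤ) : V (1 + (i - 1)) = V i := congrArg V (by ring)

/-- A section of `(V i)^*`, as a section of `V[1]^*`. -/
def shiftAlg (i : ℤ) : (V i).dual.Sec →ₗ[ℝ] V.tangentShift.funAlg :=
  V.tangentShift.ofSecLin (i - 1) ∘ₗ V.secShift (i - 1) ∘ₗ VB.castDual (V.shift_index i)

/-- The cast along `1 + (i - 1) = i` is harmless; replacing the index by a variable `k` with `k = j`
lets it be eliminated. -/
theorem shiftAlg_eq (j : ℤ) (σ : (V (1 + j)).dual.Sec) :
    V.shiftAlg (1 + j) σ = V.tangentShift.ofSec j (V.secShift j σ) := by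
  have key : ∀ (k : ℤ) (hk : k = j) (h : V (1 + k) = V (1 + j)),
      V.tangentShift.ofSec k (V.secShift k (VB.castDual h σ)) =
        V.tangentShift.ofSec j (V.secShift j σ) := by
    rintro k rfl h
    rfl
  exact key (1 + j - 1) (by ring) _

theorem shiftAlg_mem (i : ℤ) (σ : (V i).dual.Sec) :
    V.shiftAlg i σ ∈ V.tangentShift.funAlg.gr (-i + 1) := by
  have h := V.tangentShift.ofSec_mem (i - 1) (V.secShift (i - 1) (VB.castDual (V.shift_index i) σ))
  rwa [neg_sub, sub_eq_neg_add] at h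

theorem shiftAlg_fsmul (i : ℤ) (f : M.Fun) (σ : (V i).dual.Sec) :
    V.shiftAlg i (VB.fsmul f σ) = V.tangentShift.ofFun f * V.shiftAlg i σ :=
  V.tangentShift.ofSec_fsmul (i - 1) f (V.secShift (i - 1) (VB.castDual (V.shift_index i) σ))

/-- The universal morphism. -/
theorem exists_univ (nabla : ∀ i, (V i).dual.Conn) :
    ∃ u : V.funAlg ⟶ fatPoint.alg.tensor V.tangentShift.funAlg,
      (∀ f, Fat.part0 u (V.ofFun f) = V.tangentShift.ofFun f) ∧
      (∀ f, Fat.part1 u (V.ofFun f) = V.algT (Mfd.dFun f)) ∧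
      (∀ i σ, Fat.part0 u (V.ofSec i σ) = V.algV i σ) ∧
      ∀ i σ, Fat.part1 u (V.ofSec i σ) = V.shiftAlg i σ + V.connAlg (nabla i) σ := by
  refine exists_hom_tensor (fun i => V.algV i) (fun i σ => V.shiftAlg i σ + V.connAlg (nabla i) σ)
    (fun f => V.algT (Mfd.dFun f)) (fun f => V.algT_mem _) (fun f g => ?_) (fun r => ?_)
    (fun f g => ?_) (fun f x hf => ?_) V.algV_mem (fun i => map_add _) (fun i => map_smul _)
    V.algV_fsmul (fun i σ => add_mem (V.shiftAlg_mem i σ) (V.connAlg_mem (nabla i) σ))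
    (fun i σ τ => ?_) (fun i r σ => ?_) (fun i f σ => ?_)
  · rw [Mfd.dFun_add, map_add]
  · rw [Mfd.dFun_const, map_zero]
  · rw [Mfd.dFun_mul, map_add, add_comm, algT_fsmul, algT_fsmul]
  · rw [evAt_algT, Mfd.dFun_apply_of_eventually hf]
    have h := V.genT_smul x 0 0
    rwa [zero_smul, zero_smul] at h
  · rw [map_add, connAlg_add]
    abel
  · rw [map_smul, connAlg_smul, smul_add]
  · rw [shiftAlg_fsmul, connAlg_fsmul, mul_add]
    abel

end GVB

/-! ### Morphisms out of the functions on the shifted tangent bundle -/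

/-- A derivation of the smooth functions along a homomorphism to a graded symmetric algebra vanishes
if it vanishes on coordinates. -/
theorem Mfd.derivation_eq_zero {M : Mfd} {N : ℤ → Type} [∀ i, AddCommGroup (N i)]
    [∀ i, Module ℝ (N i)] {x : M} {φ : M.Fun →ₐ[ℝ] GSym N} {D : M.Fun →ₗ[ℝ] GSym N}
    (hφ : ∀ f, GSym.aug (φ f) = f x) (hD : ∀ f g, D (f * g) = D f * φ g + φ f * D g)
    (hloc : ∀ f : M.Fun, (∀ᶠ z in 𝓝 x, f z = 0) → D f = 0) {h : Fin M.dim → M.Fun}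
    (hh : ∀ f : M.Fun, ∃ k : Fin M.dim → M.Fun,
      ∀ᶠ z in 𝓝 x, f z = f x + ∑ a, (h a z - h a x) * k a z)
    (hDh : ∀ a, D (h a) = 0) (f : M.Fun) : D f = 0 := by
  have hconst : ∀ r : ℝ, D (algebraMap ℝ M.Fun r) = 0 := fun r => by
    have h1 : D 1 = 0 := by
      have h2 := hD 1 1
      rwa [mul_one, map_one φ, mul_one, one_mul, left_eq_add] at h2
    rw [Algebra.algebraMap_eq_smul_one, map_smul, h1, smul_zero]
  -- The induction is for all `f` at once, because Hadamard's lemma trades `f` for its coefficient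
  -- functions: `D f = ∑ φ(h a - h a x) D(c a)`. The first factors have augmentation `0`, so each
  -- pass gains one power of `X`.
  have key : ∀ (k : ℕ) (f : M.Fun), Polynomial.X ^ k ∣ GSym.arity (D f) := by
    intro k
    induction k with
    | zero => exact fun f => by rw [pow_zero]; exact one_dvd _
    | succ k ih =>
      intro f
      obtain ⟨c, hc⟩ := hh f
      let f' : M.Fun := algebraMap ℝ M.Fun (f x) + ∑ a, (h a - algebraMap ℝ M.Fun (h a x)) * c a
      have hf' : D (f - f') = 0 := hloc _ (by
        filter_upwards [hc] with z hz
        have h1 : f' z = f x + ∑ a, (h a z - h a x) * c a z := by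
          have h2 := map_sum (ContMDiffMap.evalRingHom (I := 𝓡 M.dim) (I' := 𝓘(ℝ, ℝ)) (R := ℝ) (n := ∞) z)
            (fun a => (h a - algebraMap ℝ M.Fun (h a x)) * c a) Finset.univ
          exact congrArg (f x + ·) h2
        exact (congrArg₂ (· - ·) hz h1).trans (sub_self _))
      rw [map_sub, sub_eq_zero] at hf'
      rw [hf', map_add, hconst, zero_add, map_sum, map_sum]
      refine Finset.dvd_sum fun a _ => ?_
      rw [hD, map_sub, hDh, hconst, sub_zero, zero_mul, zero_add]
      refine GSym.X_pow_succ_dvd_arity_mul ?_ (ih (c a))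
      rw [hφ]
      exact sub_self (h a x)
  exact GSym.eq_zero_of_forall_dvd fun k => key k f

namespace VB
variable {M : Mfd} {E : VB M}

theorem pair_add (α β : E.dual.Sec) (v : E.Sec) : pair (α + β) v = pair α v + pair β v := rfl

theorem pair_smul (r : ℝ) (α : E.dual.Sec) (v : E.Sec) : pair (r • α) v = r • pair α v := rfl

theorem pair_fsmul (f : M.Fun) (α : E.dual.Sec) (v : E.Sec) :
    pair (fsmul f α) v = f * pair α v := rfl

theorem Conn.along_add (D : E.Conn) (X : (VB.tangent M).Sec) (σ τ : E.Sec) :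
    D.along X (σ + τ) = D.along X σ + D.along X τ :=
  ContMDiffSection.ext fun x => congrArg (fun L => L (X x)) (D.cov_add σ τ x)

theorem Conn.along_smul (D : E.Conn) (X : (VB.tangent M).Sec) (r : ℝ) (σ : E.Sec) :
    D.along X (r • σ) = r • D.along X σ :=
  ContMDiffSection.ext fun x => congrArg (fun L => L (X x)) (D.cov_smul r σ x)

theorem Conn.along_fsmul (D : E.Conn) (X : (VB.tangent M).Sec) (f : M.Fun) (σ : E.Sec) :
    D.along X (fsmul f σ) = fsmul f (D.along X σ) + fsmul (pair (Mfd.dFun f) X) σ :=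
  ContMDiffSection.ext fun x => congrArg (fun L => L (X x)) (D.cov_fsmul f σ x)

end VB

namespace GVB
variable {M : Mfd} (V : GVB M)

/-- This is the universal property at one point. On functions and on `V^*` the homomorphism is `φ`,
on `1`-forms it is `Q`, and on `V[1]` it is `S0`. All are linear over functions along `φ`, so the
extension lemma applies. Coordinates at `x` enter the construction, while the resulting equations do
not mention them. -/
theorem exists_fiberHom (nabla : ∀ i, (V i).dual.Conn) {N : ℤ → Type} [∀ i, AddCommGroup (N i)]
    [∀ i, Module ℝ (N i)] {x : M} (φ : V.funAlg →ₐ[ℝ] GSym N) (δ : V.funAlg →ₗ[ℝ] GSym N)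
    (hφx : ∀ f, GSym.aug (φ (V.ofFun f)) = f x)
    (hφl : IsLocalAt x φ.toLinearMap) (hδl : IsLocalAt x δ)
    (hφm : ∀ d s, s ∈ V.funAlg.gr d → φ s ∈ GSym.gr N d)
    (hδm : ∀ d s, s ∈ V.funAlg.gr d → δ s ∈ GSym.gr N (d + 1))
    (hδ : ∀ f s, δ (V.ofFun f * s) = δ (V.ofFun f) * φ s + φ (V.ofFun f) * δ s) :
    ∃ F : V.tangentShift.funAlg →ₐ[ℝ] GSym N, IsLocalAt x F.toLinearMap ∧
      (∀ f, F (V.tangentShift.ofFun f) = φ (V.ofFun f)) ∧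
      (∀ i σ, F (V.algV i σ) = φ (V.ofSec i σ)) ∧
      (∀ f, F (V.algT (Mfd.dFun f)) = δ (V.ofFun f)) ∧
      ∀ i σ, F (V.shiftAlg i σ + V.connAlg (nabla i) σ) = δ (V.ofSec i σ) := by
  obtain ⟨h, X, hX, hh⟩ := M.exists_coordinates x
  let φ0 : M.Fun →ₐ[ℝ] GSym N := φ.comp V.ofFunHom
  let δ0 : M.Fun →ₗ[ℝ] GSym N := δ ∘ₗ V.ofFunHom.toLinearMap
  have hφ0 : ∀ f, φ0 f ∈ GSym.gr N 0 := fun f => hφm 0 _ (V.ofFun_mem f)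
  have hφc : ∀ f z, Commute (φ0 f) z := fun f z => GSym.commute_of_mem_zero (hφ0 f) z
  have hφ0l : ∀ f : M.Fun, (∀ᶠ z in 𝓝 x, f z = 0) → φ0 f = 0 := fun f hf => hφl _ (by
    filter_upwards [hf] with z hz
    refine (V.evAt_ofFunHom f z).trans ?_
    rw [hz, map_zero])
  have hδ0l : ∀ f : M.Fun, (∀ᶠ z in 𝓝 x, f z = 0) → δ0 f = 0 := fun f hf => hδl _ (by
    filter_upwards [hf] with z hz
    refine (V.evAt_ofFunHom f z).trans ?_
    rw [hz, map_zero])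
  have hδ0m : ∀ f, δ0 f ∈ GSym.gr N 1 := fun f => hδm 0 _ (V.ofFun_mem f)
  have hδ0 : ∀ f g, δ0 (f * g) = δ0 f * φ0 g + φ0 f * δ0 g := fun f g =>
    (congrArg δ (map_mul V.ofFunHom f g)).trans (hδ f (V.ofFun g))
  -- Near `x` one has `α = ∑ α(X a) dh_a`, and `dh_a` must go to `δ (h a)`.
  let Q : (VB.tangent M).dual.Sec →ₗ[ℝ] GSym N :=
    { toFun := fun α => ∑ a, φ0 (VB.pair α (X a)) * δ0 (h a)
      map_add' := fun α β => by
        rw [← Finset.sum_add_distrib]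
        exact Finset.sum_congr rfl fun a _ => by rw [VB.pair_add, map_add, add_mul]
      map_smul' := fun r α => by
        rw [RingHom.id_apply, Finset.smul_sum]
        exact Finset.sum_congr rfl fun a _ => by rw [VB.pair_smul, map_smul, smul_mul_assoc] }
  have hQa : ∀ α, Q α = ∑ a, φ0 (VB.pair α (X a)) * δ0 (h a) := fun _ => rfl
  have hQf : ∀ f α, Q (VB.fsmul f α) = φ0 f * Q α := fun f α => by
    rw [hQa, hQa, Finset.mul_sum]
    exact Finset.sum_congr rfl fun a _ => by rw [VB.pair_fsmul, map_mul, mul_assoc]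
  have hD : ∀ f, Q (Mfd.dFun f) = δ0 f := by
    let dF : M.Fun →ₗ[ℝ] (VB.tangent M).dual.Sec :=
      { toFun := Mfd.dFun
        map_add' := Mfd.dFun_add
        map_smul' := fun r f => by
          have h1 := Mfd.dFun_mul (algebraMap ℝ M.Fun r) f
          rw [Mfd.dFun_const, ← Algebra.smul_def] at h1
          refine h1.trans (ContMDiffSection.ext fun z => ?_)
          exact (congrArg (r • Mfd.dFun f z + ·) (smul_zero (f z))).trans (add_zero _) }
    -- The difference is a local derivation along `φ0`, and it vanishes on the coordinates because
    -- `dh_a(X b)` is the Kronecker delta near `x`.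
    have h1 : ∀ f, (δ0 - Q ∘ₗ dF) f = 0 := by
      refine Mfd.derivation_eq_zero (φ := φ0) hφx (fun f g => ?_) (fun f hf => ?_) hh (fun a => ?_)
      · change δ0 (f * g) - Q (Mfd.dFun (f * g)) =
          (δ0 f - Q (Mfd.dFun f)) * φ0 g + φ0 f * (δ0 g - Q (Mfd.dFun g))
        rw [hδ0, Mfd.dFun_mul, map_add, hQf, hQf, (hφc g (Q (Mfd.dFun f))).eq, sub_mul, mul_sub]
        abel
      · change δ0 f - Q (Mfd.dFun f) = 0
        rw [hδ0l f hf, zero_sub, neg_eq_zero, hQa]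
        refine Finset.sum_eq_zero fun a _ => ?_
        rw [hφ0l, zero_mul]
        filter_upwards [eventually_eventually_nhds.2 hf] with z hz
        rw [VB.pair_apply, Mfd.dFun_apply_of_eventually hz]
        rfl
      · change δ0 (h a) - Q (Mfd.dFun (h a)) = 0
        have h2 : ∀ b, φ0 (VB.pair (Mfd.dFun (h a)) (X b)) = if a = b then 1 else 0 := fun b => by
          have h3 : φ0 (VB.pair (Mfd.dFun (h a)) (X b) - algebraMap ℝ M.Fun (if a = b then 1 else 0)) =
              0 := hφ0l _ (by
            filter_upwards [hX] with z hz
            exact (congrArg (· - (if a = b then (1 : ℝ) else 0)) (hz a b)).trans (sub_self _))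
          rw [map_sub, sub_eq_zero, AlgHom.commutes] at h3
          rw [h3]
          split_ifs
          · exact map_one _
          · exact map_zero _
        rw [hQa, Finset.sum_congr rfl fun b _ => congrArg (· * δ0 (h b)) (h2 b)]
        simp
    intro f
    exact (sub_eq_zero.1 (h1 f)).symm
  have hφs : ∀ i f σ, φ (V.ofSec i (VB.fsmul f σ)) = φ0 f * φ (V.ofSec i σ) := fun i f σ => by
    rw [ofSec_fsmul, map_mul]
    rfl
  -- The value on `σ[1]` is forced: it is `δσ` minus the image of `∇σ = ∑ dh_a ∇_{X_a} σ`.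
  let S0 : ∀ i, (V i).dual.Sec →ₗ[ℝ] GSym N := fun i =>
    { toFun := fun τ => δ (V.ofSecLin i τ) -
        ∑ a, δ0 (h a) * φ (V.ofSecLin i ((nabla i).along (X a) τ))
      map_add' := fun σ τ => by
        simp only [VB.Conn.along_add, map_add, mul_add, Finset.sum_add_distrib]
        abel
      map_smul' := fun r τ => by
        simp only [VB.Conn.along_smul, map_smul, mul_smul_comm, ← Finset.smul_sum, smul_sub,
          RingHom.id_apply] }
  have hS0a : ∀ i τ, S0 i τ = δ (V.ofSec i τ) -
      ∑ a, δ0 (h a) * φ (V.ofSec i ((nabla i).along (X a) τ)) := fun _ _ => rfl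
  have hS0f : ∀ i f τ, S0 i (VB.fsmul f τ) = φ0 f * S0 i τ := fun i f τ => by
    have e1 : ∀ a, δ0 (h a) * φ (V.ofSec i ((nabla i).along (X a) (VB.fsmul f τ))) =
        φ0 f * (δ0 (h a) * φ (V.ofSec i ((nabla i).along (X a) τ))) +
          φ0 (VB.pair (Mfd.dFun f) (X a)) * δ0 (h a) * φ (V.ofSec i τ) := fun a => by
      have e2 : V.ofSec i ((nabla i).along (X a) (VB.fsmul f τ)) =
          V.ofSec i (VB.fsmul f ((nabla i).along (X a) τ)) +
            V.ofSec i (VB.fsmul (VB.pair (Mfd.dFun f) (X a)) τ) := by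
        rw [VB.Conn.along_fsmul]
        exact (V.ofSecLin i).map_add _ _
      rw [e2, map_add, hφs, hφs, mul_add, ← mul_assoc, ← mul_assoc, ← (hφc f (δ0 (h a))).eq,
        ← (hφc (VB.pair (Mfd.dFun f) (X a)) (δ0 (h a))).eq, mul_assoc]
    -- The derivative terms of the connection add up to `Q(df) φ(τ) = δ(f) φ(τ)`, which cancels the
    -- Leibniz term of `δ(f τ)`.
    rw [hS0a, hS0a, Finset.sum_congr rfl fun a _ => e1 a, Finset.sum_add_distrib, ← Finset.mul_sum,
      ← Finset.sum_mul, ← hQa, hD, ofSec_fsmul, hδ, mul_sub]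
    change δ0 f * _ + φ0 f * _ - _ = _
    abel
  have hS0m : ∀ i τ, S0 i τ ∈ GSym.gr N (-i + 1) := fun i τ => by
    refine sub_mem (hδm _ _ (V.ofSec_mem i τ)) (Submodule.sum_mem _ fun a _ => ?_)
    rw [add_comm]
    exact SetLike.GradedMul.mul_mem (hδ0m (h a)) (hφm _ _ (V.ofSec_mem i _))
  obtain ⟨F, hF, F0, FV, FT, FS⟩ := V.exists_algHom_tangentShift (GSym.gr N)
    (fun d e a ha b hb => GSym.graded_comm d e a b ha hb) x φ0 hφ0l hφ0
    (fun i => φ.toLinearMap ∘ₗ V.ofSecLin i) hφs (fun i σ => hφm _ _ (V.ofSec_mem i σ))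
    Q hQf (fun α => by
      rw [hQa]
      refine Submodule.sum_mem _ fun a _ => ?_
      have h1 := SetLike.GradedMul.mul_mem (hφ0 (VB.pair α (X a))) (hδ0m (h a))
      rwa [zero_add] at h1)
    (fun i => S0 (1 + i)) (fun i => hS0f (1 + i)) (fun i σ => by
      have h1 := hS0m (1 + i) σ
      rwa [show -(1 + i) + 1 = -i by ring] at h1)
  have FT' : ∀ f, F (V.algT (Mfd.dFun f)) = δ (V.ofFun f) := fun f => (FT _).trans (hD f)
  refine ⟨F, hF, F0, FV, FT', fun i σ => ?_⟩
  obtain ⟨j, rfl⟩ : ∃ j, i = 1 + j := ⟨i - 1, by ring⟩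
  have e1 : F (V.connAlg (nabla (1 + j)) σ) =
      ∑ a, δ0 (h a) * φ (V.ofSec (1 + j) ((nabla (1 + j)).along (X a) σ)) := by
    -- Locality of `F` allows `∇σ` to be replaced by its coordinate expression near `x`.
    have e2 : F (V.connAlg (nabla (1 + j)) σ) =
        F (∑ a, V.algT (Mfd.dFun (h a)) * V.algV (1 + j) ((nabla (1 + j)).along (X a) σ)) :=
      hF.congr (genConn_eventuallyEq (nabla (1 + j)) hX σ)
    rw [e2, map_sum]
    refine Finset.sum_congr rfl fun a _ => ?_
    rw [map_mul, FT']
    exact congrArg (δ0 (h a) * ·) (FV _ _)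
  rw [map_add, e1, shiftAlg_eq, FS]
  exact sub_add_cancel _ _

end GVB

/-! ### The factorization through `V ⊕ T[1]M ⊕ V[1]` and its uniqueness -/

namespace GVB
variable {M N : Mfd} {V : GVB M} {W : GVB N}

/-- The coordinate expansion of a `1`-form gives its germ in terms of functions and differentials,
the elements on which a morphism is prescribed. -/
theorem algT_eventuallyEq {x : M} {h : Fin M.dim → M.Fun} {X : Fin M.dim → (VB.tangent M).Sec}
    (hX : ∀ᶠ z in 𝓝 x, ∀ a b, VB.pair (Mfd.dFun (h a)) (X b) z = if a = b then 1 else 0)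
    (α : (VB.tangent M).dual.Sec) : ∀ᶠ z in 𝓝 x, V.tangentShift.evAt z (V.algT α) =
      V.tangentShift.evAt z
        (∑ a, V.tangentShift.ofFun (VB.pair α (X a)) * V.algT (Mfd.dFun (h a))) := by
  filter_upwards [hX] with z hz
  let T : (VB.tangent M).dual.Fiber z →ₗ[ℝ] V.tangentShift.SymFiber z :=
    ⟨⟨V.genT z, V.genT_add z⟩, V.genT_smul z⟩
  have h1 : ∀ β, V.tangentShift.evAt z (V.algT β) = T (β z) := fun _ => rfl
  rw [map_sum, h1, Mfd.eq_sum_of_dual (α := fun a => Mfd.dFun (h a) z) (w := fun a => X a z) hz (α z),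
    map_sum]
  refine Finset.sum_congr rfl fun a _ => ?_
  rw [map_mul, evAt_ofFun, ← Algebra.smul_def, h1, map_smul]
  rfl

theorem part0_mul_part1_mem (v : V.funAlg ⟶ fatPoint.alg.tensor W.funAlg) (f h : M.Fun) :
    Fat.part0 v (V.ofFun f) * Fat.part1 v (V.ofFun h) ∈ W.funAlg.gr (-(-1)) := by
  have h3 := SetLike.GradedMul.mul_mem (Fat.part0_mem v (V.ofFun_mem f))
    (Fat.part1_mem v (V.ofFun_mem h))
  rwa [show 0 + (0 + 1) = -(-1 : ℤ) by norm_num] at h3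

theorem part1_mul_part0_mem (v : V.funAlg ⟶ fatPoint.alg.tensor W.funAlg) (h : M.Fun) {j : ℤ}
    (σ : (V (1 + j)).dual.Sec) :
    Fat.part1 v (V.ofFun h) * Fat.part0 v (V.ofSec (1 + j) σ) ∈ W.funAlg.gr (-j) := by
  have h3 := SetLike.GradedMul.mul_mem (Fat.part1_mem v (V.ofFun_mem h))
    (Fat.part0_mem v (V.ofSec_mem (1 + j) σ))
  rwa [show 0 + 1 + -(1 + j) = -j by ring] at h3

/-- The coefficients of a morphism to the tensor product with the functions on the fat point factor
through the functions on the shifted tangent bundle. -/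
theorem exists_lift (nabla : ∀ i, (V i).dual.Conn) (v : V.funAlg ⟶ fatPoint.alg.tensor W.funAlg) :
    ∃ ψ : V.tangentShift.funAlg ⟶ W.funAlg,
      (∀ f, GrAlg.toAlgHom ψ (V.tangentShift.ofFun f) = Fat.part0 v (V.ofFun f)) ∧
      (∀ f, GrAlg.toAlgHom ψ (V.algT (Mfd.dFun f)) = Fat.part1 v (V.ofFun f)) ∧
      (∀ i σ, GrAlg.toAlgHom ψ (V.algV i σ) = Fat.part0 v (V.ofSec i σ)) ∧
      ∀ i σ, GrAlg.toAlgHom ψ (V.shiftAlg i σ + V.connAlg (nabla i) σ) =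
        Fat.part1 v (V.ofSec i σ) := by
  obtain ⟨g, hg, hgf⟩ := exists_body (Fat.part0 v)
  have hδ : ∀ f s, Fat.part1 v (V.ofFun f * s) =
      Fat.part1 v (V.ofFun f) * Fat.part0 v s + Fat.part0 v (V.ofFun f) * Fat.part1 v s :=
    fun f s => by rw [Fat.part1_mul v (V.ofFun_mem f), uzpow_zero, one_smul]
  have hex := fun y => V.exists_fiberHom nabla ((W.evAt y).comp (Fat.part0 v))
    ((W.evAt y).toLinearMap ∘ₗ Fat.part1 v) (hgf y) (isLocalAt_of_aug (hgf y))
    (isLocalAt_derivation (hgf y) _ hδ) (fun d s hs => W.evAt_mem_gr (Fat.part0_mem v hs) y)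
    (fun d s hs => W.evAt_mem_gr (Fat.part1_mem v hs) y)
    (fun f s => (congrArg (W.evAt y) (hδ f s)).trans (by rw [map_add, map_mul, map_mul]; rfl))
  choose F hF F0 FV FT FS using hex
  have hev : ∀ y (s t : V.tangentShift.funAlg),
      (∀ᶠ x in 𝓝 (g y), V.tangentShift.evAt x s = V.tangentShift.evAt x t) →
      ∀ᶠ z in 𝓝 y, F z s = F z t := fun y s t h => by
    filter_upwards [hg.continuousAt.eventually (eventually_eventually_nhds.2 h)] with z hz
    exact (hF z).congr hz
  have h1 : ∀ i (τ : (V.tangentShift i).dual.Sec), ∀ y, ∃ a ∈ W.funAlg.gr (-i),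
      ∀ᶠ z in 𝓝 y, F z (V.tangentShift.ofSec i τ) = W.evAt z a := by
    intro i τ
    refine V.sec_induction (P := fun i τ => ∀ y, ∃ a ∈ W.funAlg.gr (-i),
      ∀ᶠ z in 𝓝 y, F z (V.tangentShift.ofSec i τ) = W.evAt z a) (fun i σ y => ?_) (fun α y => ?_)
      (fun j σ y => ?_) (fun i σ τ hσ hτ y => ?_) i τ
    · exact ⟨_, Fat.part0_mem v (V.ofSec_mem i σ), Filter.Eventually.of_forall fun z => FV z i σ⟩
    -- The coordinates used to build `F z` were chosen separately for each `z`, with no regularity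
    -- in `z`. Here coordinates are fixed at `g y`: their formulas remain valid at `g z` for `z`
    -- near `y`, and `F z` is known on functions and differentials, so its value varies smoothly.
    · obtain ⟨h, X, hX, -⟩ := M.exists_coordinates (g y)
      refine ⟨∑ a, Fat.part0 v (V.ofFun (VB.pair α (X a))) * Fat.part1 v (V.ofFun (h a)),
        Submodule.sum_mem _ fun a _ => part0_mul_part1_mem v _ _, ?_⟩
      have h2 := hev y (V.algT α)
        (∑ a, V.tangentShift.ofFun (VB.pair α (X a)) * V.algT (Mfd.dFun (h a)))
        (algT_eventuallyEq hX α)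
      filter_upwards [h2] with z hz
      refine hz.trans ?_
      rw [map_sum, map_sum]
      refine Finset.sum_congr rfl fun a _ => ?_
      rw [map_mul, map_mul, F0, FT]
      rfl
    · obtain ⟨h, X, hX, -⟩ := M.exists_coordinates (g y)
      refine ⟨Fat.part1 v (V.ofSec (1 + j) σ) - ∑ a, Fat.part1 v (V.ofFun (h a)) *
        Fat.part0 v (V.ofSec (1 + j) ((nabla (1 + j)).along (X a) σ)), ?_, ?_⟩
      · refine sub_mem ?_ (Submodule.sum_mem _ fun a _ => ?_)
        · have h3 := Fat.part1_mem v (V.ofSec_mem (1 + j) σ)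
          rwa [show -(1 + j) + 1 = -j by ring] at h3
        · exact part1_mul_part0_mem v _ _
      · have h2 := hev y (V.connAlg (nabla (1 + j)) σ) _ (genConn_eventuallyEq (nabla (1 + j)) hX σ)
        filter_upwards [h2] with z hz
        have h3 := FS z (1 + j) σ
        rw [map_add, shiftAlg_eq, ← eq_sub_iff_add_eq] at h3
        refine h3.trans ?_
        rw [hz, map_sub, map_sum, map_sum]
        refine congrArg₂ _ rfl (Finset.sum_congr rfl fun a _ => ?_)
        rw [map_mul, map_mul, FT, FV]
        rfl
    · obtain ⟨a, ha, ha'⟩ := hσ y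
      obtain ⟨b, hb, hb'⟩ := hτ y
      refine ⟨a + b, add_mem ha hb, ?_⟩
      filter_upwards [ha', hb'] with z h3 h4
      rw [map_add, ← h3, ← h4, ← map_add]
      exact congrArg (F z) ((V.tangentShift.ofSecLin i).map_add σ τ)
  obtain ⟨ψ, hψ, hψ'⟩ := exists_algHom_of_fiberwise hg F hF
    (fun f y => ⟨_, Fat.part0_mem v (V.ofFun_mem f), Filter.Eventually.of_forall fun z => F0 z f⟩) h1
  exact ⟨GrAlg.ofAlgHom ψ hψ', fun f => funAlg_ext fun y => (hψ y _).trans (F0 y f),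
    fun f => funAlg_ext fun y => (hψ y _).trans (FT y f),
    fun i σ => funAlg_ext fun y => (hψ y _).trans (FV y i σ),
    fun i σ => funAlg_ext fun y => (hψ y _).trans (FS y i σ)⟩

/-- A morphism to the tensor product with the functions on the fat point is determined by its values
on functions and sections. -/
theorem hom_tensor_ext {u v : V.funAlg ⟶ fatPoint.alg.tensor W.funAlg}
    (h0 : ∀ f, Fat.part0 u (V.ofFun f) = Fat.part0 v (V.ofFun f))
    (h1 : ∀ f, Fat.part1 u (V.ofFun f) = Fat.part1 v (V.ofFun f))
    (h2 : ∀ i σ, Fat.part0 u (V.ofSec i σ) = Fat.part0 v (V.ofSec i σ))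
    (h3 : ∀ i σ, Fat.part1 u (V.ofSec i σ) = Fat.part1 v (V.ofSec i σ)) : u = v := by
  have hpoly : ∀ p ∈ V.polyAlg, GrAlg.toAlgHom u p = GrAlg.toAlgHom v p := fun p hp => by
    refine poly_induction (P := fun p => GrAlg.toAlgHom u p = GrAlg.toAlgHom v p) (fun f => ?_)
      (fun i σ => ?_) (fun s t hs ht => ?_) (fun s t hs ht => ?_) hp
    · rw [Fat.apply_eq, Fat.apply_eq, h0, h1]
    · rw [Fat.apply_eq, Fat.apply_eq, h2, h3]
    · rw [map_add, map_add, hs, ht]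
    · rw [map_mul, map_mul, hs, ht]
  obtain ⟨g, -, hgf⟩ := exists_body (Fat.part0 u)
  -- Agreement on functions gives `u` and `v` the same underlying map, so both can be tested on a
  -- polynomial representative at the same point.
  have hgf' : ∀ y f, GSym.aug (W.evAt y (Fat.part0 v (V.ofFun f))) = f (g y) := fun y f => by
    rw [← h0, hgf]
  have hδ : ∀ (w : V.funAlg ⟶ fatPoint.alg.tensor W.funAlg) f s, Fat.part1 w (V.ofFun f * s) =
      Fat.part1 w (V.ofFun f) * Fat.part0 w s + Fat.part0 w (V.ofFun f) * Fat.part1 w s :=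
    fun w f s => by rw [Fat.part1_mul w (V.ofFun_mem f), uzpow_zero, one_smul]
  refine Fat.hom_ext (fun s => funAlg_ext fun y => ?_) (fun s => funAlg_ext fun y => ?_)
  · obtain ⟨p, hp, hsp⟩ := V.exists_poly s (g y)
    have e1 := (isLocalAt_of_aug (hgf y)).congr hsp
    have e2 := (isLocalAt_of_aug (hgf' y)).congr hsp
    refine e1.trans (Eq.trans ?_ e2.symm)
    exact congrArg (fun z => W.evAt y (Fat.comp W.funAlg Fat.c0 z)) (hpoly p hp)
  · obtain ⟨p, hp, hsp⟩ := V.exists_poly s (g y)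
    have e1 := (isLocalAt_derivation (hgf y) _ (hδ u)).congr hsp
    have e2 := (isLocalAt_derivation (hgf' y) _ (hδ v)).congr hsp
    refine e1.trans (Eq.trans ?_ e2.symm)
    exact congrArg (fun z => W.evAt y (Fat.comp W.funAlg Fat.c1 z)) (hpoly p hp)

/-- A morphism is determined by its values on functions and sections. -/
theorem hom_ext {ψ χ : V.funAlg ⟶ W.funAlg}
    (h0 : ∀ f, GrAlg.toAlgHom ψ (V.ofFun f) = GrAlg.toAlgHom χ (V.ofFun f))
    (h1 : ∀ i σ, GrAlg.toAlgHom ψ (V.ofSec i σ) = GrAlg.toAlgHom χ (V.ofSec i σ)) : ψ = χ := by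
  obtain ⟨g, -, hgf⟩ := exists_body (GrAlg.toAlgHom ψ)
  refine GrAlg.hom_ext_apply fun s => funAlg_ext fun y => ?_
  have h2 : (W.evAt y).comp (GrAlg.toAlgHom ψ) = (W.evAt y).comp (GrAlg.toAlgHom χ) :=
    algHom_ext (isLocalAt_of_aug (hgf y)) (isLocalAt_of_aug fun f => by rw [← h0, hgf])
      (fun f => congrArg (W.evAt y) (h0 f)) (fun i σ => congrArg (W.evAt y) (h1 i σ))
  exact DFunLike.congr_fun h2 s

/-- A morphism from the functions on the shifted tangent bundle is determined by its values on
functions, on sections of `V^*`, on differentials and on `σ[1] + ∇σ`. -/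
theorem hom_tangentShift_ext (nabla : ∀ i, (V i).dual.Conn) {ψ χ : V.tangentShift.funAlg ⟶ W.funAlg}
    (h0 : ∀ f, GrAlg.toAlgHom ψ (V.tangentShift.ofFun f) =
      GrAlg.toAlgHom χ (V.tangentShift.ofFun f))
    (hT : ∀ f, GrAlg.toAlgHom ψ (V.algT (Mfd.dFun f)) = GrAlg.toAlgHom χ (V.algT (Mfd.dFun f)))
    (hV : ∀ i σ, GrAlg.toAlgHom ψ (V.algV i σ) = GrAlg.toAlgHom χ (V.algV i σ))
    (hS : ∀ i σ, GrAlg.toAlgHom ψ (V.shiftAlg i σ + V.connAlg (nabla i) σ) =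
      GrAlg.toAlgHom χ (V.shiftAlg i σ + V.connAlg (nabla i) σ)) : ψ = χ := by
  obtain ⟨g, -, hgf⟩ := exists_body (GrAlg.toAlgHom ψ)
  have hψ := fun y => isLocalAt_of_aug (hgf y)
  have hχ := fun y => isLocalAt_of_aug (φ := GrAlg.toAlgHom χ) (x := g y) (y := y)
    fun f => by rw [← h0, hgf]
  have hloc : ∀ y (s t : V.tangentShift.funAlg),
      (∀ᶠ x in 𝓝 (g y), V.tangentShift.evAt x s = V.tangentShift.evAt x t) →
      GrAlg.toAlgHom ψ t = GrAlg.toAlgHom χ t →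
      W.evAt y (GrAlg.toAlgHom ψ s) = W.evAt y (GrAlg.toAlgHom χ s) := fun y s t h1 h2 =>
    ((hψ y).congr h1).trans ((congrArg (W.evAt y) h2).trans ((hχ y).congr h1).symm)
  have hα : ∀ α, GrAlg.toAlgHom ψ (V.algT α) = GrAlg.toAlgHom χ (V.algT α) := fun α =>
    funAlg_ext fun y => by
      obtain ⟨h, X, hX, -⟩ := M.exists_coordinates (g y)
      refine hloc y _ (∑ a, V.tangentShift.ofFun (VB.pair α (X a)) * V.algT (Mfd.dFun (h a))) ?_ ?_
      · exact algT_eventuallyEq hX α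
      · rw [map_sum, map_sum]
        exact Finset.sum_congr rfl fun a _ => by rw [map_mul, map_mul, h0, hT]
  -- Agreement on `∇σ` follows from agreement on differentials and on `V^*`. It is needed to extract
  -- `σ[1]` from `σ[1] + ∇σ`.
  have hC : ∀ i σ, GrAlg.toAlgHom ψ (V.connAlg (nabla i) σ) =
      GrAlg.toAlgHom χ (V.connAlg (nabla i) σ) := fun i σ =>
    funAlg_ext fun y => by
      obtain ⟨h, X, hX, -⟩ := M.exists_coordinates (g y)
      refine hloc y _ _ (genConn_eventuallyEq (nabla i) hX σ) ?_
      rw [map_sum, map_sum]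
      exact Finset.sum_congr rfl fun a _ => by rw [map_mul, map_mul, hT, hV]
  refine hom_ext h0 fun i τ => ?_
  refine V.sec_induction (P := fun i τ => GrAlg.toAlgHom ψ (V.tangentShift.ofSec i τ) =
    GrAlg.toAlgHom χ (V.tangentShift.ofSec i τ)) hV hα (fun j σ => ?_) (fun i σ τ hσ hτ => ?_) i τ
  · have h1 := hS (1 + j) σ
    rw [map_add, map_add, hC, shiftAlg_eq] at h1
    exact add_right_cancel h1
  · have h1 : V.tangentShift.ofSec i (σ + τ) =
      V.tangentShift.ofSec i σ + V.tangentShift.ofSec i τ := (V.tangentShift.ofSecLin i).map_add σ τ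
    rw [h1, map_add, map_add, hσ, hτ]

end GVB

/-! ### Existence of connections -/

namespace VB
variable {M : Mfd}

/-- A family of homomorphisms is smooth if it maps smooth sections to smooth sections. -/
theorem contMDiff_hom {E F : VB M} {A : ∀ x, E.Fiber x →L[ℝ] F.Fiber x}
    (h : ∀ v : E.Sec, ContMDiff (𝓡 M.dim) ((𝓡 M.dim).prod 𝓘(ℝ, F.Model)) ∞
      fun z => TotalSpace.mk' F.Model z (A z (v z))) :
    ContMDiff (𝓡 M.dim) ((𝓡 M.dim).prod 𝓘(ℝ, E.Model →L[ℝ] F.Model)) ∞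
      (fun x => TotalSpace.mk' (E.Model →L[ℝ] F.Model)
        (E := fun x => E.Fiber x →L[ℝ] F.Fiber x) x (A x)) := by
  intro x
  obtain ⟨e, he, -⟩ := exists_frame E x
  rw [contMDiffAt_hom_bundle]
  refine ⟨contMDiffAt_id, ?_⟩
  let b := Module.finBasis ℝ E.Model
  let t := trivializationAt E.Model E.Fiber x
  have hx : x ∈ t.baseSet := FiberBundle.mem_baseSet_trivializationAt' x
  let t' := trivializationAt F.Model F.Fiber x
  have hx' : x ∈ t'.baseSet := FiberBundle.mem_baseSet_trivializationAt' x
  have hs : ContMDiffAt (𝓡 M.dim) 𝓘(ℝ, E.Model →L[ℝ] F.Model) ∞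
      (fun z => ∑ k, ContinuousLinearMap.smulRightL ℝ E.Model F.Model
        (LinearMap.toContinuousLinearMap (b.coord k)) (t' ⟨z, A z (e k z)⟩).2) x :=
    contMDiffAt_finsetSum fun k _ =>
      (ContinuousLinearMap.contMDiff _).contMDiffAt.comp x ((contMDiffAt_section x).1 (h (e k) x))
  refine hs.congr_of_eventuallyEq ?_
  filter_upwards [he, t.open_baseSet.mem_nhds hx, t'.open_baseSet.mem_nhds hx'] with z hz hzt hzt'
  rw [ContinuousLinearMap.inCoordinates_eq hzt hzt']
  refine ContinuousLinearMap.coe_injective (b.ext fun l => ?_)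
  have h3 : (t.continuousLinearEquivAt ℝ z hzt).symm (b l) = e l z := by
    rw [ContinuousLinearEquiv.symm_apply_eq, ← hz l]
    exact congrFun (t.coe_linearMapAt_of_mem (R := ℝ) hzt) _
  simp only [FunLike.coe_sum, ContinuousLinearMap.coe_coe, Finset.sum_apply]
  have h4 : ∀ k, (ContinuousLinearMap.smulRightL ℝ E.Model F.Model
      (LinearMap.toContinuousLinearMap (b.coord k)) (t' ⟨z, A z (e k z)⟩).2) (b l) =
      if l = k then (t' ⟨z, A z (e k z)⟩).2 else 0 := by
    intro k
    simp [Finsupp.single_apply]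
  change t'.continuousLinearEquivAt ℝ z hzt'
    (A z ((t.continuousLinearEquivAt ℝ z hzt).symm (b l))) = _
  rw [h3]
  refine Eq.trans ?_ (Finset.sum_congr rfl fun k _ => h4 k).symm
  rw [Finset.sum_ite_eq, if_pos (Finset.mem_univ l)]
  rfl

/-- Near every point there are a frame and its dual frame, given by global sections. -/
theorem exists_coframe (E : VB M) (x : M) :
    ∃ (e : Fin (Module.finrank ℝ E.Model) → E.Sec) (α : Fin (Module.finrank ℝ E.Model) → E.dual.Sec),
      ∀ᶠ z in 𝓝 x, ∀ v : E.Fiber z, v = ∑ k, (α k z v : ℝ) • e k z := by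
  let t := trivializationAt E.Model E.Fiber x
  have hx : x ∈ t.baseSet := FiberBundle.mem_baseSet_trivializationAt' x
  let b := Module.finBasis ℝ E.Model
  obtain ⟨e, he, -⟩ := exists_frame E x
  obtain ⟨χ, hχ, hχ'⟩ := Mfd.exists_bump (t.open_baseSet.mem_nhds hx)
  have hα : ∀ k, ∃ α : E.dual.Sec, ∀ z v, α z v = χ z * b.coord k (t.continuousLinearMapAt ℝ z v) := by
    intro k
    refine ⟨⟨fun z => χ z • ((LinearMap.toContinuousLinearMap (b.coord k)).comp
      (t.continuousLinearMapAt ℝ z)), contMDiff_dual fun v => ?_⟩, fun z v => rfl⟩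
    refine contMDiff_of_tsupport fun z hz => ?_
    have hz' : z ∈ t.baseSet := hχ' (closure_mono (Function.support_mul_subset_left _ _) hz)
    have h1 : ContMDiffAt (𝓡 M.dim) 𝓘(ℝ, E.Model) ∞
        (fun z => (t ⟨z, v z⟩).2) z :=
      ((t.contMDiffAt_section_iff (IB := 𝓡 M.dim) hz').1 (v.contMDiff z))
    have h2 := (LinearMap.toContinuousLinearMap (b.coord k)).contMDiff.contMDiffAt.comp z h1
    refine (χ.contMDiff.contMDiffAt.mul h2).congr_of_eventuallyEq ?_
    filter_upwards [t.open_baseSet.mem_nhds hz'] with y hy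
    exact congrArg (fun m => χ y * b.coord k m) (congrFun (t.coe_linearMapAt_of_mem (R := ℝ) hy) _)
  choose α hα using hα
  refine ⟨e, α, ?_⟩
  filter_upwards [he, hχ, t.open_baseSet.mem_nhds hx] with z hz hz1 hzt v
  apply (t.continuousLinearEquivAt ℝ z hzt).injective
  rw [map_sum]
  have h3 : ∀ w, t.continuousLinearEquivAt ℝ z hzt w = t.continuousLinearMapAt ℝ z w := fun w =>
    (congrFun (t.coe_linearMapAt_of_mem (R := ℝ) hzt) _).symm
  refine (b.sum_repr _).symm.trans (Finset.sum_congr rfl fun k _ => ?_)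
  rw [map_smul, hα, hz1, one_mul, h3, h3, ← hz k]
  rfl

theorem mdifferentiableAt_pair {E : VB M} (α : E.dual.Sec) {σ : ∀ x, E.Fiber x} {x : M}
    (hσ : MDifferentiableAt (𝓡 M.dim) ((𝓡 M.dim).prod 𝓘(ℝ, E.Model))
      (fun x => TotalSpace.mk' E.Model x (σ x)) x) :
    MDifferentiableAt (𝓡 M.dim) 𝓘(ℝ, ℝ) (fun z => (α z (σ z) : ℝ)) x := by
  have h := MDifferentiableAt.clm_bundle_apply (b := id)
    (α.contMDiff.contMDiffAt.mdifferentiableAt (x := x) (by simp)) hσ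
  exact ((mdifferentiableAt_totalSpace (𝓡 M.dim) _).1 h).2

/-- The flat covariant derivative given by a frame `e` with dual frame `α`. -/
def frameCov {E : VB M} {n : ℕ} (e : Fin n → E.Sec) (α : Fin n → E.dual.Sec)
    (σ : ∀ x, E.Fiber x) (x : M) : TangentSpace (𝓡 M.dim) x →L[ℝ] E.Fiber x :=
  ∑ k, (mvfderiv (𝓡 M.dim) (fun z => (α k z (σ z) : ℝ)) x).smulRight (e k x)

/-- Every vector bundle has a connection. -/
theorem exists_conn (E : VB M) : Nonempty E.Conn := by
  choose e α hα using E.exists_coframe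
  choose U hU hUo hxU using fun x => eventually_nhds_iff.1 (hα x)
  obtain ⟨ρ, hρ⟩ := SmoothPartitionOfUnity.exists_isSubordinate (𝓡 M.dim)
    (isClosed_univ (X := M)) U hUo (fun x _ => Set.mem_iUnion.2 ⟨x, hxU x⟩)
  -- A convex combination of local covariant derivatives is again one: the Leibniz terms are
  -- averaged with weights of sum `1`. The frame derivatives are defined everywhere and meaningful
  -- only on `U i`, where the weights are supported.
  let cov : (∀ x, E.Fiber x) → ∀ x : M, TangentSpace (𝓡 M.dim) x →L[ℝ] E.Fiber x := fun σ x =>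
    ∑ i ∈ ρ.finsupport x, ρ i x • frameCov (e i) (α i) σ x
  refine ⟨⟨⟨cov, ⟨?_, ?_⟩⟩, ⟨⟨?_⟩⟩⟩⟩
  · intro σ τ x hσ hτ _
    change cov _ x = cov _ x + cov _ x
    simp only [cov]
    rw [← Finset.sum_add_distrib]
    refine Finset.sum_congr rfl fun i _ => ?_
    rw [← smul_add, frameCov, frameCov, frameCov, ← Finset.sum_add_distrib]
    congr 1
    refine Finset.sum_congr rfl fun k _ => ?_
    have h1 : (fun z => (α i k z ((σ + τ) z) : ℝ)) =
        (fun z => (α i k z (σ z) : ℝ)) + fun z => (α i k z (τ z) : ℝ) :=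
      funext fun z => map_add (α i k z) (σ z) (τ z)
    rw [h1, mvfderiv_add (mdifferentiableAt_pair _ hσ) (mdifferentiableAt_pair _ hτ)]
    exact ContinuousLinearMap.ext fun v => add_smul _ _ _
  · intro σ g x hσ hg _
    have key : ∀ i ∈ ρ.finsupport x, frameCov (e i) (α i) (g • σ) x =
        g x • frameCov (e i) (α i) σ x + (mvfderiv (𝓡 M.dim) g x).smulRight (σ x) := by
      intro i hi
      have hxi : x ∈ U i := hρ i (subset_closure ((ρ.mem_finsupport x).1 hi))
      refine ContinuousLinearMap.ext fun v => ?_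
      have h2 : ∀ k, mvfderiv (𝓡 M.dim) (fun z => (α i k z ((g • σ) z) : ℝ)) x v =
          g x * mvfderiv (𝓡 M.dim) (fun z => (α i k z (σ z) : ℝ)) x v +
            α i k x (σ x) * mvfderiv (𝓡 M.dim) g x v := by
        intro k
        have h1 : (fun z => (α i k z ((g • σ) z) : ℝ)) = g * fun z => (α i k z (σ z) : ℝ) :=
          funext fun z => map_smul (α i k z) (g z) (σ z)
        rw [h1, mvfderiv_mul hg (mdifferentiableAt_pair _ hσ)]
        rfl
      change frameCov (e i) (α i) (g • σ) x v =
        g x • frameCov (e i) (α i) σ x v + mvfderiv (𝓡 M.dim) g x v • σ x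
      simp only [frameCov, sum_apply, ContinuousLinearMap.smulRight_apply]
      conv_rhs => rw [hU i x hxi (σ x)]
      rw [Finset.smul_sum, Finset.smul_sum, ← Finset.sum_add_distrib]
      refine Finset.sum_congr rfl fun k _ => ?_
      rw [h2 k, smul_smul, smul_smul, ← add_smul, mul_comm (α i k x (σ x) : ℝ)]
    change cov _ x = g x • cov _ x + _
    simp only [cov]
    rw [Finset.sum_congr rfl fun i hi => congrArg (ρ i x • ·) (key i hi)]
    simp only [smul_add]
    rw [Finset.sum_add_distrib, ← Finset.sum_smul, ρ.sum_finsupport x (Set.mem_univ x), one_smul,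
      Finset.smul_sum]
    congr 1
    exact Finset.sum_congr rfl fun i _ => smul_comm _ _ _
  · intro σ hσ
    refine ContMDiff.contMDiffOn ?_
    let σ' : E.Sec := ⟨σ, contMDiffOn_univ.1 (hσ.of_le (by simp))⟩
    refine contMDiff_hom (E := VB.tangent M) (F := E) fun X => ?_
    let s : M → E.Sec := fun i => fsmul (ρ i) (∑ k, fsmul (pair (Mfd.dFun (pair (α i k) σ')) X) (e i k))
    have hs : ∀ i x, s i x = ρ i x • frameCov (e i) (α i) σ x (X x) := by
      intro i x
      change ρ i x • (∑ k, fsmul (pair (Mfd.dFun (pair (α i k) σ')) X) (e i k) : E.Sec) x = _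
      congr 1
      rw [frameCov, sum_apply]
      have h2 : ∀ f : Fin (Module.finrank ℝ E.Model) → E.Sec, (∑ k, f k : E.Sec) x = ∑ k, f k x :=
        fun f => map_sum (AddMonoidHom.mk' (fun τ : E.Sec => τ x) fun _ _ => rfl) f Finset.univ
      exact h2 _
    -- The finite index set in `cov` depends on the point, so smoothness is shown for the locally
    -- finite sum over all indices, which has the same value.
    have h1 := ContMDiff.finsum_section_of_locallyFinite (t := fun i x => s i x)
      (I := 𝓡 M.dim) (n := ∞) (F := E.Model) (V := E.Fiber)
      (ρ.locallyFinite.subset fun i x hx h => hx (by rw [hs, h, zero_smul])) fun i => (s i).contMDiff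
    refine h1.congr fun x => ?_
    congr 1
    simp only [hs]
    change (∑ i ∈ ρ.finsupport x, ρ i x • frameCov (e i) (α i) σ x) (X x) = _
    rw [sum_apply]
    refine (finsum_eq_sum_of_support_subset _ fun i hi => ?_).symm
    exact (ρ.mem_finsupport x).2 fun h => hi (by
      change ρ i x • frameCov (e i) (α i) σ x (X x) = 0
      rw [show ρ i x = 0 from h, zero_smul])

end VB

/-! ### Representability -/

theorem GrAlg.tensorMap_comp (A : GrAlg) {B C E : GrAlg} (f : B ⟶ C) (g : C ⟶ E) :
    A.tensorMap (f ≫ g) = A.tensorMap f ≫ A.tensorMap g := A.tensorLeft.map_comp f g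

theorem GrAlg.tensorMap_id (A B : GrAlg) : A.tensorMap (𝟙 B) = 𝟙 (A.tensor B) :=
  A.tensorLeft.map_id B

namespace GVB
variable {M : Mfd} {V : GVB M}

/-- The morphism `f ↦ f + ε df`, `σ ↦ σ + ε (σ[1] + ∇σ)`. -/
structure IsUniversal (nabla : ∀ i, (V i).dual.Conn)
    (u : V.funAlg ⟶ fatPoint.alg.tensor V.tangentShift.funAlg) : Prop where
  part0_ofFun : ∀ f, Fat.part0 u (V.ofFun f) = V.tangentShift.ofFun f
  part1_ofFun : ∀ f, Fat.part1 u (V.ofFun f) = V.algT (Mfd.dFun f)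
  part0_ofSec : ∀ i σ, Fat.part0 u (V.ofSec i σ) = V.algV i σ
  part1_ofSec : ∀ i σ, Fat.part1 u (V.ofSec i σ) = V.shiftAlg i σ + V.connAlg (nabla i) σ

namespace IsUniversal
variable {nabla : ∀ i, (V i).dual.Conn}
  {u : V.funAlg ⟶ fatPoint.alg.tensor V.tangentShift.funAlg}

theorem unique {v : V.funAlg ⟶ fatPoint.alg.tensor V.tangentShift.funAlg}
    (hu : IsUniversal nabla u) (hv : IsUniversal nabla v) : u = v :=
  hom_tensor_ext (fun f => (hu.part0_ofFun f).trans (hv.part0_ofFun f).symm)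
    (fun f => (hu.part1_ofFun f).trans (hv.part1_ofFun f).symm)
    (fun i σ => (hu.part0_ofSec i σ).trans (hv.part0_ofSec i σ).symm)
    (fun i σ => (hu.part1_ofSec i σ).trans (hv.part1_ofSec i σ).symm)

theorem exists_factor (hu : IsUniversal nabla u) {N : Mfd} {W : GVB N}
    (v : V.funAlg ⟶ fatPoint.alg.tensor W.funAlg) :
    ∃ ψ : V.tangentShift.funAlg ⟶ W.funAlg, u ≫ fatPoint.alg.tensorMap ψ = v := by
  obtain ⟨ψ, h0, h1, h2, h3⟩ := exists_lift nabla v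
  refine ⟨ψ, hom_tensor_ext (fun f => ?_) (fun f => ?_) (fun i σ => ?_) (fun i σ => ?_)⟩
  · rw [Fat.part0_comp_tensorMap, hu.part0_ofFun, h0]
  · rw [Fat.part1_comp_tensorMap, hu.part1_ofFun, h1]
  · rw [Fat.part0_comp_tensorMap, hu.part0_ofSec, h2]
  · rw [Fat.part1_comp_tensorMap, hu.part1_ofSec, h3]

/-- The coefficients of `u` on functions and sections are exactly the elements on which
`hom_tangentShift_ext` tests a morphism. -/
theorem factor_unique (hu : IsUniversal nabla u) {N : Mfd} {W : GVB N}
    {ψ χ : V.tangentShift.funAlg ⟶ W.funAlg} (h : u ≫ fatPoint.alg.tensorMap ψ = u ≫ fatPoint.alg.tensorMap χ) : ψ = χ := by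
  have e0 : ∀ a, GrAlg.toAlgHom ψ (Fat.part0 u a) = GrAlg.toAlgHom χ (Fat.part0 u a) := fun a => by
    rw [← Fat.part0_comp_tensorMap, h, Fat.part0_comp_tensorMap]
  have e1 : ∀ a, GrAlg.toAlgHom ψ (Fat.part1 u a) = GrAlg.toAlgHom χ (Fat.part1 u a) := fun a => by
    rw [← Fat.part1_comp_tensorMap, h, Fat.part1_comp_tensorMap]
  refine hom_tangentShift_ext nabla (fun f => ?_) (fun f => ?_) (fun i σ => ?_) (fun i σ => ?_)
  · rw [← hu.part0_ofFun, e0]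
  · rw [← hu.part1_ofFun, e1]
  · rw [← hu.part0_ofSec, e0]
  · rw [← hu.part1_ofSec, e1]

/-- Every test object has some splitting, so the split case carries over along an isomorphism of
function algebras. -/
theorem bijective (hu : IsUniversal nabla u) (T : ZMfd) : Function.Bijective
    fun ψ : V.tangentShift.funAlg ⟶ T.alg => u ≫ fatPoint.alg.tensorMap ψ := by
  obtain ⟨N, W, ⟨i⟩⟩ := T.exists_splitting
  refine ⟨fun ψ χ h => ?_, fun v => ?_⟩
  · have h1 : ψ ≫ i.hom = χ ≫ i.hom := hu.factor_unique (by
      rw [GrAlg.tensorMap_comp, GrAlg.tensorMap_comp, ← Category.assoc, ← Category.assoc]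
      exact congrArg (· ≫ fatPoint.alg.tensorMap i.hom) h)
    exact (cancel_mono i.hom).1 h1
  · obtain ⟨ψ, hψ⟩ := hu.exists_factor (v ≫ fatPoint.alg.tensorMap i.hom)
    refine ⟨ψ ≫ i.inv, ?_⟩
    change u ≫ fatPoint.alg.tensorMap (ψ ≫ i.inv) = v
    rw [GrAlg.tensorMap_comp, ← Category.assoc, hψ, Category.assoc, ← GrAlg.tensorMap_comp,
      i.hom_inv_id, GrAlg.tensorMap_id, Category.comp_id]

/-- The functor of points `Hom (D, X)` is represented by the shifted tangent bundle. -/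
def representableBy (hu : IsUniversal nabla u) {X : ZMfd} (s : X.Splitting V) :
    (fatPoint.innerHom X).RepresentableBy (ZMfd.split V.tangentShift) where
  homEquiv {T} := (Equiv.ofBijective _ (hu.bijective T)).trans
    { toFun := fun v => s.hom ≫ v
      invFun := fun v => s.inv ≫ v
      left_inv := fun v => s.inv_hom_id_assoc v
      right_inv := fun v => s.hom_inv_id_assoc v }
  homEquiv_comp {T T'} f g := by
    change s.hom ≫ u ≫ fatPoint.alg.tensorMap (ZMfd.pullback g ≫ ZMfd.pullback f) =
      (s.hom ≫ u ≫ fatPoint.alg.tensorMap (ZMfd.pullback g)) ≫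
        fatPoint.alg.tensorMap (ZMfd.pullback f)
    have h := GrAlg.tensorMap_comp fatPoint.alg (B := V.tangentShift.funAlg) (ZMfd.pullback g)
      (ZMfd.pullback f)
    refine (congrArg (fun z => s.hom ≫ u ≫ z) h).trans ?_
    rw [Category.assoc, Category.assoc]

theorem representableBy_homEquiv (hu : IsUniversal nabla u) {X : ZMfd} (s : X.Splitting V)
    {T : ZMfd} (f : T ⟶ ZMfd.split V.tangentShift) :
    (hu.representableBy s).homEquiv f =
      s.hom ≫ u ≫ fatPoint.alg.tensorMap (ZMfd.pullback f) := rfl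

end IsUniversal

/-- A tensor determines its coefficients of `1` and `ε`, and elements of a function algebra are
determined by their values. Hence the elementwise condition fixes both coefficients of the
transported morphism. -/
theorem isInducedSplitting_iff {X : ZMfd} (s : X.Splitting V) (nabla : ∀ i, (V i).dual.Conn)
    {R : ZMfd} (v : X.alg ⟶ fatPoint.alg.tensor R.alg) (e : R.Splitting V.tangentShift) :
    IsInducedSplitting s nabla v e ↔
      IsUniversal nabla (s.inv ≫ v ≫ fatPoint.alg.tensorMap e.hom) := by
  let w := s.inv ≫ v ≫ fatPoint.alg.tensorMap e.hom
  have hw : ∀ a : V.funAlg, (fatPoint.alg.tensorMap e.hom (v (s.inv a)) :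
      GrAlg.Tensor fatPoint.alg V.tangentShift.funAlg) = Fat.pack (Fat.part0 w a) (Fat.part1 w a) :=
    fun a => Fat.apply_eq w a
  constructor
  · intro h
    have hf : ∀ f, Fat.part0 w (V.ofFun f) = V.tangentShift.ofFun f ∧
        Fat.part1 w (V.ofFun f) = V.algT (Mfd.dFun f) := by
      intro f
      obtain ⟨a, b, ha, hb, hab⟩ := h.on_functions f
      obtain ⟨h0, h1⟩ := Fat.pack_inj ((hw _).symm.trans hab)
      exact ⟨h0.trans (funAlg_ext ha), h1.trans (funAlg_ext hb)⟩
    have hs : ∀ i σ, Fat.part0 w (V.ofSec i σ) = V.algV i σ ∧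
        Fat.part1 w (V.ofSec i σ) = V.shiftAlg i σ + V.connAlg (nabla i) σ := by
      intro i
      obtain ⟨j, rfl⟩ : ∃ j, i = 1 + j := ⟨i - 1, by ring⟩
      intro σ
      obtain ⟨a, b, ha, hb, hab⟩ := h.on_sections j σ
      obtain ⟨h0, h1⟩ := Fat.pack_inj ((hw _).symm.trans hab)
      refine ⟨h0.trans (funAlg_ext ha), h1.trans (funAlg_ext fun x => (hb x).trans ?_)⟩
      rw [map_add, shiftAlg_eq]
      rfl
    exact ⟨fun f => (hf f).1, fun f => (hf f).2, fun i σ => (hs i σ).1, fun i σ => (hs i σ).2⟩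
  · intro h
    refine ⟨fun f => ⟨_, _, fun x => ?_, fun x => ?_, hw _⟩,
      fun j σ => ⟨_, _, fun x => ?_, fun x => ?_, hw _⟩⟩
    · rw [h.part0_ofFun]
      rfl
    · rw [h.part1_ofFun]
      rfl
    · rw [h.part0_ofSec]
      rfl
    · rw [h.part1_ofSec, shiftAlg_eq]
      rfl

end GVB
end ZGraded

end

/-! ### The theorem: representability, and the induced splitting by the Yoneda argument -/

open ZGraded
theorem theorem2p10 {M : Mfd} (V : GVB M) (X : ZMfd) (s : X.Splitting V) :
    (fatPoint.innerHom X).IsRepresentable ∧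
    ∀ (nabla : ∀ i, (V i).dual.Conn) (R : ZMfd) (rep : (fatPoint.innerHom X).RepresentableBy R),
      ∃! e : R.Splitting V.tangentShift,
        IsInducedSplitting s nabla (rep.homEquiv (𝟙 R)) e := by
  have huniv : ∀ nabla : ∀ i, (V i).dual.Conn, ∃ u, GVB.IsUniversal nabla u := fun nabla => by
    obtain ⟨u, h0, h1, h2, h3⟩ := GVB.exists_univ V nabla
    exact ⟨u, h0, h1, h2, h3⟩
  refine ⟨?_, fun nabla R rep => ?_⟩
  -- Representability does not refer to a connection, so an arbitrary one is chosen.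
  · obtain ⟨u, hu⟩ := huniv fun i => Classical.choice (V i).dual.exists_conn
    exact (hu.representableBy s).isRepresentable
  obtain ⟨u, hu⟩ := huniv nabla
  have key : ∀ f : ZMfd.split V.tangentShift ⟶ R, rep.homEquiv f =
      rep.homEquiv (𝟙 R) ≫ fatPoint.alg.tensorMap (ZMfd.pullback f) := fun f => rep.homEquiv_eq f
  let p := hu.representableBy s
  -- This is the Yoneda isomorphism between two representing objects, characterized by matching
  -- their universal elements. Morphisms of graded manifolds reverse those of algebras, so `φ.hom`
  -- pulls back to an algebra morphism out of `R.alg`, as a splitting requires.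
  let φ : ZMfd.split V.tangentShift ≅ R :=
    { hom := rep.homEquiv.symm (p.homEquiv (𝟙 _))
      inv := p.homEquiv.symm (rep.homEquiv (𝟙 _))
      hom_inv_id := p.homEquiv.injective (by
        rw [p.homEquiv_comp, Equiv.apply_symm_apply, ← rep.homEquiv_eq, Equiv.apply_symm_apply])
      inv_hom_id := rep.homEquiv.injective (by
        rw [rep.homEquiv_comp, Equiv.apply_symm_apply, ← p.homEquiv_eq, Equiv.apply_symm_apply]) }
  have hφ : rep.homEquiv φ.hom = s.hom ≫ u := by
    refine (Equiv.apply_symm_apply _ _).trans ((hu.representableBy_homEquiv s _).trans ?_)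
    exact congrArg (s.hom ≫ ·) ((congrArg (u ≫ ·) (GrAlg.tensorMap_id _ _)).trans
      (Category.comp_id u))
  refine ⟨⟨ZMfd.pullback φ.hom, ZMfd.pullback φ.inv, φ.inv_hom_id, φ.hom_inv_id⟩, ?_, ?_⟩
  · refine (GVB.isInducedSplitting_iff s nabla _ _).2 ?_
    have h1 := (key φ.hom).symm.trans hφ
    exact ((congrArg (s.inv ≫ ·) h1).trans (s.inv_hom_id_assoc u)) ▸ hu
  · intro e he
    -- Any induced splitting carries the universal element of `R` to the same `u`, and a map into a
    -- representing object is determined by the element it corresponds to.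
    have h1 := hu.unique ((GVB.isInducedSplitting_iff s nabla _ _).1 he)
    have h2 : rep.homEquiv (X := ZMfd.split V.tangentShift) e.hom = s.hom ≫ u := by
      refine (key e.hom).trans ?_
      rw [h1]
      exact (s.hom_inv_id_assoc _).symm
    exact Iso.ext (rep.homEquiv.injective (h2.trans hφ.symm))
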